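/- Let $p$ be an odd prime, let $m=2s\ge 4$, and let $l$ be an integer with $0\le l\le m-1$ and $l\ne s$. Put $q=p^m$, $n=q-1$, $d=\gcd(s,l)$ and $d'=\gcd(s+l,2l)$. Let $\alpha$ be a primitive element of $\mathbb F_q$, and let $\mathbb C$ be the cyclic code over $\mathbb F_p$ of length $n$ whose parity-check polynomial is $h_1(x)h_{p^s+1}(x)h_{p^l+1}(x)$, where $h_i(x)$ denotes the minimal polynomial of $\alpha^i$ over $\mathbb F_p$ (that is, the generator polynomial of $\mathbb C$ is $(x^n-1)/(h_1h_{p^s+1}h_{p^l+1})$). For a linear code $\mathcal C$ let $\mathcal C^\bot$ be its dual, and let $\overline{\mathcal C}$ be its extended code, obtained by appending to each codeword a last coordinate that makes the sum of all its coordinates zero. For $r\ge 1$ write $\mathrm{Tr}_r(x)=x+x^p+\dots+x^{p^{r-1}}$ for the trace from $\mathbb F_{p^r}$ to $\mathbb F_p$. Then $\overline{\mathbb C^\bot}^{\bot}$ has length $p^m$ and dimension $\frac{5m}{2}+1$ over $\mathbb F_p$. If the coordinates are labelled by the elements of $\mathbb F_q$, coordinate $i\in\{0,\dots,n-1\}$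 by $\alpha^{-i}$ and the appended coordinate by $0$, then $$\overline{\mathbb C^\bot}^{\bot}=\Big\{\big(\mathrm{Tr}_s(ax^{p^s+1})+\mathrm{Tr}_m(bx^{p^l+1}+cx)+h\big)_{x\in\mathbb F_q}: a\in\mathbb F_{p^s},\ b,c\in\mathbb F_q,\ h\in\mathbb F_p\Big\}.$$ Moreover $d'\in\{d,2d\}$, and the number of codewords of each Hamming weight is given by the following tables. Weights not listed do not occur; rows whose weights happen to coincide are to be merged by adding their multiplicities; a row with $\pm$ stands for two rows, each with the stated multiplicity. (1) If $d'=d$ is odd, there are at most ten nonzero weights, and the weight distribution is $$\begin{array}{l|l} \text{Weight}&\text{Multiplicity}\\\hline 0&1\\ (p-1)(p^{m-1}-p^{s-1})&\frac12p^{m+d}(p^s+1)(p^m-1)/(p^d+1)\\ p^{m-1}(p-1)+p^{s-1}&\frac12p^{m+d}(p-1)(p^s+1)(p^m-1)/(p^d+1)\\ (p-1)(p^{m-1}+p^{s-1})&\frac{p^{m+d}(p^m-2p^{m-d}+1)(p^s-1)}{2(p^d-1)}\\ p^{m-1}(p-1)-p^{s-1}&\frac{p^{m+d}(p-1)(p^m-2p^{m-d}+1)(p^s-1)}{2(p^d-1)}\\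 p^{m-1}(p-1)\pm(-1)^{\frac{p-1}2}p^{s+\frac{d-1}2}&\frac12p^{3s-2d}(p-1)(p^m-1)\\ p^{s+d-1}(p-1)(p^{s-d}+1)&p^{m-2d}(p^{s-d}-1)(p^m-1)/(p^{2d}-1)\\ p^{m-1}(p-1)-p^{s+d-1}&p^{m-2d}(p-1)(p^{s-d}-1)(p^m-1)/(p^{2d}-1)\\ p^{m-1}(p-1)&p(p^{3s-d}-p^{3s-2d}+p^{3s-2d-1}+p^{3s-3d}-p^{m-2d}+1)(p^m-1)\\ p^m&p-1 \end{array}$$ (2) If $d'=d$ is even, there are at most twelve nonzero weights, and the weight distribution is $$\begin{array}{l|l} \text{Weight}&\text{Multiplicity}\\\hline 0&1\\ p^{s-1}(p-1)(p^s-1)&\frac12p^{m+d}(p^s+1)(p^m-1)/(p^d+1)\\ p^{s-1}(p^{s+1}-p^s+1)&\frac12p^{m+d}(p-1)(p^s+1)(p^m-1)/(p^d+1)\\ p^{s-1}(p-1)(p^s+1)&\frac{p^{m+d}(p^m-2p^{m-d}+1)(p^s-1)}{2(p^d-1)}\\ p^{s-1}(p^{s+1}-p^s-1)&\frac{p^{m+d}(p-1)(p^m-2p^{m-d}+1)(p^s-1)}{2(p^d-1)}\\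 p^{s+\frac d2-1}(p-1)(p^{s-\frac d2}\pm1)&\frac12p^{3s-2d}(p^m-1)\\ p^{s+\frac d2-1}(p^{s-\frac d2+1}-p^{s-\frac d2}\pm1)&\frac12p^{3s-2d}(p-1)(p^m-1)\\ p^{s+d-1}(p-1)(p^{s-d}+1)&p^{m-2d}(p^{s-d}-1)(p^m-1)/(p^{2d}-1)\\ p^{s+d-1}(p^{s-d+1}-p^{s-d}-1)&p^{m-2d}(p-1)(p^{s-d}-1)(p^m-1)/(p^{2d}-1)\\ p^{m-1}(p-1)&p(p^{3s-d}-p^{3s-2d}+p^{3s-3d}-p^{m-2d}+1)(p^m-1)\\ p^m&p-1 \end{array}$$ (3) If $d'=2d$, there are at most eight nonzero weights, and the weight distribution is $$\begin{array}{l|l} \text{Weight}&\text{Multiplicity}\\\hline 0&1\\ p^{s-1}(p-1)(p^s+1)&\frac{p^{m+3d}(p^m-p^{m-2d}-p^{m-3d}+p^s-p^{s-d}+1)(p^s-1)}{(p^d+1)(p^{2d}-1)}\\ p^{s-1}(p^{s+1}-p^s-1)&\frac{p^{m+3d}(p-1)(p^m-p^{m-2d}-p^{m-3d}+p^s-p^{s-d}+1)(p^s-1)}{(p^d+1)(p^{2d}-1)}\\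 p^{s+d-1}(p-1)(p^{s-d}-1)&\frac{p^{m-d}(p^s+p^{s-d}+p^{s-2d}+1)(p^m-1)}{(p^d+1)^2}\\ p^{s+d-1}(p^{s-d+1}-p^{s-d}+1)&\frac{p^{m-d}(p-1)(p^s+p^{s-d}+p^{s-2d}+1)(p^m-1)}{(p^d+1)^2}\\ p^{s+2d-1}(p-1)(p^{s-2d}+1)&\frac{p^{m-4d}(p^{s-d}-1)(p^m-1)}{(p^d+1)(p^{2d}-1)}\\ p^{s+2d-1}(p^{s-2d+1}-p^{s-2d}-1)&\frac{p^{m-4d}(p-1)(p^{s-d}-1)(p^m-1)}{(p^d+1)(p^{2d}-1)}\\ p^{m-1}(p-1)&p(p^{3s-d}-p^{3s-2d}+p^{3s-3d}-p^{3s-4d}+p^{3s-5d}+p^{m-d}-2p^{m-2d}+p^{m-3d}-p^{m-4d}+1)(p^m-1)\\ p^m&p-1 \end{array}$$ -/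

import Mathlib

open Polynomial

/-- The polynomial `c_0 + c_1 X + ⋯ + c_{n-1} X^{n-1}` attached to a word `(c_0, …, c_{n-1})`. -/
noncomputable def wordPoly {k : Type*} [Field k] {n : ℕ} (c : Fin n → k) : k[X] :=
  ∑ i : Fin n, C (c i) * X ^ (i : ℕ)

/-- The code of length `n` consisting of the words whose polynomial is a multiple of `g`.
For `g ∣ X ^ n - 1` this is the cyclic code of length `n` with generator polynomial `g`. -/
noncomputable def cyclicCode {k : Type*} [Field k] (n : ℕ) (g : k[X]) :
    Submodule k (Fin n → k) where
  carrier := {c | g ∣ wordPoly c}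
  zero_mem' := by simp [wordPoly]
  add_mem' := by
    intro u v hu hv
    have h : wordPoly (u + v) = wordPoly u + wordPoly v := by
      simp [wordPoly, add_mul, Finset.sum_add_distrib]
    simpa [h] using dvd_add hu hv
  smul_mem' := by
    intro r u hu
    have h : wordPoly (r • u) = C r * wordPoly u := by
      simp [wordPoly, Finset.mul_sum, mul_assoc]
    simpa [h] using Dvd.dvd.mul_left hu (C r)

/-- The cyclic code of length `n` with (monic) parity-check polynomial `h`, that is, with
generator polynomial `(X ^ n - 1) / h`. -/
noncomputable def parityCheckCyclicCode {k : Type*} [Field k] (n : ℕ) (h : k[X]) :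
    Submodule k (Fin n → k) :=
  cyclicCode n ((X ^ n - 1) /ₘ h)

/-- The dual of a linear code, for the standard inner product. -/
def dualCode {k : Type*} [Field k] {n : ℕ} (D : Submodule k (Fin n → k)) :
    Submodule k (Fin n → k) where
  carrier := {v | ∀ c ∈ D, ∑ i, v i * c i = 0}
  zero_mem' := by simp
  add_mem' := by
    intro u v hu hv c hc
    simp [add_mul, Finset.sum_add_distrib, hu c hc, hv c hc]
  smul_mem' := by
    intro r u hu c hc
    simp [mul_assoc, ← Finset.mul_sum, hu c hc]

/-- The extended code: a last coordinate is appended that makes the sum of all coordinates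
zero. -/
def extendedCode {k : Type*} [Field k] {n : ℕ} (D : Submodule k (Fin n → k)) :
    Submodule k (Fin (n + 1) → k) where
  carrier := {c | (fun i : Fin n => c i.castSucc) ∈ D ∧ ∑ i, c i = 0}
  zero_mem' := ⟨D.zero_mem, by simp⟩
  add_mem' := by
    rintro u v ⟨hu, hu'⟩ ⟨hv, hv'⟩
    exact ⟨D.add_mem hu hv, by simp [Finset.sum_add_distrib, hu', hv']⟩
  smul_mem' := by
    rintro r u ⟨hu, hu'⟩
    exact ⟨D.smul_mem r hu, by simp [← Finset.mul_sum, hu']⟩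

/-- The non-binary Kasami cyclic code of length `p ^ m - 1`, with parity-check polynomial the
product of the minimal polynomials of `α`, `α ^ (p ^ s + 1)` and `α ^ (p ^ l + 1)`. -/
noncomputable def kasamiCode (p m s l : ℕ) [Fact p.Prime] {F : Type*} [Field F]
    [Algebra (ZMod p) F] (α : F) : Submodule (ZMod p) (Fin (p ^ m - 1) → ZMod p) :=
  parityCheckCyclicCode (p ^ m - 1)
    (minpoly (ZMod p) α * minpoly (ZMod p) (α ^ (p ^ s + 1)) *
      minpoly (ZMod p) (α ^ (p ^ l + 1)))

/-- The dual of the extended code of the dual of the Kasami code. -/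
noncomputable def dualExtDualKasamiCode (p m s l : ℕ) [Fact p.Prime] {F : Type*} [Field F]
    [Algebra (ZMod p) F] (α : F) : Submodule (ZMod p) (Fin (p ^ m - 1 + 1) → ZMod p) :=
  dualCode (extendedCode (dualCode (kasamiCode p m s l α)))

/-- The absolute trace `x + x ^ p + ⋯ + x ^ (p ^ (r - 1))` of an element `x` of the field with
`p ^ r` elements, computed inside an extension `F` of that field. -/
def absTrace (p r : ℕ) {F : Type*} [Field F] (x : F) : F :=
  ∑ i ∈ Finset.range r, x ^ p ^ i

/-- The labelling of the `n + 1` coordinates by field elements: coordinate `i < n` belongs to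
`α ^ (-i)`, and the last (appended) coordinate to `0`. -/
def coordPoint {F : Type*} [Field F] (n : ℕ) (α : F) (i : Fin (n + 1)) : F :=
  if (i : ℕ) < n then α⁻¹ ^ (i : ℕ) else 0

/-- The number `A_w` of codewords of Hamming weight `w`. -/
noncomputable def weightCount {p N : ℕ} (D : Submodule (ZMod p) (Fin N → ZMod p)) (w : ℕ) : ℕ :=
  Set.ncard {c : Fin N → ZMod p | c ∈ D ∧ hammingNorm c = w}

/-- The number of nonzero weights of a code: the number of `w` with `1 ≤ w ≤ N` and
`A_w ≠ 0`. -/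
noncomputable def numWeights {p N : ℕ} (D : Submodule (ZMod p) (Fin N → ZMod p)) : ℕ :=
  Set.ncard {w : ℕ | 1 ≤ w ∧ w ≤ N ∧ weightCount D w ≠ 0}

/-- The weight distribution of `D` is given by the table `T` with rows (weight, multiplicity).
Rows whose weights happen to coincide are merged by adding their multiplicities, and a weight
that does not occur in the table has multiplicity zero. -/
def HasWeightDistribution {p N : ℕ} (D : Submodule (ZMod p) (Fin N → ZMod p))
    (T : List (ℤ × ℚ)) : Prop :=
  ∀ w : ℕ, (weightCount D w : ℚ) = ((T.filter fun r => r.1 = (w : ℤ)).map Prod.snd).sum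

/-- The table for `gcd (s + l, 2 l) = gcd (s, l) = d`, `d` odd; here `m = 2 s`. -/
def tableOdd (p m s d : ℕ) : List (ℤ × ℚ) :=
  let P : ℤ := p
  let Q : ℚ := p
  [ (0, 1),
    ((P - 1) * (P ^ (m - 1) - P ^ (s - 1)),
      1 / 2 * Q ^ (m + d) * (Q ^ s + 1) * (Q ^ m - 1) / (Q ^ d + 1)),
    (P ^ (m - 1) * (P - 1) + P ^ (s - 1),
      1 / 2 * Q ^ (m + d) * (Q - 1) * (Q ^ s + 1) * (Q ^ m - 1) / (Q ^ d + 1)),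
    ((P - 1) * (P ^ (m - 1) + P ^ (s - 1)),
      Q ^ (m + d) * (Q ^ m - 2 * Q ^ (m - d) + 1) * (Q ^ s - 1) / (2 * (Q ^ d - 1))),
    (P ^ (m - 1) * (P - 1) - P ^ (s - 1),
      Q ^ (m + d) * (Q - 1) * (Q ^ m - 2 * Q ^ (m - d) + 1) * (Q ^ s - 1) / (2 * (Q ^ d - 1))),
    (P ^ (m - 1) * (P - 1) + (-1) ^ ((p - 1) / 2) * P ^ (s + (d - 1) / 2),
      1 / 2 * Q ^ (3 * s - 2 * d) * (Q - 1) * (Q ^ m - 1)),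
    (P ^ (m - 1) * (P - 1) - (-1) ^ ((p - 1) / 2) * P ^ (s + (d - 1) / 2),
      1 / 2 * Q ^ (3 * s - 2 * d) * (Q - 1) * (Q ^ m - 1)),
    (P ^ (s + d - 1) * (P - 1) * (P ^ (s - d) + 1),
      Q ^ (m - 2 * d) * (Q ^ (s - d) - 1) * (Q ^ m - 1) / (Q ^ (2 * d) - 1)),
    (P ^ (m - 1) * (P - 1) - P ^ (s + d - 1),
      Q ^ (m - 2 * d) * (Q - 1) * (Q ^ (s - d) - 1) * (Q ^ m - 1) / (Q ^ (2 * d) - 1)),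
    (P ^ (m - 1) * (P - 1),
      Q * (Q ^ (3 * s - d) - Q ^ (3 * s - 2 * d) + Q ^ (3 * s - 2 * d - 1) + Q ^ (3 * s - 3 * d)
        - Q ^ (m - 2 * d) + 1) * (Q ^ m - 1)),
    (P ^ m, Q - 1) ]

/-- The table for `gcd (s + l, 2 l) = gcd (s, l) = d`, `d` even; here `m = 2 s`. -/
def tableEven (p m s d : ℕ) : List (ℤ × ℚ) :=
  let P : ℤ := p
  let Q : ℚ := p
  [ (0, 1),
    (P ^ (s - 1) * (P - 1) * (P ^ s - 1),
      1 / 2 * Q ^ (m + d) * (Q ^ s + 1) * (Q ^ m - 1) / (Q ^ d + 1)),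
    (P ^ (s - 1) * (P ^ (s + 1) - P ^ s + 1),
      1 / 2 * Q ^ (m + d) * (Q - 1) * (Q ^ s + 1) * (Q ^ m - 1) / (Q ^ d + 1)),
    (P ^ (s - 1) * (P - 1) * (P ^ s + 1),
      Q ^ (m + d) * (Q ^ m - 2 * Q ^ (m - d) + 1) * (Q ^ s - 1) / (2 * (Q ^ d - 1))),
    (P ^ (s - 1) * (P ^ (s + 1) - P ^ s - 1),
      Q ^ (m + d) * (Q - 1) * (Q ^ m - 2 * Q ^ (m - d) + 1) * (Q ^ s - 1) / (2 * (Q ^ d - 1))),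
    (P ^ (s + d / 2 - 1) * (P - 1) * (P ^ (s - d / 2) + 1),
      1 / 2 * Q ^ (3 * s - 2 * d) * (Q ^ m - 1)),
    (P ^ (s + d / 2 - 1) * (P - 1) * (P ^ (s - d / 2) - 1),
      1 / 2 * Q ^ (3 * s - 2 * d) * (Q ^ m - 1)),
    (P ^ (s + d / 2 - 1) * (P ^ (s - d / 2 + 1) - P ^ (s - d / 2) + 1),
      1 / 2 * Q ^ (3 * s - 2 * d) * (Q - 1) * (Q ^ m - 1)),
    (P ^ (s + d / 2 - 1) * (P ^ (s - d / 2 + 1) - P ^ (s - d / 2) - 1),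
      1 / 2 * Q ^ (3 * s - 2 * d) * (Q - 1) * (Q ^ m - 1)),
    (P ^ (s + d - 1) * (P - 1) * (P ^ (s - d) + 1),
      Q ^ (m - 2 * d) * (Q ^ (s - d) - 1) * (Q ^ m - 1) / (Q ^ (2 * d) - 1)),
    (P ^ (s + d - 1) * (P ^ (s - d + 1) - P ^ (s - d) - 1),
      Q ^ (m - 2 * d) * (Q - 1) * (Q ^ (s - d) - 1) * (Q ^ m - 1) / (Q ^ (2 * d) - 1)),
    (P ^ (m - 1) * (P - 1),
      Q * (Q ^ (3 * s - d) - Q ^ (3 * s - 2 * d) + Q ^ (3 * s - 3 * d) - Q ^ (m - 2 * d) + 1)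
        * (Q ^ m - 1)),
    (P ^ m, Q - 1) ]

/-- The table for `gcd (s + l, 2 l) = 2 d`, `gcd (s, l) = d`; here `m = 2 s`. -/
def tableDouble (p m s d : ℕ) : List (ℤ × ℚ) :=
  let P : ℤ := p
  let Q : ℚ := p
  [ (0, 1),
    (P ^ (s - 1) * (P - 1) * (P ^ s + 1),
      Q ^ (m + 3 * d) * (Q ^ m - Q ^ (m - 2 * d) - Q ^ (m - 3 * d) + Q ^ s - Q ^ (s - d) + 1)
        * (Q ^ s - 1) / ((Q ^ d + 1) * (Q ^ (2 * d) - 1))),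
    (P ^ (s - 1) * (P ^ (s + 1) - P ^ s - 1),
      Q ^ (m + 3 * d) * (Q - 1)
        * (Q ^ m - Q ^ (m - 2 * d) - Q ^ (m - 3 * d) + Q ^ s - Q ^ (s - d) + 1)
        * (Q ^ s - 1) / ((Q ^ d + 1) * (Q ^ (2 * d) - 1))),
    (P ^ (s + d - 1) * (P - 1) * (P ^ (s - d) - 1),
      Q ^ (m - d) * (Q ^ s + Q ^ (s - d) + Q ^ (s - 2 * d) + 1) * (Q ^ m - 1)
        / (Q ^ d + 1) ^ 2),
    (P ^ (s + d - 1) * (P ^ (s - d + 1) - P ^ (s - d) + 1),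
      Q ^ (m - d) * (Q - 1) * (Q ^ s + Q ^ (s - d) + Q ^ (s - 2 * d) + 1) * (Q ^ m - 1)
        / (Q ^ d + 1) ^ 2),
    (P ^ (s + 2 * d - 1) * (P - 1) * (P ^ (s - 2 * d) + 1),
      Q ^ (m - 4 * d) * (Q ^ (s - d) - 1) * (Q ^ m - 1) / ((Q ^ d + 1) * (Q ^ (2 * d) - 1))),
    (P ^ (s + 2 * d - 1) * (P ^ (s - 2 * d + 1) - P ^ (s - 2 * d) - 1),
      Q ^ (m - 4 * d) * (Q - 1) * (Q ^ (s - d) - 1) * (Q ^ m - 1)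
        / ((Q ^ d + 1) * (Q ^ (2 * d) - 1))),
    (P ^ (m - 1) * (P - 1),
      Q * (Q ^ (3 * s - d) - Q ^ (3 * s - 2 * d) + Q ^ (3 * s - 3 * d) - Q ^ (3 * s - 4 * d)
        + Q ^ (3 * s - 5 * d) + Q ^ (m - d) - 2 * Q ^ (m - 2 * d) + Q ^ (m - 3 * d)
        - Q ^ (m - 4 * d) + 1) * (Q ^ m - 1)),
    (P ^ m, Q - 1) ]

/-! Taking the dual, extending, and taking the dual again turns a code `D` into `D` padded by a zero
coordinate plus the constant words (`dual_extended_dual`). Fourier inversion at the roots of the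
parity-check polynomial then identifies the codewords with the functions `Q x + Tr (c x) + h`, where
`Q x = Tr (a x bar(x) + b x σ(x))`, `bar` is the `s`-th and `σ` the `l`-th power of Frobenius, and
`a` lies in the fixed field `E` of `bar` (`mem_dualExtDual_iff`, `formWord_injective`). For one form
`Q`, completing the square shows that the weights of its words depend only on the rank of `Q` and,
when the rank is even, on the sign of its exponential sum (`formCount_even`, `formCount_odd`). It
remains to count the forms of each rank and sign. Let `K` be the fixed field of `σ ∘ bar`; it has `p
^ d'` elements, and the radical of a nonzero form has `1`, `|K|` or `|K| ^ 2` elements.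

If `d' = d`, then `K` lies in `E`. A form with a nonzero radical element `x` is, after scaling by
`x`, of the shape `Tr (κ N(σ y - bar y))` with `κ` in `E` and `N(w) = w bar(w)`, so such pairs
(form, `x`) are parametrised by `x` and some `ω ≠ 0` in `E` (`radical_param`, `sum_radCard_mul`).
The exponential sum collapses to `-p ^ s` times a quadratic Gauss sum over `K` attached to `ω`
(`expSum_of_radical`). That sum is `|K|` when `ω⁻¹` is orthogonal to `K` and has absolute value
`√|K|` otherwise, and the latter values add up to zero. Double counting gives the two degenerate
classes; the nondegenerate one follows from the number of forms and the total of all exponential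
sums (`classes_single`).

If `d' = 2 d`, then `s / d` and `l / d` are odd. A Wronskian argument bounds the radical by
dimension two over `K` (`radCard_trichotomy`). All forms are invariant under the `(p ^ d + 1)`-th
roots of unity, and a congruence modulo `p ^ d + 1` then fixes the sign of each exponential sum from
the radical alone (`expSum_double`). The number of forms and the first and second moments of the
exponential sums give three linear equations for the three class sizes (`classes_double`). -/

set_option linter.unusedSectionVars false

/-! ### Additive characters of `F` and quadratic Gauss sums over `ZMod p`. -/

namespace Kasami

variable {p : ℕ} [Fact p.Prime] {F : Type*} [Field F] [Algebra (ZMod p) F]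

/-- The additive character `x ↦ exp (2πi Tr(x) / p)` of a finite field. -/
noncomputable def traceChar (p : ℕ) [Fact p.Prime] (F : Type*) [Field F] [Algebra (ZMod p) F] :
    AddChar F ℂ :=
  (ZMod.stdAddChar (N := p)).compAddMonoidHom (Algebra.trace (ZMod p) F).toAddMonoidHom

lemma traceChar_apply (x : F) :
    traceChar p F x = ZMod.stdAddChar (Algebra.trace (ZMod p) F x) := rfl

lemma traceChar_algEquiv (σ : F ≃ₐ[ZMod p] F) (x : F) :
    traceChar p F (σ x) = traceChar p F x := by
  simp only [traceChar_apply, Algebra.trace_eq_of_algEquiv]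

lemma stdAddChar_eq_one_iff (a : ZMod p) : ZMod.stdAddChar a = (1 : ℂ) ↔ a = 0 := by
  constructor
  · intro h
    apply ZMod.injective_stdAddChar
    simpa using h
  · rintro rfl; simp

lemma traceChar_eq_one_iff (x : F) :
    traceChar p F x = 1 ↔ Algebra.trace (ZMod p) F x = 0 :=
  stdAddChar_eq_one_iff _

lemma exists_trace_mul_ne_zero [Finite F] {a : F} (ha : a ≠ 0) :
    ∃ b, Algebra.trace (ZMod p) F (a * b) ≠ 0 := by
  by_contra! h
  have := (traceForm_nondegenerate (ZMod p) F).1 a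
  exact ha (this fun b => by simpa [Algebra.traceForm_apply] using h b)

lemma eq_zero_of_trace_mul [Finite F] {a : F}
    (h : ∀ b, Algebra.trace (ZMod p) F (a * b) = 0) : a = 0 := by
  by_contra ha
  obtain ⟨b, hb⟩ := exists_trace_mul_ne_zero (p := p) ha
  exact hb (h b)

/-- A sum of a character of the additive group of `F` over a finite additive group. -/
lemma sum_traceChar_comp {A : Type*} [AddCommGroup A] [Fintype A] (f : A →+ F)
    [Decidable (∀ a, Algebra.trace (ZMod p) F (f a) = 0)] :
    ∑ a, traceChar p F (f a) =
      if ∀ a, Algebra.trace (ZMod p) F (f a) = 0 then (Fintype.card A : ℂ) else 0 := by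
  classical
  have h := AddChar.sum_eq_ite ((traceChar p F).compAddMonoidHom f)
  simp only [AddChar.compAddMonoidHom_apply] at h
  rw [h]
  have : ((traceChar p F).compAddMonoidHom f = 0) ↔
      ∀ a, Algebra.trace (ZMod p) F (f a) = 0 := by
    rw [AddChar.eq_zero_iff]
    simp [traceChar_eq_one_iff]
  simp [this]

lemma sum_traceChar_mul [Fintype F] [DecidableEq F] (x : F) :
    ∑ y, traceChar p F (x * y) = if x = 0 then (Fintype.card F : ℂ) else 0 := by
  classical
  have h := sum_traceChar_comp (p := p) (AddMonoidHom.mulLeft x)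
  simp only [AddMonoidHom.coe_mulLeft] at h
  rw [h]
  have : (∀ a, Algebra.trace (ZMod p) F (x * a) = 0) ↔ x = 0 :=
    ⟨eq_zero_of_trace_mul, by rintro rfl; simp⟩
  simp [this]

lemma sum_stdAddChar_mul (x : ZMod p) :
    ∑ y, (ZMod.stdAddChar (x * y) : ℂ) = if x = 0 then (p : ℂ) else 0 := by
  have h := AddChar.sum_mulShift x (ZMod.isPrimitive_stdAddChar p)
  simp only [ZMod.card] at h
  rw [Finset.sum_congr rfl fun y _ => by rw [mul_comm], h]
  split_ifs <;> simp

lemma star_traceChar [Finite F] (x : F) :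
    (starRingEnd ℂ) (traceChar p F x) = traceChar p F (-x) :=
  (AddChar.map_neg_eq_conj _ _).symm

/-! ### Quadratic Gauss sums over `ZMod p` -/

/-- The quadratic Gauss sum over `ZMod p`. -/
noncomputable def quadGauss (p : ℕ) [Fact p.Prime] : ℂ := ∑ x : ZMod p, ZMod.stdAddChar (x ^ 2)

/-- The quadratic character of `ZMod p` as a complex number. -/
noncomputable def eta (a : ZMod p) : ℂ := ((quadraticChar (ZMod p) a : ℤ) : ℂ)

lemma eta_mul (a b : ZMod p) : eta (a * b) = eta a * eta b := by
  simp only [eta, map_mul, Int.cast_mul]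

@[simp] lemma eta_zero : eta (0 : ZMod p) = 0 := by simp [eta]

lemma eta_sq_of_ne {a : ZMod p} (ha : a ≠ 0) : eta a ^ 2 = 1 := by
  have := quadraticChar_sq_one ha
  simp only [eta]; exact_mod_cast this

lemma eta_eq_or {a : ZMod p} (ha : a ≠ 0) : eta a = 1 ∨ eta a = -1 :=
  mul_self_eq_one_iff.mp (by rw [← pow_two]; exact eta_sq_of_ne ha)

/-- Each `t` has `eta t + 1` square roots, and the summand `1` contributes a complete character sum,
which vanishes for `c ≠ 0`. -/
lemma sum_eta_mul_stdAddChar (hp : p ≠ 2) (c : ZMod p) (hc : c ≠ 0) :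
    ∑ x : ZMod p, (ZMod.stdAddChar (c * x ^ 2) : ℂ) =
      ∑ t : ZMod p, eta t * ZMod.stdAddChar (c * t) := by
  have h1 : ∑ x : ZMod p, (ZMod.stdAddChar (c * x ^ 2) : ℂ) =
      ∑ t : ZMod p, ∑ x ∈ Finset.univ.filter (fun x : ZMod p => x ^ 2 = t),
        (ZMod.stdAddChar (c * x ^ 2) : ℂ) :=
    (Finset.sum_fiberwise _ _ _).symm
  have h2 : ∀ t : ZMod p, ∑ x ∈ Finset.univ.filter (fun x : ZMod p => x ^ 2 = t),
        (ZMod.stdAddChar (c * x ^ 2) : ℂ) = (eta t + 1) * ZMod.stdAddChar (c * t) := by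
    intro t
    rw [Finset.sum_congr rfl (g := fun _ => (ZMod.stdAddChar (c * t) : ℂ))]
    · rw [Finset.sum_const, nsmul_eq_mul]
      congr 1
      have h := quadraticChar_card_sqrts (F := ZMod p) (by rwa [ZMod.ringChar_zmod_n]) t
      have h' : ((Finset.univ.filter (fun x : ZMod p => x ^ 2 = t)).card : ℤ) =
          quadraticChar (ZMod p) t + 1 := by
        rw [← h]; congr 2; ext x; simp
      rw [eta]; exact_mod_cast h'
    · intro x hx
      rw [(Finset.mem_filter.mp hx).2]
  rw [h1, Finset.sum_congr rfl fun t _ => h2 t]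
  simp only [add_mul, one_mul, Finset.sum_add_distrib]
  rw [sum_stdAddChar_mul, if_neg hc, add_zero]

/-- For `c = 0` both sides vanish, so the identity may be used for every `t` in `quadGauss_sq`. -/
lemma sum_eta_mul_stdAddChar_mul (hp : p ≠ 2) (c : ZMod p) :
    ∑ t : ZMod p, eta t * ZMod.stdAddChar (c * t) = eta c * quadGauss p := by
  have h1 : quadGauss p = ∑ t : ZMod p, eta t * ZMod.stdAddChar t := by
    have := sum_eta_mul_stdAddChar hp (1 : ZMod p) one_ne_zero
    simpa [quadGauss] using this
  by_cases hc : c = 0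
  · subst hc
    simp only [zero_mul, AddChar.map_zero_eq_one, mul_one, eta_zero]
    have := quadraticChar_sum_zero (F := ZMod p) (by rwa [ZMod.ringChar_zmod_n])
    simp only [eta]; exact_mod_cast this
  · rw [h1, Finset.mul_sum]
    refine Fintype.sum_equiv (Equiv.mulLeft₀ c hc) _ _ fun t => ?_
    rw [show (Equiv.mulLeft₀ c hc) t = c * t from rfl, eta_mul, ← mul_assoc, ← mul_assoc, ← pow_two, eta_sq_of_ne hc, one_mul]

lemma sum_stdAddChar_mul_sq (hp : p ≠ 2) {c : ZMod p} (hc : c ≠ 0) :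
    ∑ x : ZMod p, (ZMod.stdAddChar (c * x ^ 2) : ℂ) = eta c * quadGauss p := by
  rw [sum_eta_mul_stdAddChar hp c hc, sum_eta_mul_stdAddChar_mul hp]

lemma quadGauss_sq (hp : p ≠ 2) : quadGauss p ^ 2 = eta (-1 : ZMod p) * p := by
  have h1 : quadGauss p = ∑ t : ZMod p, eta t * ZMod.stdAddChar t := by
    have := sum_eta_mul_stdAddChar hp (1 : ZMod p) one_ne_zero
    simpa [quadGauss] using this
  have h2 : ∀ t : ZMod p, eta t * quadGauss p = ∑ x, eta x * ZMod.stdAddChar (t * x) := fun t =>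
    (sum_eta_mul_stdAddChar_mul hp t).symm
  -- Expand one factor and absorb `eta t` into a twisted Gauss sum in the other; the sum over `t`
  -- then leaves only `x = -1`.
  calc quadGauss p ^ 2 = ∑ t : ZMod p, ZMod.stdAddChar t * (eta t * quadGauss p) := by
        rw [pow_two, show quadGauss p * quadGauss p =
          (∑ t : ZMod p, eta t * ZMod.stdAddChar t) * quadGauss p by rw [← h1], Finset.sum_mul]
        exact Finset.sum_congr rfl fun t _ => by ring
    _ = ∑ x : ZMod p, eta x * ∑ t : ZMod p, ZMod.stdAddChar ((1 + x) * t) := by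
        simp only [h2, Finset.mul_sum]
        rw [Finset.sum_comm]
        refine Finset.sum_congr rfl fun x _ => Finset.sum_congr rfl fun t _ => ?_
        rw [show (1 + x) * t = t + t * x by ring, AddChar.map_add_eq_mul]; ring
    _ = eta (-1 : ZMod p) * p := by
        simp only [sum_stdAddChar_mul]
        rw [Finset.sum_eq_single (-1)]
        · simp
        · intro b _ hb
          rw [if_neg, mul_zero]
          intro h; exact hb (by linear_combination h)
        · simp

end Kasami

/-! ### Exponential sums and value distribution of quadratic forms over `ZMod p`. -/

namespace Kasami

variable {p : ℕ} [Fact p.Prime]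

lemma two_ne_zero_zmod (hp : p ≠ 2) : (2 : ZMod p) ≠ 0 := by
  have := (ZMod.natCast_eq_zero_iff 2 p).not.mpr (fun h =>
    hp ((Nat.prime_dvd_prime_iff_eq Fact.out Nat.prime_two).mp h))
  exact_mod_cast this

lemma stdAddChar_sum {ι : Type*} (s : Finset ι) (f : ι → ZMod p) :
    (ZMod.stdAddChar (∑ i ∈ s, f i) : ℂ) = ∏ i ∈ s, ZMod.stdAddChar (f i) := by
  classical
  induction s using Finset.induction_on with
  | empty => simp
  | insert a s ha ih => rw [Finset.sum_insert ha, Finset.prod_insert ha, AddChar.map_add_eq_mul, ih]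

/-- The sum of a diagonal form factors over the coordinates: a zero coefficient contributes `p`, a
nonzero one a Gauss sum. -/
lemma sum_weightedSumSquares {n : ℕ} (hp : p ≠ 2) (w : Fin n → ZMod p) (y : ZMod p) (hy : y ≠ 0) :
    ∑ v : Fin n → ZMod p, (ZMod.stdAddChar (y * ∑ i, w i * (v i * v i)) : ℂ) =
      p ^ (Finset.univ.filter fun i => w i = 0).card *
      (∏ i ∈ Finset.univ.filter (fun i => ¬ w i = 0), eta (w i)) *
      (eta y * quadGauss p) ^ (Finset.univ.filter fun i => ¬ w i = 0).card := by
  have h1 : ∀ v : Fin n → ZMod p, (ZMod.stdAddChar (y * ∑ i, w i * (v i * v i)) : ℂ) =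
      ∏ i, (ZMod.stdAddChar (y * w i * (v i) ^ 2) : ℂ) := by
    intro v
    rw [Finset.mul_sum, stdAddChar_sum]
    exact Finset.prod_congr rfl fun i _ => by rw [pow_two, mul_assoc]
  have h2 : ∑ v : Fin n → ZMod p, ∏ i, (ZMod.stdAddChar (y * w i * (v i) ^ 2) : ℂ) =
      ∏ i, ∑ x : ZMod p, (ZMod.stdAddChar (y * w i * x ^ 2) : ℂ) := by
    rw [Finset.prod_univ_sum, Fintype.piFinset_univ]
  rw [Finset.sum_congr rfl fun v _ => h1 v, h2,
    ← Finset.prod_filter_mul_prod_filter_not Finset.univ (fun i => w i = 0), mul_assoc]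
  congr 1
  · rw [Finset.prod_congr rfl (g := fun _ => (p : ℂ)), Finset.prod_const]
    intro i hi
    simp [(Finset.mem_filter.mp hi).2]
  · rw [Finset.prod_congr rfl (g := fun i => eta (w i) * (eta y * quadGauss p)),
      Finset.prod_mul_distrib, Finset.prod_const]
    intro i hi
    rw [sum_stdAddChar_mul_sq hp (mul_ne_zero hy (Finset.mem_filter.mp hi).2), eta_mul]
    ring

lemma card_radical_weightedSumSquares {n : ℕ} (hp : p ≠ 2) (w : Fin n → ZMod p) :
    Nat.card {x : Fin n → ZMod p | ∀ y,
      QuadraticMap.polar (QuadraticMap.weightedSumSquares (ZMod p) w) x y = 0} =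
      p ^ (Finset.univ.filter fun i => w i = 0).card := by
  classical
  have hpol : ∀ x y : Fin n → ZMod p,
      QuadraticMap.polar (QuadraticMap.weightedSumSquares (ZMod p) w) x y =
        ∑ i, 2 * w i * x i * y i := by
    intro x y
    simp only [QuadraticMap.polar, QuadraticMap.weightedSumSquares_apply, smul_eq_mul,
      Pi.add_apply, ← Finset.sum_sub_distrib]
    exact Finset.sum_congr rfl fun i _ => by ring
  have hset : {x : Fin n → ZMod p | ∀ y,
      QuadraticMap.polar (QuadraticMap.weightedSumSquares (ZMod p) w) x y = 0} =
      ↑(Fintype.piFinset fun i => if w i = 0 then (Finset.univ : Finset (ZMod p)) else {0}) := by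
    ext x
    simp only [Set.mem_ofPred_eq, hpol, Finset.mem_coe, Fintype.mem_piFinset]
    constructor
    · intro h i
      have := h (Pi.single i 1)
      rw [Finset.sum_eq_single i (fun j _ hj => by simp [hj]) (by simp)] at this
      simp only [Pi.single_eq_same, mul_one, mul_eq_zero] at this
      split_ifs with hw
      · simp
      · rcases this with (h2 | hw') | hx
        · exact absurd h2 (two_ne_zero_zmod hp)
        · exact absurd hw' hw
        · simpa using hx
    · intro h y
      refine Finset.sum_eq_zero fun i _ => ?_
      have := h i
      split_ifs at this with hw
      · simp [hw]
      · simp [Finset.mem_singleton.mp this]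
  rw [hset]
  simp only [Finset.coe_sort_coe, Nat.card_eq_fintype_card, Fintype.card_coe,
    Fintype.card_piFinset]
  rw [← Finset.prod_filter_mul_prod_filter_not Finset.univ (fun i => w i = 0)]
  rw [Finset.prod_congr rfl (g := fun _ => p), Finset.prod_const,
    Finset.prod_congr rfl (g := fun _ => 1), Finset.prod_const_one, mul_one]
  · intro i hi
    rw [if_neg (Finset.mem_filter.mp hi).2, Finset.card_singleton]
  · intro i hi
    rw [if_pos (Finset.mem_filter.mp hi).2, Finset.card_univ, ZMod.card]

/-- The exponential sums of a quadratic form over `ZMod p`. -/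
theorem exists_sum_quadraticForm {V : Type*} [AddCommGroup V] [Module (ZMod p) V] [Fintype V]
    (hp : p ≠ 2) (Q : QuadraticForm (ZMod p) V) :
    ∃ k R : ℕ, p ^ (k + R) = Fintype.card V ∧
      Nat.card {x : V | ∀ y, QuadraticMap.polar Q x y = 0} = p ^ k ∧
      ∃ e : ℂ, (e = 1 ∨ e = -1) ∧ ∀ y : ZMod p, y ≠ 0 →
        ∑ x, (ZMod.stdAddChar (y * Q x) : ℂ) = p ^ k * e * (eta y * quadGauss p) ^ R := by
  classical
  let : Invertible (2 : ZMod p) := invertibleOfNonzero (two_ne_zero_zmod hp)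
  have : FiniteDimensional (ZMod p) V := Module.Finite.of_finite
  obtain ⟨w, ⟨f⟩⟩ := QuadraticForm.equivalent_weightedSumSquares Q
  -- In a diagonalisation, `k` counts the zero and `R` the nonzero coefficients; the sign is the
  -- quadratic character of the product of the nonzero ones.
  refine ⟨(Finset.univ.filter fun i => w i = 0).card, (Finset.univ.filter fun i => ¬ w i = 0).card,
    ?_, ?_, ∏ i ∈ Finset.univ.filter (fun i => ¬ w i = 0), eta (w i), ?_, fun y hy => ?_⟩
  · rw [Finset.card_filter_add_card_filter_not, Finset.card_univ, Fintype.card_fin,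
      Module.card_eq_pow_finrank (K := ZMod p), ZMod.card]
  · rw [← card_radical_weightedSumSquares hp w]
    refine Nat.card_congr (f.toLinearEquiv.toEquiv.subtypeEquiv fun x => ?_)
    have hpol : ∀ x y, QuadraticMap.polar Q x y =
        QuadraticMap.polar (QuadraticMap.weightedSumSquares (ZMod p) w) (f x) (f y) := by
      intro x y
      simp only [QuadraticMap.polar, ← map_add, QuadraticMap.IsometryEquiv.map_app]
    constructor
    · intro h y
      have := h (f.toLinearEquiv.symm y)
      rw [hpol] at this
      rwa [show f (f.toLinearEquiv.symm y) = y from f.toLinearEquiv.apply_symm_apply y] at this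
    · intro h y
      rw [hpol]; exact h _
  · refine Finset.prod_induction _ (fun e : ℂ => e = 1 ∨ e = -1) ?_ (Or.inl rfl) ?_
    · rintro a b (rfl | rfl) (rfl | rfl) <;> simp
    · intro i hi
      exact eta_eq_or (Finset.mem_filter.mp hi).2
  · rw [← sum_weightedSumSquares hp w y hy]
    refine Fintype.sum_equiv f.toLinearEquiv.toEquiv _ _ fun x => ?_
    congr 2
    have := f.map_app x
    rw [QuadraticMap.weightedSumSquares_apply] at this
    rw [← this]
    simp [smul_eq_mul]

/-- Fourier inversion over `ZMod p` for the function counting the fibres of `f`. -/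
lemma card_fiber_eq_sum {V : Type*} [Fintype V] (f : V → ZMod p) (t : ZMod p) :
    (p : ℂ) * (Finset.univ.filter fun x => f x = t).card =
      ∑ y : ZMod p, ZMod.stdAddChar (-(t * y)) * ∑ x, ZMod.stdAddChar (y * f x) := by
  simp only [Finset.mul_sum]
  rw [Finset.sum_comm, Finset.card_filter]
  push_cast
  rw [Finset.mul_sum]
  refine Finset.sum_congr rfl fun x _ => ?_
  have := sum_stdAddChar_mul (f x - t)
  rw [Finset.sum_congr rfl (g := fun y : ZMod p => (ZMod.stdAddChar ((f x - t) * y) : ℂ)), this]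
  · simp only [sub_eq_zero]; split_ifs <;> simp
  · intro y _
    rw [← AddChar.map_add_eq_mul]; congr 1; ring

/-- A form all of whose nontrivial exponential sums have the same value `T`. -/
lemma card_fiber_of_sum_eq {V : Type*} [Fintype V] (f : V → ZMod p) (T : ℂ)
    (hT : ∀ y : ZMod p, y ≠ 0 → ∑ x, (ZMod.stdAddChar (y * f x) : ℂ) = T) (t : ZMod p) :
    (p : ℂ) * (Finset.univ.filter fun x => f x = t).card =
      Fintype.card V + T * (if t = 0 then (p : ℂ) - 1 else -1) := by
  rw [card_fiber_eq_sum, ← Finset.add_sum_erase _ _ (Finset.mem_univ 0)]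
  rw [Finset.sum_congr rfl (g := fun y : ZMod p => T * (ZMod.stdAddChar (-t * y) : ℂ)), ← Finset.mul_sum]
  · have h := sum_stdAddChar_mul (-t)
    rw [← Finset.add_sum_erase _ _ (Finset.mem_univ 0)] at h
    simp only [neg_eq_zero, mul_zero, AddChar.map_zero_eq_one] at h
    have h' := eq_sub_of_add_eq' h
    rw [h']
    simp only [neg_zero, mul_zero, zero_mul, AddChar.map_zero_eq_one, Finset.sum_const,
      Finset.card_univ, nsmul_eq_mul, one_mul, mul_one]
    congr 2; split_ifs <;> simp
  · intro y hy
    rw [hT y (Finset.ne_of_mem_erase hy), mul_comm, neg_mul]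

lemma eta_pow_even {a : ZMod p} (ha : a ≠ 0) {R : ℕ} (hR : Even R) : eta a ^ R = 1 := by
  obtain ⟨r, rfl⟩ := hR
  rw [← two_mul, pow_mul, eta_sq_of_ne ha, one_pow]

lemma quadGauss_pow_even (hp : p ≠ 2) (r : ℕ) :
    ∃ e : ℂ, (e = 1 ∨ e = -1) ∧ quadGauss p ^ (2 * r) = e * p ^ r := by
  refine ⟨eta (-1 : ZMod p) ^ r, ?_, by rw [pow_mul, quadGauss_sq hp, mul_pow]⟩
  rcases eta_eq_or (p := p) (a := -1) (by simp) with h | h <;> rw [h]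
  · simp
  · exact neg_one_pow_eq_or ℂ r

/-- Even rank: all exponential sums are equal, and the fibres have the expected sizes. -/
theorem quadraticForm_even {V : Type*} [AddCommGroup V] [Module (ZMod p) V] [Fintype V]
    (hp : p ≠ 2) (Q : QuadraticForm (ZMod p) V) (n k r : ℕ) (hn : Fintype.card V = p ^ n)
    (hk : Nat.card {x : V | ∀ y, QuadraticMap.polar Q x y = 0} = p ^ k) (hnk : n = k + 2 * r) :
    ∃ e : ℤ, (e = 1 ∨ e = -1) ∧ ∑ x, (ZMod.stdAddChar (Q x) : ℂ) = e * p ^ (k + r) ∧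
      ∀ t, (p : ℤ) * (Finset.univ.filter fun x => Q x = t).card =
        p ^ n + e * p ^ (k + r) * (if t = 0 then (p : ℤ) - 1 else -1) := by
  have hp1 : 1 < p := (Fact.out : p.Prime).one_lt
  obtain ⟨k', R, h1, h2, e, he, hsum⟩ := exists_sum_quadraticForm hp Q
  have hkk : k' = k := Nat.pow_right_injective hp1 (h2.symm.trans hk)
  subst hkk
  have hR : R = 2 * r := by
    have := Nat.pow_right_injective hp1 (h1.trans hn); omega
  subst hR
  obtain ⟨e', he', hG⟩ := quadGauss_pow_even hp r
  obtain ⟨ε, hε, hεe⟩ : ∃ ε : ℤ, (ε = 1 ∨ ε = -1) ∧ (ε : ℂ) = e * e' := by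
    rcases he with rfl | rfl <;> rcases he' with rfl | rfl
    · exact ⟨1, by simp⟩
    · exact ⟨-1, by simp⟩
    · exact ⟨-1, by simp⟩
    · exact ⟨1, by simp⟩
  -- The character `eta y` enters to an even power, so the sum does not depend on `y`.
  have hall : ∀ y : ZMod p, y ≠ 0 →
      ∑ x, (ZMod.stdAddChar (y * Q x) : ℂ) = ε * p ^ (k' + r) := by
    intro y hy
    rw [hsum y hy, mul_pow, eta_pow_even hy (even_two_mul r), hG, hεe, pow_add]; ring
  refine ⟨ε, hε, ?_, fun t => ?_⟩
  · simpa using hall 1 one_ne_zero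
  · have := card_fiber_of_sum_eq Q _ hall t
    rw [hn] at this
    split_ifs at this ⊢ <;> exact_mod_cast this

/-- Odd rank: the fibre sizes up to a global sign. -/
theorem quadraticForm_odd {V : Type*} [AddCommGroup V] [Module (ZMod p) V] [Fintype V]
    (hp : p ≠ 2) (Q : QuadraticForm (ZMod p) V) (n k r : ℕ) (hn : Fintype.card V = p ^ n)
    (hk : Nat.card {x : V | ∀ y, QuadraticMap.polar Q x y = 0} = p ^ k)
    (hnk : n = k + (2 * r + 1)) :
    ∃ e : ℤ, (e = 1 ∨ e = -1) ∧
      ∀ t, (p : ℤ) * (Finset.univ.filter fun x => Q x = t).card =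
        p ^ n + e * p ^ (k + r + 1) * quadraticChar (ZMod p) t := by
  have hp1 : 1 < p := (Fact.out : p.Prime).one_lt
  obtain ⟨k', R, h1, h2, e, he, hsum⟩ := exists_sum_quadraticForm hp Q
  have hkk : k' = k := Nat.pow_right_injective hp1 (h2.symm.trans hk)
  subst hkk
  have hR : R = 2 * r + 1 := by
    have := Nat.pow_right_injective hp1 (h1.trans hn); omega
  subst hR
  obtain ⟨e', he', hG⟩ := quadGauss_pow_even hp (r + 1)
  have hm1 := eta_eq_or (p := p) (a := -1) (by simp)
  obtain ⟨ε, hε, hεe⟩ : ∃ ε : ℤ, (ε = 1 ∨ ε = -1) ∧ (ε : ℂ) = e * e' * eta (-1 : ZMod p) := by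
    rcases he with rfl | rfl <;> rcases he' with rfl | rfl <;> rcases hm1 with h | h <;> rw [h]
    exacts [⟨1, by simp⟩, ⟨-1, by simp⟩, ⟨-1, by simp⟩, ⟨1, by simp⟩, ⟨-1, by simp⟩, ⟨1, by simp⟩,
      ⟨1, by simp⟩, ⟨-1, by simp⟩]
  refine ⟨ε, hε, fun t => ?_⟩
  have key : (p : ℂ) * (Finset.univ.filter fun x => Q x = t).card =
      p ^ n + ε * p ^ (k' + r + 1) * eta t := by
    rw [card_fiber_eq_sum, ← Finset.add_sum_erase _ _ (Finset.mem_univ 0)]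
    -- One factor `eta y` survives an odd power. Inversion then produces one more Gauss sum, so that
    -- an even power of `quadGauss p` appears, and its argument `-t` accounts for the `eta (-1)` in
    -- `ε`.
    have h0 : ∀ y : ZMod p, y ∈ Finset.univ.erase 0 →
        ZMod.stdAddChar (-(t * y)) * ∑ x, (ZMod.stdAddChar (y * Q x) : ℂ) =
        (p ^ k' * e * quadGauss p ^ (2 * r + 1)) * (eta y * ZMod.stdAddChar (-t * y)) := by
      intro y hy
      have hy0 := Finset.ne_of_mem_erase hy
      rw [hsum y hy0, mul_pow, pow_succ (eta y), eta_pow_even hy0 (even_two_mul r), neg_mul]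
      ring
    rw [Finset.sum_congr rfl h0, ← Finset.mul_sum, Finset.sum_erase _ (by simp),
      sum_eta_mul_stdAddChar_mul hp]
    have h5 : eta (-t) = eta (-1 : ZMod p) * eta t := by rw [← eta_mul]; simp
    rw [h5, hεe]
    simp only [neg_zero, mul_zero, zero_mul, AddChar.map_zero_eq_one, Finset.sum_const,
      Finset.card_univ, nsmul_eq_mul, one_mul, mul_one, hn]
    have h6 : quadGauss p ^ (2 * r + 1) * quadGauss p = e' * p ^ (r + 1) := by
      rw [← hG]; ring
    push_cast
    rw [show (p : ℂ) ^ (k' + r + 1) = p ^ k' * p ^ (r + 1) by ring]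
    linear_combination (p ^ k' * e * eta (-1 : ZMod p) * eta t) * h6
  rw [eta] at key
  exact_mod_cast key

/-- The square of the absolute value of an exponential sum. -/
theorem normSq_sum_quadraticForm {V : Type*} [AddCommGroup V] [Module (ZMod p) V] [Fintype V]
    (hp : p ≠ 2) (Q : QuadraticForm (ZMod p) V) :
    Complex.normSq (∑ x, (ZMod.stdAddChar (Q x) : ℂ)) = Fintype.card V *
      Nat.card {x : V | ∀ y, QuadraticMap.polar Q x y = 0} := by
  obtain ⟨k, R, h1, h2, e, he, hsum⟩ := exists_sum_quadraticForm hp Q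
  have h := hsum 1 one_ne_zero
  -- The sign in `quadGauss_sq` disappears on taking absolute values.
  have hG : Complex.normSq (quadGauss p) = p := by
    have h3 := congrArg Complex.normSq (quadGauss_sq hp)
    have h4 : Complex.normSq (eta (-1 : ZMod p)) = 1 := by
      rcases eta_eq_or (p := p) (a := -1) (by simp) with h | h <;> rw [h] <;> simp
    rw [map_mul, h4, map_pow, one_mul, Complex.normSq_natCast] at h3
    nlinarith [Complex.normSq_nonneg (quadGauss p), (Nat.cast_nonneg p : (0 : ℝ) ≤ p)]
  have h1' : eta (1 : ZMod p) = 1 := by simp [eta]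
  have he' : Complex.normSq e = 1 := by rcases he with rfl | rfl <;> simp
  simp only [one_mul] at h
  rw [h, h2, ← h1, h1', one_mul, map_mul, map_mul, map_pow, map_pow, hG, he',
    Complex.normSq_natCast]
  push_cast; ring

end Kasami

/-! ### The forms `Tr (a x bar(x) + b x σ(x))`: radical, and exponential sum when the radical is
nontrivial. -/

namespace Kasami

variable {p : ℕ} [Fact p.Prime] {F : Type*} [Field F] [Algebra (ZMod p) F]

/-- The fixed points of an automorphism. -/
def fixed (φ : F ≃ₐ[ZMod p] F) : Subalgebra (ZMod p) F :=
  AlgHom.equalizer (φ : F →ₐ[ZMod p] F) (AlgHom.id (ZMod p) F)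

lemma mem_fixed {φ : F ≃ₐ[ZMod p] F} {x : F} : x ∈ fixed φ ↔ φ x = x := Iff.rfl

instance decidableMemFixed [DecidableEq F] (φ : F ≃ₐ[ZMod p] F) : DecidablePred (· ∈ fixed φ) :=
  fun x => inferInstanceAs (Decidable (φ x = x))

instance fintypeFixed [Fintype F] [DecidableEq F] (φ : F ≃ₐ[ZMod p] F) : Fintype (fixed φ) :=
  Subtype.fintype (· ∈ fixed φ)

lemma fixed_apply {φ : F ≃ₐ[ZMod p] F} (x : fixed φ) : φ (x : F) = x := x.2

/-- The quadratic form `x ↦ Tr (a x bar(x) + b x σ(x))`. -/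
noncomputable def kasamiForm (σ bar : F ≃ₐ[ZMod p] F) (a b : F) : QuadraticForm (ZMod p) F :=
  LinearMap.BilinMap.toQuadraticMap (LinearMap.mk₂ (ZMod p)
    (fun x y => Algebra.trace (ZMod p) F (a * (x * bar y) + b * (x * σ y)))
    (fun x x' y => by rw [← map_add]; congr 1; ring)
    (fun c x y => by rw [← map_smul]; congr 1; simp only [Algebra.smul_def]; ring)
    (fun x y y' => by rw [← map_add]; congr 1; simp only [map_add]; ring)
    (fun c x y => by rw [← map_smul]; congr 1; simp only [Algebra.smul_def, map_mul,
      AlgEquiv.commutes]; ring))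

lemma kasamiForm_apply (σ bar : F ≃ₐ[ZMod p] F) (a b x : F) :
    kasamiForm σ bar a b x = Algebra.trace (ZMod p) F (a * (x * bar x) + b * (x * σ x)) := rfl

/-- The exponential sum of the form `kasamiForm σ bar a b`. -/
noncomputable def expSum [Fintype F] (σ bar : F ≃ₐ[ZMod p] F) (a b : F) : ℂ :=
  ∑ x, traceChar p F (a * (x * bar x) + b * (x * σ x))

/-- The number of elements of the radical of `kasamiForm σ bar a b`. -/
noncomputable def radCard [Fintype F] [DecidableEq F] (σ bar : F ≃ₐ[ZMod p] F) (a b : F) : ℕ :=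
  (Finset.univ.filter fun x : F => σ (2 * a * bar x + b * σ x) + b * x = 0).card

section
variable {σ bar : F ≃ₐ[ZMod p] F}

/-- The trace is invariant under `bar` and `σ`: the first moves both halves of the `a`-term onto
`y`, the second then turns every `y` into `σ y`. Nondegeneracy of the trace form reads off the
radical equation. -/
lemma polar_kasamiForm (hbar : ∀ x, bar (bar x) = x) {a : F} (ha : bar a = a) (b x y : F) :
    QuadraticMap.polar (kasamiForm σ bar a b) x y =
      Algebra.trace (ZMod p) F ((σ (2 * a * bar x + b * σ x) + b * x) * σ y) := by
  have h1 : Algebra.trace (ZMod p) F (a * (x * bar y)) =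
      Algebra.trace (ZMod p) F (a * (bar x * y)) := by
    rw [← Algebra.trace_eq_of_algEquiv bar]; simp [ha, hbar]
  have h2 : Algebra.trace (ZMod p) F (σ (2 * a * bar x + b * σ x) * σ y) =
      Algebra.trace (ZMod p) F (2 * a * bar x * y + b * σ x * y) := by
    rw [← map_mul, Algebra.trace_eq_of_algEquiv, add_mul]
  rw [add_mul, map_add, h2]
  simp only [QuadraticMap.polar, kasamiForm_apply, map_add]
  have e1 : a * ((x + y) * (bar x + bar y)) =
      a * (x * bar x) + a * (y * bar y) + a * (x * bar y) + a * (bar x * y) := by ring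
  have e2 : b * ((x + y) * (σ x + σ y)) =
      b * (x * σ x) + b * (y * σ y) + b * x * σ y + b * σ x * y := by ring
  have e3 : 2 * a * bar x * y = a * (bar x * y) + a * (bar x * y) := by ring
  rw [e1, e2, e3]
  simp only [map_add]
  rw [h1]; ring

lemma polar_eq_zero_iff [Finite F] (hbar : ∀ x, bar (bar x) = x) {a : F} (ha : bar a = a)
    (b x : F) : (∀ y, QuadraticMap.polar (kasamiForm σ bar a b) x y = 0) ↔
      σ (2 * a * bar x + b * σ x) + b * x = 0 := by
  simp only [polar_kasamiForm hbar ha]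
  constructor
  · intro h
    refine eq_zero_of_trace_mul (p := p) fun y => ?_
    simpa using h (σ.symm y)
  · intro h y
    rw [h, zero_mul, map_zero]

/-- The composite `x ↦ σ (bar x)`. -/
def twist (σ bar : F ≃ₐ[ZMod p] F) : F ≃ₐ[ZMod p] F := bar.trans σ

lemma twist_apply (x : F) : twist σ bar x = σ (bar x) := rfl

lemma sigma_eq_bar (hbar : ∀ x, bar (bar x) = x) (hcomm : ∀ x, σ (bar x) = bar (σ x))
    {u : F} (hu : u ∈ fixed (twist σ bar)) : σ u = bar u := by
  rw [mem_fixed, twist_apply, hcomm] at hu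
  rw [← hbar (σ u), hu]

lemma two_ne_zero_field (hp : p ≠ 2) : (2 : F) ≠ 0 := by
  have h := (algebraMap (ZMod p) F).injective.ne (two_ne_zero_zmod hp)
  rwa [map_ofNat, map_zero] at h

variable [Fintype F] [DecidableEq F]

lemma card_radical_eq (hbar : ∀ x, bar (bar x) = x) {a : F} (ha : bar a = a) (b : F) :
    Nat.card {x : F | ∀ y, QuadraticMap.polar (kasamiForm σ bar a b) x y = 0} =
      radCard σ bar a b := by
  simp only [polar_eq_zero_iff hbar ha, radCard]
  rw [Nat.card_eq_fintype_card]
  exact Fintype.card_subtype _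

lemma normSq_expSum (hp : p ≠ 2) (hbar : ∀ x, bar (bar x) = x) {a : F} (ha : bar a = a) (b : F) :
    Complex.normSq (expSum σ bar a b) = Fintype.card F * radCard σ bar a b := by
  rw [← card_radical_eq hbar ha, ← normSq_sum_quadraticForm hp]
  rfl

lemma radCard_pos (a b : F) : 0 < radCard σ bar a b :=
  Finset.card_pos.mpr ⟨0, by simp⟩

/-! ### Sums of the norm form -/

/-- Elements `y + bar y` lie in the fixed field of `bar`, and testing on them recovers `Tr (2 κ y)`;
a trivial character would force `κ = 0`. -/
lemma sum_fixed_mul (hp : p ≠ 2) (hbar : ∀ x, bar (bar x) = x) {κ : F} (hκ : bar κ = κ)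
    (hκ0 : κ ≠ 0) : ∑ e : fixed bar, traceChar p F (κ * e) = 0 := by
  classical
  have h := sum_traceChar_comp (p := p)
    ((AddMonoidHom.mulLeft κ).comp (fixed bar).val.toAddMonoidHom)
  have h' : ∑ e : fixed bar, traceChar p F (κ * e) =
      if ∀ e : fixed bar, Algebra.trace (ZMod p) F (κ * e) = 0 then
        (Fintype.card (fixed bar) : ℂ) else 0 := h
  rw [h', if_neg]
  intro h0
  have h2 : 2 * κ = 0 := by
    refine eq_zero_of_trace_mul (p := p) fun y => ?_
    have h3 := h0 ⟨y + bar y, by rw [mem_fixed, map_add, hbar, add_comm]⟩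
    simp only [mul_add, map_add] at h3
    rw [← Algebra.trace_eq_of_algEquiv bar (κ * bar y), map_mul bar, hbar, hκ] at h3
    rw [two_mul, add_mul, map_add]; exact h3
  exact hκ0 ((mul_eq_zero.mp h2).resolve_left (two_ne_zero_field hp))

/-- The norm takes each nonzero value of the fixed field `N + 1` times, but the value `0` only once.
Were `0` also taken `N + 1` times, the sum would be a multiple of a vanishing character sum; the
defect at `0` is `-N`. -/
lemma sum_norm (hp : p ≠ 2) (hbar : ∀ x, bar (bar x) = x) {N : ℕ}
    (hN : ∀ e : F, bar e = e → e ≠ 0 →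
      (Finset.univ.filter fun w : F => w * bar w = e).card = N + 1)
    {κ : F} (hκ : bar κ = κ) (hκ0 : κ ≠ 0) :
    ∑ w, traceChar p F (κ * (w * bar w)) = -N := by
  classical
  have hmem : ∀ w : F, w * bar w ∈ fixed bar := fun w => by
    rw [mem_fixed, map_mul, hbar, mul_comm]
  have h1 : ∑ w, traceChar p F (κ * (w * bar w)) =
      ∑ e : fixed bar, ∑ w ∈ Finset.univ.filter (fun w : F => (⟨_, hmem w⟩ : fixed bar) = e),
        traceChar p F (κ * (w * bar w)) := (Finset.sum_fiberwise _ _ _).symm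
  have h2 : ∀ e : fixed bar,
      ∑ w ∈ Finset.univ.filter (fun w : F => (⟨_, hmem w⟩ : fixed bar) = e),
        traceChar p F (κ * (w * bar w)) =
      (N + 1) * traceChar p F (κ * e) - (if e = 0 then (N : ℂ) else 0) := by
    intro e
    have hc : ∀ w ∈ Finset.univ.filter (fun w : F => (⟨_, hmem w⟩ : fixed bar) = e),
        traceChar p F (κ * (w * bar w)) = traceChar p F (κ * e) := by
      intro w hw
      rw [← (Finset.mem_filter.mp hw).2]
    rw [Finset.sum_congr rfl hc, Finset.sum_const, nsmul_eq_mul]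
    by_cases he : e = 0
    · subst he
      have : (Finset.univ.filter (fun w : F => (⟨_, hmem w⟩ : fixed bar) = 0)) = {0} := by
        ext w
        simp [Subtype.ext_iff]
      rw [this]; simp
    · rw [if_neg he, sub_zero]
      congr 1
      have := hN e (fixed_apply e) (by simpa using he)
      rw [← Nat.cast_add_one, ← this]
      congr 2
      ext w
      simp [Subtype.ext_iff]
  rw [h1, Finset.sum_congr rfl fun e _ => h2 e, Finset.sum_sub_distrib, ← Finset.mul_sum,
    sum_fixed_mul hp hbar hκ hκ0]
  simp

/-- Complete the square by the shift `bar u / (2 κ)`. The leftover mixed terms have the form `bar z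
- z`, of trace zero. -/
lemma sum_norm_sub (hp : p ≠ 2) (hbar : ∀ x, bar (bar x) = x) {N : ℕ}
    (hN : ∀ e : F, bar e = e → e ≠ 0 →
      (Finset.univ.filter fun w : F => w * bar w = e).card = N + 1)
    {κ : F} (hκ : bar κ = κ) (hκ0 : κ ≠ 0) (u : F) :
    ∑ w, traceChar p F (κ * (w * bar w) - u * w) =
      -N * traceChar p F (-(u * bar u / (4 * κ))) := by
  have h2 := two_ne_zero_field (p := p) (F := F) hp
  have h4 : (4 : F) ≠ 0 := by
    rw [show (4 : F) = 2 * 2 by norm_num]; exact mul_ne_zero h2 h2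
  rw [← Equiv.sum_comp (Equiv.addRight (bar u / (2 * κ))), ← sum_norm hp hbar hN hκ hκ0,
    Finset.sum_mul]
  refine Finset.sum_congr rfl fun w _ => ?_
  rw [← AddChar.map_add_eq_mul, traceChar_apply, traceChar_apply]
  congr 1
  simp only [Equiv.coe_addRight]
  have hb : bar (bar u / (2 * κ)) = u / (2 * κ) := by
    rw [map_div₀, hbar, map_mul, hκ, map_ofNat]
  rw [map_add bar, hb]
  have e1 : κ * ((w + bar u / (2 * κ)) * (bar w + u / (2 * κ))) - u * (w + bar u / (2 * κ)) =
      (κ * (w * bar w) + -(u * bar u / (4 * κ))) + (bar (u * w / 2) - u * w / 2) := by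
    rw [map_div₀, map_mul, map_ofNat]
    field_simp
    ring
  rw [e1, map_add, map_sub, Algebra.trace_eq_of_algEquiv, sub_self, add_zero]

/-! ### Forms with a nontrivial radical -/

/-- Poisson summation for the additive map `σ - bar`. By `Tr (u (σ x - bar x)) = Tr ((u - σ (bar u))
σ x)`, the annihilator of its image is the fixed field of `twist σ bar`. -/
lemma sum_comp_sub (hbar : ∀ x, bar (bar x) = x) (f : F → ℂ) :
    ∑ x, f (σ x - bar x) =
      ∑ u : fixed (twist σ bar), ∑ w, f w * traceChar p F (-((u : F) * w)) := by
  classical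
  have hq : (Fintype.card F : ℂ) ≠ 0 := Nat.cast_ne_zero.mpr Fintype.card_ne_zero
  apply mul_left_cancel₀ hq
  have h1 : ∀ u : F, ∑ x, traceChar p F (u * (σ x - bar x)) =
      if u ∈ fixed (twist σ bar) then (Fintype.card F : ℂ) else 0 := by
    intro u
    have hx : ∀ x, traceChar p F (u * (σ x - bar x)) =
        traceChar p F ((u - σ (bar u)) * σ x) := by
      intro x
      rw [traceChar_apply, traceChar_apply]
      congr 1
      have : Algebra.trace (ZMod p) F (u * bar x) =
          Algebra.trace (ZMod p) F (σ (bar u) * σ x) := by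
        rw [← map_mul, Algebra.trace_eq_of_algEquiv, ← Algebra.trace_eq_of_algEquiv bar, map_mul,
          hbar]
      rw [mul_sub, map_sub, this, sub_mul, map_sub]
    have hσ : ∑ x, traceChar p F ((u - σ (bar u)) * σ x) =
        ∑ y, traceChar p F ((u - σ (bar u)) * y) :=
      Equiv.sum_comp σ.toEquiv (fun y => traceChar p F ((u - σ (bar u)) * y))
    rw [Finset.sum_congr rfl fun x _ => hx x, hσ, sum_traceChar_mul]
    simp only [sub_eq_zero, mem_fixed, twist_apply]
    congr 1
    exact propext eq_comm
  have h2 : ∀ x, (Fintype.card F : ℂ) * f (σ x - bar x) =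
      ∑ w, f w * ∑ u, traceChar p F ((σ x - bar x - w) * u) := by
    intro x
    simp only [sum_traceChar_mul, sub_eq_zero]
    simp [mul_comm]
  calc (Fintype.card F : ℂ) * ∑ x, f (σ x - bar x)
      = ∑ x, ∑ w, ∑ u, f w * traceChar p F ((σ x - bar x - w) * u) := by
        rw [Finset.mul_sum]
        refine Finset.sum_congr rfl fun x _ => ?_
        rw [h2]; simp only [Finset.mul_sum]
    _ = ∑ u, ∑ w, f w * traceChar p F (-(u * w)) * ∑ x, traceChar p F (u * (σ x - bar x)) := by
        simp only [Finset.mul_sum]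
        rw [Finset.sum_congr rfl fun x _ => Finset.sum_comm, Finset.sum_comm]
        refine Finset.sum_congr rfl fun u _ => ?_
        rw [Finset.sum_comm]
        refine Finset.sum_congr rfl fun w _ => Finset.sum_congr rfl fun x _ => ?_
        rw [mul_assoc, ← AddChar.map_add_eq_mul]
        congr 2; ring
    _ = ∑ u, if u ∈ fixed (twist σ bar) then
          (Fintype.card F : ℂ) * ∑ w, f w * traceChar p F (-(u * w)) else 0 := by
        refine Finset.sum_congr rfl fun u _ => ?_
        simp only [h1]
        split_ifs
        · rw [← Finset.sum_mul, mul_comm]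
        · simp
    _ = _ := by
        rw [← Finset.sum_filter, Finset.mul_sum]
        refine Finset.sum_subtype _ (fun x => by simp) _

/-- The value of an exponential sum with nontrivial radical. -/
noncomputable def gaussFixed (σ bar : F ≃ₐ[ZMod p] F) (ω : F) : ℂ :=
  ∑ y : fixed (twist σ bar), traceChar p F ((y : F) * bar y / (2 * ω))

/-- Replacing `x` by `x₀ x` and adding terms of trace zero turns the form into `Tr (κ N(σ x - bar
x))`, where `κ = -σ ω / 2` and `N(w) = w bar(w)`. Poisson summation reduces the sum to the fixed
field of `twist σ bar`, and each inner sum is a shifted norm sum. Applying `σ` finally replaces `σ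
ω` by `ω`. -/
lemma expSum_of_radical (hp : p ≠ 2) (hbar : ∀ x, bar (bar x) = x)
    (hcomm : ∀ x, σ (bar x) = bar (σ x)) {N : ℕ}
    (hN : ∀ e : F, bar e = e → e ≠ 0 →
      (Finset.univ.filter fun w : F => w * bar w = e).card = N + 1)
    {ω : F} (hω : bar ω = ω) (hω0 : ω ≠ 0) {x₀ : F} (hx₀ : x₀ ≠ 0) :
    expSum σ bar (-(ω + σ ω) / (2 * (x₀ * bar x₀))) (σ ω / (x₀ * σ x₀)) =
      -N * gaussFixed σ bar ω := by
  classical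
  have h2 := two_ne_zero_field (p := p) (F := F) hp
  have h4 : (4 : F) ≠ 0 := by
    rw [show (4 : F) = 2 * 2 by norm_num]; exact mul_ne_zero h2 h2
  have hb0 : bar x₀ ≠ 0 := by simpa using hx₀
  have hs0 : σ x₀ ≠ 0 := by simpa using hx₀
  have hsω0 : σ ω ≠ 0 := by simpa using hω0
  have hsω : bar (σ ω) = σ ω := by rw [← hcomm, hω]
  set κ : F := -(σ ω) / 2 with hκdef
  have hκ : bar κ = κ := by rw [hκdef, map_div₀, map_neg, hsω, map_ofNat]
  have hκ0 : κ ≠ 0 := div_ne_zero (neg_ne_zero.mpr hsω0) h2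
  have h1 : expSum σ bar (-(ω + σ ω) / (2 * (x₀ * bar x₀))) (σ ω / (x₀ * σ x₀)) =
      ∑ x, traceChar p F (κ * ((σ x - bar x) * bar (σ x - bar x))) := by
    rw [expSum, ← Equiv.sum_comp (Equiv.mulLeft₀ x₀ hx₀)]
    refine Finset.sum_congr rfl fun x _ => ?_
    rw [traceChar_apply, traceChar_apply]
    congr 1
    rw [show (Equiv.mulLeft₀ x₀ hx₀) x = x₀ * x from rfl, map_mul, map_mul]
    have e1 : -(ω + σ ω) / (2 * (x₀ * bar x₀)) * (x₀ * x * (bar x₀ * bar x)) +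
        σ ω / (x₀ * σ x₀) * (x₀ * x * (σ x₀ * σ x)) =
        κ * ((σ x - bar x) * bar (σ x - bar x)) +
          (σ (ω / 2 * (x * bar x)) - ω / 2 * (x * bar x)) +
          (σ ω * (x * σ x) / 2 - bar (σ ω * (x * σ x) / 2)) := by
      simp only [map_mul, map_div₀, map_sub, hbar, hsω, map_ofNat, hcomm, hκdef]
      field_simp
      ring
    rw [e1]
    simp only [map_add, map_sub (Algebra.trace (ZMod p) F), Algebra.trace_eq_of_algEquiv,
      sub_self, add_zero]
  rw [h1, sum_comp_sub (σ := σ) hbar (fun w => traceChar p F (κ * (w * bar w))), gaussFixed,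
    Finset.mul_sum]
  refine Finset.sum_congr rfl fun u _ => ?_
  have h3 : ∀ w : F, traceChar p F (κ * (w * bar w)) * traceChar p F (-((u : F) * w)) =
      traceChar p F (κ * (w * bar w) - u * w) := by
    intro w; rw [← AddChar.map_add_eq_mul, sub_eq_add_neg]
  rw [Finset.sum_congr rfl fun w _ => h3 w, sum_norm_sub hp hbar hN hκ hκ0]
  congr 1
  have hu := sigma_eq_bar hbar hcomm u.2
  have hu' : σ (bar (u : F)) = u := u.2
  rw [← traceChar_algEquiv σ ((u : F) * bar u / (2 * ω)), map_div₀, map_mul, map_mul, hu, hu',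
    map_ofNat, hκdef]
  congr 1
  field_simp
  ring

end

end Kasami

/-! ### Forms with nontrivial radical when the fixed field of `twist σ bar` lies in that of `bar`.
-/

namespace Kasami

variable {p : ℕ} [Fact p.Prime] {F : Type*} [Field F] [Algebra (ZMod p) F]
variable {σ bar : F ≃ₐ[ZMod p] F}

/-- Put `β = b x σ(x)`. The radical equation and its image under `bar` show that both `σ` and `bar`
negate `γ = β - bar β`. Then `twist σ bar` fixes `γ`, so by `hK` also `bar γ = γ`, whence `γ = 0`.
Now `ω = σ⁻¹ β` expresses both coefficients. -/
lemma radical_param (hp : p ≠ 2) (hbar : ∀ x, bar (bar x) = x)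
    (hcomm : ∀ x, σ (bar x) = bar (σ x)) (hK : ∀ y, σ (bar y) = y → bar y = y)
    {a b x : F} (ha : bar a = a) (hx : x ≠ 0)
    (h : σ (2 * a * bar x + b * σ x) + b * x = 0) :
    ∃ ω, bar ω = ω ∧ a = -(ω + σ ω) / (2 * (x * bar x)) ∧ b = σ ω / (x * σ x) := by
  have h2 := two_ne_zero_field (p := p) (F := F) hp
  have hb0 : bar x ≠ 0 := by simpa using hx
  have hs0 : σ x ≠ 0 := by simpa using hx
  have h1 : σ (2 * (a * (x * bar x)) + b * (x * σ x)) + b * (x * σ x) = 0 := by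
    have := congrArg (· * σ x) h
    simp only [add_mul, map_add, map_mul, zero_mul] at this ⊢
    linear_combination this
  set β : F := b * (x * σ x) with hβdef
  have h3 : σ (2 * (a * (x * bar x)) + bar β) + bar β = 0 := by
    have := congrArg bar h1
    rw [map_add bar, ← hcomm, map_zero, map_add bar, map_mul bar, map_mul bar, map_mul bar, hbar,
      ha, map_ofNat, mul_comm (bar x)] at this
    exact this
  have hβ : bar β = β := by
    have hγ1 : σ (β - bar β) = -(β - bar β) := by
      simp only [map_add, map_sub] at h1 h3 ⊢
      linear_combination h1 - h3
    have hγ2 : bar (β - bar β) = -(β - bar β) := by rw [map_sub, hbar]; ring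
    have h5 := hK (β - bar β) (by rw [hγ2, map_neg, hγ1, neg_neg])
    have h6 : 2 * (β - bar β) = 0 := by linear_combination hγ2 - h5
    have := (mul_eq_zero.mp h6).resolve_left h2
    exact (sub_eq_zero.mp this).symm
  refine ⟨σ.symm β, ?_, ?_, ?_⟩
  · apply σ.injective
    rw [hcomm, AlgEquiv.apply_symm_apply, hβ]
  · have h7 : 2 * (a * (x * bar x)) + β = -σ.symm β := by
      apply σ.injective
      rw [map_neg, AlgEquiv.apply_symm_apply]
      linear_combination h1
    rw [AlgEquiv.apply_symm_apply]
    field_simp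
    linear_combination h7
  · rw [AlgEquiv.apply_symm_apply, hβdef]
    field_simp

lemma radical_param_mem (hp : p ≠ 2) {ω x : F} (hx : x ≠ 0) :
    σ (2 * (-(ω + σ ω) / (2 * (x * bar x))) * bar x + σ ω / (x * σ x) * σ x) +
      σ ω / (x * σ x) * x = 0 := by
  have h2 := two_ne_zero_field (p := p) (F := F) hp
  have hb0 : bar x ≠ 0 := by simpa using hx
  have hs0 : σ x ≠ 0 := by simpa using hx
  have : 2 * (-(ω + σ ω) / (2 * (x * bar x))) * bar x + σ ω / (x * σ x) * σ x = -ω / x := by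
    field_simp; ring
  rw [this, map_div₀, map_neg]
  field_simp; ring

variable [Fintype F] [DecidableEq F]

/-- The nonzero fixed points. -/
def fixedUnits (φ : F ≃ₐ[ZMod p] F) : Finset F :=
  Finset.univ.filter fun x => φ x = x ∧ x ≠ 0

lemma mem_fixedUnits {φ : F ≃ₐ[ZMod p] F} {x : F} : x ∈ fixedUnits φ ↔ φ x = x ∧ x ≠ 0 := by
  simp [fixedUnits]

lemma sum_fixed_eq (φ : F ≃ₐ[ZMod p] F) (f : F → ℂ) :
    ∑ e : fixed φ, f e = f 0 + ∑ e ∈ fixedUnits φ, f e := by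
  have h : insert 0 (fixedUnits φ) = Finset.univ.filter (· ∈ fixed φ) := by
    ext x
    simp only [Finset.mem_insert, mem_fixedUnits, Finset.mem_filter_univ, mem_fixed]
    by_cases hx : x = 0
    · simp [hx]
    · simp [hx]
  rw [← Finset.sum_insert (by simp [mem_fixedUnits]), h]
  exact (Finset.sum_subtype _ (fun x => by simp) _).symm

lemma card_fixedUnits (φ : F ≃ₐ[ZMod p] F) :
    ((fixedUnits φ).card : ℂ) = Fintype.card (fixed φ) - 1 := by
  have := sum_fixed_eq φ (fun _ => 1)
  simp only [Finset.sum_const, nsmul_eq_mul, mul_one, Finset.card_univ] at this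
  rw [this]; ring

lemma sum_fixedUnits_inv (φ : F ≃ₐ[ZMod p] F) (f : F → ℂ) :
    ∑ e ∈ fixedUnits φ, f e⁻¹ = ∑ e ∈ fixedUnits φ, f e := by
  refine Finset.sum_nbij' (fun x => x⁻¹) (fun x => x⁻¹) ?_ ?_ ?_ ?_ ?_
  · intro x hx
    rw [mem_fixedUnits] at hx ⊢
    exact ⟨by rw [map_inv₀, hx.1], inv_ne_zero hx.2⟩
  · intro x hx
    rw [mem_fixedUnits] at hx ⊢
    exact ⟨by rw [map_inv₀, hx.1], inv_ne_zero hx.2⟩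
  · simp
  · simp
  · simp

/-- Double counting of the pairs (form, nonzero radical element). -/
lemma sum_radCard_mul (hp : p ≠ 2) (hbar : ∀ x, bar (bar x) = x)
    (hcomm : ∀ x, σ (bar x) = bar (σ x)) (hK : ∀ y, σ (bar y) = y → bar y = y)
    (g : F → F → ℂ) :
    ∑ P ∈ Finset.univ.filter (fun P : fixed bar × F => P ≠ 0),
        ((radCard σ bar P.1 P.2 : ℂ) - 1) * g P.1 P.2 =
      ∑ x ∈ Finset.univ.filter (fun x : F => x ≠ 0), ∑ ω ∈ fixedUnits bar,
        g (-(ω + σ ω) / (2 * (x * bar x))) (σ ω / (x * σ x)) := by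
  have h1 : ∀ P : fixed bar × F, ((radCard σ bar P.1 P.2 : ℂ) - 1) * g P.1 P.2 =
      ∑ x ∈ Finset.univ.filter (fun x : F => x ≠ 0),
        if σ (2 * P.1 * bar x + P.2 * σ x) + P.2 * x = 0 then g P.1 P.2 else 0 := by
    intro P
    have h2 : (radCard σ bar (P.1 : F) P.2 : ℂ) = 1 +
        ∑ x ∈ Finset.univ.filter (fun x : F => x ≠ 0),
          if σ (2 * P.1 * bar x + P.2 * σ x) + P.2 * x = 0 then (1 : ℂ) else 0 := by
      rw [radCard, Finset.card_filter]
      push_cast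
      rw [← Finset.add_sum_erase _ _ (Finset.mem_univ 0)]
      congr 1
      · simp
      · congr 1; ext x; simp
    rw [h2, add_sub_cancel_left, Finset.sum_mul]
    exact Finset.sum_congr rfl fun x _ => by split_ifs <;> simp
  rw [Finset.sum_congr rfl fun P _ => h1 P, Finset.sum_comm]
  refine Finset.sum_congr rfl fun x hx => ?_
  have hx0 : x ≠ 0 := by simpa using hx
  have h2 := two_ne_zero_field (p := p) (F := F) hp
  have hb0 : bar x ≠ 0 := by simpa using hx0
  have hs0 : σ x ≠ 0 := by simpa using hx0
  rw [← Finset.sum_filter, Finset.filter_filter]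
  symm
  have hmem : ∀ ω ∈ fixedUnits bar, -(ω + σ ω) / (2 * (x * bar x)) ∈ fixed bar := by
    intro ω hω
    have hω' := (mem_fixedUnits.mp hω).1
    rw [mem_fixed, map_div₀, map_neg, map_add, ← hcomm, hω', map_mul, map_mul, hbar, map_ofNat,
      mul_comm (bar x)]
  -- For fixed `x`, `radical_param` and `radical_param_mem` match the nonzero forms having `x` in
  -- the radical with the nonzero `ω` fixed by `bar`; the second coefficient determines `ω`.
  refine Finset.sum_bij (fun ω hω => ((⟨_, hmem ω hω⟩ : fixed bar), σ ω / (x * σ x))) ?_ ?_ ?_ ?_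
  · intro ω hω
    rw [Finset.mem_filter]
    refine ⟨Finset.mem_univ _, ?_, radical_param_mem hp hx0⟩
    intro h0
    have := congrArg Prod.snd h0
    simp only [Prod.snd_zero, div_eq_zero_iff, mul_eq_zero, hx0, hs0, or_self, or_false] at this
    exact (mem_fixedUnits.mp hω).2 (by simpa using this)
  · intro ω _ ω' _ h
    have := congrArg Prod.snd h
    simp only at this
    exact σ.injective ((div_left_inj' (mul_ne_zero hx0 hs0)).mp this)
  · rintro ⟨a, b⟩ hP
    rw [Finset.mem_filter] at hP
    obtain ⟨ω, hω, ha, hb⟩ := radical_param hp hbar hcomm hK (fixed_apply a) hx0 hP.2.2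
    have hω0 : ω ≠ 0 := by
      rintro rfl
      apply hP.2.1
      ext
      · simpa using ha
      · simpa using hb
    exact ⟨ω, mem_fixedUnits.mpr ⟨hω, hω0⟩, Prod.ext (Subtype.ext ha.symm) hb.symm⟩
  · intro ω _; rfl

/-! ### The values of `gaussFixed` when the fixed field of `twist` lies in that of `bar` -/

variable (p σ bar) in
/-- The condition that `ω⁻¹` is orthogonal to the fixed field of `twist σ bar`. -/
def IsOrth (ω : F) : Prop :=
  ∀ y : fixed (twist σ bar), Algebra.trace (ZMod p) F ((y : F) / ω) = 0

lemma gaussFixed_eq (hK : ∀ y, σ (bar y) = y → bar y = y) (ω : F) :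
    gaussFixed σ bar ω = ∑ y : fixed (twist σ bar), traceChar p F ((y : F) ^ 2 / (2 * ω)) := by
  refine Finset.sum_congr rfl fun y _ => ?_
  rw [hK y y.2, pow_two]

/-- The fixed field contains `y ^ 2 / 2` along with `y`, so every summand equals `1`. -/
lemma gaussFixed_of_orthogonal (hK : ∀ y, σ (bar y) = y → bar y = y) {ω : F}
    (h : IsOrth p σ bar ω) :
    gaussFixed σ bar ω = Fintype.card (fixed (twist σ bar)) := by
  rw [gaussFixed_eq hK, Finset.sum_congr rfl (g := fun _ => 1)]
  · simp
  · intro y _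
    rw [traceChar_eq_one_iff]
    have hmem : (y : F) ^ 2 / 2 ∈ fixed (twist σ bar) := by
      rw [mem_fixed, map_div₀, map_pow, fixed_apply, map_ofNat]
    have := h ⟨_, hmem⟩
    rwa [div_div] at this

open Classical in
lemma sum_fixed_trace_div (ω : F) :
    ∑ y : fixed (twist σ bar), traceChar p F ((y : F) / ω) =
      if IsOrth p σ bar ω then (Fintype.card (fixed (twist σ bar)) : ℂ) else 0 := by
  have h := sum_traceChar_comp (p := p)
    ((AddMonoidHom.mulRight ω⁻¹).comp (fixed (twist σ bar)).val.toAddMonoidHom)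
  have e : (∀ a, Algebra.trace (ZMod p) F
      (((AddMonoidHom.mulRight ω⁻¹).comp (fixed (twist σ bar)).val.toAddMonoidHom) a) = 0) ↔
      IsOrth p σ bar ω := by
    simp only [IsOrth, div_eq_mul_inv]; rfl
  have e' : ∑ y : fixed (twist σ bar), traceChar p F ((y : F) / ω) = ∑ a, traceChar p F
      (((AddMonoidHom.mulRight ω⁻¹).comp (fixed (twist σ bar)).val.toAddMonoidHom) a) := by
    simp only [div_eq_mul_inv]; rfl
  rw [e', h]
  by_cases h0 : IsOrth p σ bar ω
  · rw [if_pos h0, if_pos (e.mpr h0)]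
  · rw [if_neg h0, if_neg (e.not.mpr h0)]

/-- The usual evaluation of the modulus of a Gauss sum over `K = fixed (twist σ bar)`: after
substituting `z + v` in the product with the conjugate, the sum over `z` is a character sum over
`K`. For `v ≠ 0` it vanishes, because division by `v` preserves `K` and so orthogonality for `ω / v`
would give it for `ω`. -/
lemma normSq_gaussFixed (hp : p ≠ 2) (hK : ∀ y, σ (bar y) = y → bar y = y) {ω : F} (hω : ω ≠ 0)
    (h : ¬ IsOrth p σ bar ω) :
    Complex.normSq (gaussFixed σ bar ω) = Fintype.card (fixed (twist σ bar)) := by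
  classical
  have h2 := two_ne_zero_field (p := p) (F := F) hp
  have key : gaussFixed σ bar ω * (starRingEnd ℂ) (gaussFixed σ bar ω) =
      (Fintype.card (fixed (twist σ bar)) : ℂ) := by
    have e1 : gaussFixed σ bar ω * (starRingEnd ℂ) (gaussFixed σ bar ω) =
        ∑ v : fixed (twist σ bar), traceChar p F ((v : F) ^ 2 / (2 * ω)) *
          ∑ z : fixed (twist σ bar), traceChar p F ((z : F) * v / ω) := by
      rw [gaussFixed_eq hK, map_sum, Finset.mul_sum]
      rw [Finset.sum_congr rfl (g := fun z : fixed (twist σ bar) => ∑ v : fixed (twist σ bar),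
        traceChar p F ((v : F) ^ 2 / (2 * ω)) * traceChar p F ((z : F) * v / ω))]
      · rw [Finset.sum_comm]
        simp only [Finset.mul_sum]
      · intro z _
        rw [Finset.sum_mul, ← Equiv.sum_comp (Equiv.addRight z)]
        refine Finset.sum_congr rfl fun v _ => ?_
        rw [star_traceChar, ← AddChar.map_add_eq_mul, ← AddChar.map_add_eq_mul]
        congr 1
        simp only [Equiv.coe_addRight, Subalgebra.coe_add]
        field_simp
        ring
    rw [e1, Finset.sum_eq_single 0]
    · simp
    · intro v _ hv
      have hv0 : (v : F) ≠ 0 := by simpa using hv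
      have hmul : ∀ z : fixed (twist σ bar), (z : F) * v / ω = (z : F) / (ω / v) := by
        intro z; field_simp
      simp only [hmul]
      rw [sum_fixed_trace_div, if_neg, mul_zero]
      intro h'
      apply h
      intro y
      have hy : (y : F) / v ∈ fixed (twist σ bar) := by
        rw [mem_fixed, map_div₀, fixed_apply, fixed_apply]
      have := h' ⟨_, hy⟩
      convert this using 2
      simp only; field_simp
    · simp
  rw [Complex.mul_conj] at key
  exact_mod_cast key

-- Sum `traceChar (y / ω)` over both variables in two orders; for `y ≠ 0`, inverting `ω` leaves a
-- complete character sum lacking its term at zero. The added `1` stands for the zero element: the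
-- inverses of the orthogonal `ω`, together with `0`, form the annihilator of `fixed (twist σ bar)`
-- inside `fixed bar`.
open Classical in
lemma card_isOrth (hp : p ≠ 2) (hbar : ∀ x, bar (bar x) = x)
    (hK : ∀ y, σ (bar y) = y → bar y = y) :
    (Fintype.card (fixed (twist σ bar)) : ℂ) *
      (((fixedUnits bar).filter (IsOrth p σ bar)).card + 1) = Fintype.card (fixed bar) := by
  have e1 : ∑ ω ∈ fixedUnits bar, ∑ y : fixed (twist σ bar), traceChar p F ((y : F) / ω) =
      (Fintype.card (fixed (twist σ bar)) : ℂ) *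
        ((fixedUnits bar).filter (IsOrth p σ bar)).card := by
    simp only [sum_fixed_trace_div]
    rw [← Finset.sum_filter, Finset.sum_const, nsmul_eq_mul, mul_comm]
  have e2 : ∀ y : fixed (twist σ bar), y ∈ Finset.univ.erase 0 →
      ∑ ω ∈ fixedUnits bar, traceChar p F ((y : F) / ω) = -1 := by
    intro y hy
    have hy0 : (y : F) ≠ 0 := by simpa using Finset.ne_of_mem_erase hy
    simp only [div_eq_mul_inv]
    rw [sum_fixedUnits_inv bar (fun e => traceChar p F ((y : F) * e))]
    have h3 := sum_fixed_eq bar (fun e => traceChar p F ((y : F) * e))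
    rw [sum_fixed_mul hp hbar (hK y y.2) hy0] at h3
    simp only [mul_zero, AddChar.map_zero_eq_one] at h3
    linear_combination -h3
  rw [Finset.sum_comm, ← Finset.add_sum_erase _ _ (Finset.mem_univ 0), Finset.sum_congr rfl e2]
    at e1
  have hc : (((Finset.univ : Finset (fixed (twist σ bar))).erase 0).card : ℂ) =
      Fintype.card (fixed (twist σ bar)) - 1 := by
    rw [Finset.card_erase_of_mem (Finset.mem_univ _), Finset.card_univ,
      Nat.cast_pred Fintype.card_pos]
  simp only [ZeroMemClass.coe_zero, zero_div, AddChar.map_zero_eq_one, Finset.sum_const,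
    nsmul_eq_mul, hc, card_fixedUnits] at e1
  linear_combination -e1

/-- The term `y = 0` contributes the number of `ω`, and every other `y` contributes `-1` after
inverting `ω`. -/
lemma sum_gaussFixed (hp : p ≠ 2) (hbar : ∀ x, bar (bar x) = x)
    (hK : ∀ y, σ (bar y) = y → bar y = y) :
    ∑ ω ∈ fixedUnits bar, gaussFixed σ bar ω =
      Fintype.card (fixed bar) - Fintype.card (fixed (twist σ bar)) := by
  have h2 := two_ne_zero_field (p := p) (F := F) hp
  simp only [gaussFixed_eq hK]
  have e2 : ∀ y : fixed (twist σ bar), y ∈ Finset.univ.erase 0 →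
      ∑ ω ∈ fixedUnits bar, traceChar p F ((y : F) ^ 2 / (2 * ω)) = -1 := by
    intro y hy
    have hy0 : (y : F) ≠ 0 := by simpa using Finset.ne_of_mem_erase hy
    simp only [← div_div]
    simp only [div_eq_mul_inv]
    rw [sum_fixedUnits_inv bar (fun e => traceChar p F ((y : F) ^ 2 * 2⁻¹ * e))]
    have h3 := sum_fixed_eq bar (fun e => traceChar p F ((y : F) ^ 2 * 2⁻¹ * e))
    rw [sum_fixed_mul hp hbar (by rw [map_mul, map_pow, hK y y.2, map_inv₀, map_ofNat])
      (mul_ne_zero (pow_ne_zero _ hy0) (inv_ne_zero h2))] at h3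
    simp only [mul_zero, AddChar.map_zero_eq_one] at h3
    linear_combination -h3
  have hc : (((Finset.univ : Finset (fixed (twist σ bar))).erase 0).card : ℂ) =
      Fintype.card (fixed (twist σ bar)) - 1 := by
    rw [Finset.card_erase_of_mem (Finset.mem_univ _), Finset.card_univ,
      Nat.cast_pred Fintype.card_pos]
  rw [Finset.sum_comm, ← Finset.add_sum_erase _ _ (Finset.mem_univ 0), Finset.sum_congr rfl e2]
  simp only [ZeroMemClass.coe_zero, ne_eq, OfNat.ofNat_ne_zero, not_false_eq_true, zero_pow,
    zero_div, AddChar.map_zero_eq_one, Finset.sum_const, nsmul_eq_mul, hc, card_fixedUnits]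
  ring

-- By `card_isOrth`, the orthogonal `ω` already account for the whole of `sum_gaussFixed`.
open Classical in
lemma sum_gaussFixed_not_isOrth (hp : p ≠ 2) (hbar : ∀ x, bar (bar x) = x)
    (hK : ∀ y, σ (bar y) = y → bar y = y) :
    ∑ ω ∈ (fixedUnits bar).filter (fun ω => ¬ IsOrth p σ bar ω), gaussFixed σ bar ω = 0 := by
  have h := sum_gaussFixed hp hbar hK
  have h' : ∑ ω ∈ (fixedUnits bar).filter (IsOrth p σ bar), gaussFixed σ bar ω =
      ∑ _ω ∈ (fixedUnits bar).filter (IsOrth p σ bar),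
        (Fintype.card (fixed (twist σ bar)) : ℂ) :=
    Finset.sum_congr rfl fun ω hω => gaussFixed_of_orthogonal hK (Finset.mem_filter.mp hω).2
  rw [← Finset.sum_filter_add_sum_filter_not _ (IsOrth p σ bar), h', Finset.sum_const,
    nsmul_eq_mul] at h
  linear_combination h - card_isOrth hp hbar hK

/-! ### The distribution of radicals and exponential sums -/

/-- Summation over the second coefficient alone kills every `x ≠ 0`, since then `x σ(x) ≠ 0`. -/
lemma sum_expSum :
    ∑ P : fixed bar × F, expSum σ bar P.1 P.2 =
      Fintype.card (fixed bar) * Fintype.card F := by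
  simp only [expSum]
  rw [Finset.sum_comm]
  have h1 : ∀ x : F, ∑ P : fixed bar × F, traceChar p F (P.1 * (x * bar x) + P.2 * (x * σ x)) =
      if x = 0 then (Fintype.card (fixed bar) : ℂ) * Fintype.card F else 0 := by
    intro x
    rw [Fintype.sum_prod_type]
    simp only [AddChar.map_add_eq_mul, ← Finset.mul_sum, mul_comm _ (x * σ x)]
    simp only [sum_traceChar_mul, mul_eq_zero]
    split_ifs with h1 h2 h2
    · subst h2; simp
    · simp [h2] at h1
    · exact absurd (Or.inl h2) h1
    · simp
  rw [Finset.sum_congr rfl fun x _ => h1 x]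
  simp

variable (hp : p ≠ 2) (hbar : ∀ x, bar (bar x) = x)
    (hcomm : ∀ x, σ (bar x) = bar (σ x)) (hK : ∀ y, σ (bar y) = y → bar y = y)
    (hN : ∀ e : F, bar e = e → e ≠ 0 →
      (Finset.univ.filter fun w : F => w * bar w = e).card = Fintype.card (fixed bar) + 1)
    (hq : Fintype.card F = Fintype.card (fixed bar) ^ 2)

include hp hbar hcomm hK hN hq

-- Two expressions for the squared modulus of the exponential sum are compared: `|F|` times the size
-- of the radical, and `|E| ^ 2 = |F|` times the squared modulus of `gaussFixed`, with `E = fixed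
-- bar`.
open Classical in
lemma radCard_param {ω x : F} (hω : ω ∈ fixedUnits bar) (hx : x ≠ 0) :
    radCard σ bar (-(ω + σ ω) / (2 * (x * bar x))) (σ ω / (x * σ x)) =
      if IsOrth p σ bar ω then Fintype.card (fixed (twist σ bar)) ^ 2 else
        Fintype.card (fixed (twist σ bar)) := by
  obtain ⟨hω, hω0⟩ := mem_fixedUnits.mp hω
  have hE := expSum_of_radical hp hbar hcomm hN hω hω0 hx
  have ha : bar (-(ω + σ ω) / (2 * (x * bar x))) = -(ω + σ ω) / (2 * (x * bar x)) := by
    rw [map_div₀, map_neg, map_add, ← hcomm, hω, map_mul, map_mul, hbar, map_ofNat,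
      mul_comm (bar x)]
  have h1 := normSq_expSum hp hbar ha (σ := σ) (σ ω / (x * σ x))
  rw [hE, map_mul, Complex.normSq_neg, Complex.normSq_natCast, hq] at h1
  have hE0 : (Fintype.card (fixed bar) : ℝ) ≠ 0 := Nat.cast_ne_zero.mpr Fintype.card_ne_zero
  push_cast at h1
  rw [pow_two] at h1
  have h2 := mul_left_cancel₀ (mul_ne_zero hE0 hE0) h1
  split_ifs with h
  · rw [gaussFixed_of_orthogonal hK h, Complex.normSq_natCast] at h2
    rw [pow_two]; exact_mod_cast h2.symm
  · rw [normSq_gaussFixed hp hK hω0 h] at h2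
    exact_mod_cast h2.symm

/-- Only for the largest radical is the exponential sum itself determined here; for the middle class
it will be enough to know the sum over the class. -/
theorem radCard_cases {a b : F} (ha : bar a = a) (hab : ¬ (a = 0 ∧ b = 0)) :
    radCard σ bar a b = 1 ∨ radCard σ bar a b = Fintype.card (fixed (twist σ bar)) ∨
      (radCard σ bar a b = Fintype.card (fixed (twist σ bar)) ^ 2 ∧
        expSum σ bar a b = -(Fintype.card (fixed bar) * Fintype.card (fixed (twist σ bar)))) := by
  classical
  by_cases h1 : radCard σ bar a b = 1
  · exact Or.inl h1
  right
  have h2 : 1 < radCard σ bar a b := lt_of_le_of_ne (radCard_pos a b) (Ne.symm h1)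
  obtain ⟨x, hx, hx0⟩ := Finset.exists_mem_ne h2 (0 : F)
  have hx' := (Finset.mem_filter.mp hx).2
  obtain ⟨ω, hω, ha', hb'⟩ := radical_param hp hbar hcomm hK ha hx0 hx'
  have hω0 : ω ≠ 0 := by
    rintro rfl
    exact hab ⟨by simpa using ha', by simpa using hb'⟩
  have h3 := radCard_param hp hbar hcomm hK hN hq (mem_fixedUnits.mpr ⟨hω, hω0⟩) hx0
  have hE := expSum_of_radical hp hbar hcomm hN hω hω0 hx0
  rw [← ha', ← hb'] at h3 hE
  split_ifs at h3 with h
  · right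
    rw [gaussFixed_of_orthogonal hK h] at hE
    exact ⟨h3, by rw [hE]; ring⟩
  · exact Or.inl h3

/-- `sum_radCard_mul` is applied to the indicator of the class: each form is counted once for every
nonzero radical element, and each `x ≠ 0` contributes the number of orthogonal `ω`, known from
`card_isOrth`. -/
theorem card_radCard_sq (hK1 : 1 < Fintype.card (fixed (twist σ bar))) :
    (Fintype.card (fixed (twist σ bar)) : ℂ) * (Fintype.card (fixed (twist σ bar)) ^ 2 - 1) *
      (Finset.univ.filter fun P : fixed bar × F => P ≠ 0 ∧
        radCard σ bar P.1 P.2 = Fintype.card (fixed (twist σ bar)) ^ 2).card =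
      (Fintype.card F - 1) * (Fintype.card (fixed bar) - Fintype.card (fixed (twist σ bar))) := by
  classical
  set k := Fintype.card (fixed (twist σ bar)) with hk
  have hkk : k ≠ k ^ 2 := by nlinarith
  have h := sum_radCard_mul hp hbar hcomm hK
    (fun a b => if radCard σ bar a b = k ^ 2 then (1 : ℂ) else 0)
  have hl : ∑ P ∈ Finset.univ.filter (fun P : fixed bar × F => P ≠ 0),
      ((radCard σ bar P.1 P.2 : ℂ) - 1) * (if radCard σ bar P.1 P.2 = k ^ 2 then (1 : ℂ) else 0) =
      (k ^ 2 - 1) * (Finset.univ.filter fun P : fixed bar × F => P ≠ 0 ∧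
        radCard σ bar P.1 P.2 = k ^ 2).card := by
    rw [← Finset.filter_filter, Finset.card_filter, Nat.cast_sum, Finset.mul_sum]
    refine Finset.sum_congr rfl fun P _ => ?_
    split_ifs with h
    · rw [h]; push_cast; ring
    · simp
  have hr : ∀ x ∈ Finset.univ.filter (fun x : F => x ≠ 0), ∑ ω ∈ fixedUnits bar,
      (if radCard σ bar (-(ω + σ ω) / (2 * (x * bar x))) (σ ω / (x * σ x)) = k ^ 2
        then (1 : ℂ) else 0) = ((fixedUnits bar).filter (IsOrth p σ bar)).card := by
    intro x hx
    rw [Finset.card_filter, Nat.cast_sum]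
    refine Finset.sum_congr rfl fun ω hω => ?_
    rw [radCard_param hp hbar hcomm hK hN hq hω (by simpa using hx)]
    split_ifs with h1 <;> simp_all
  rw [hl, Finset.sum_congr rfl hr, Finset.sum_const, nsmul_eq_mul, Finset.filter_ne',
    Finset.card_erase_of_mem (Finset.mem_univ _), Finset.card_univ,
    Nat.cast_pred Fintype.card_pos] at h
  have h3 := card_isOrth hp hbar hK
  rw [← hk] at h3
  linear_combination (k : ℂ) * h + ((Fintype.card F : ℂ) - 1) * h3

theorem card_radCard_eq (hK1 : 1 < Fintype.card (fixed (twist σ bar))) :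
    (Fintype.card (fixed (twist σ bar)) : ℂ) * (Fintype.card (fixed (twist σ bar)) - 1) *
      (Finset.univ.filter fun P : fixed bar × F => P ≠ 0 ∧
        radCard σ bar P.1 P.2 = Fintype.card (fixed (twist σ bar))).card =
      (Fintype.card F - 1) * (Fintype.card (fixed bar) * Fintype.card (fixed (twist σ bar))
        - Fintype.card (fixed bar)) := by
  classical
  set k := Fintype.card (fixed (twist σ bar)) with hk
  have hkk : k ≠ k ^ 2 := by nlinarith
  have h := sum_radCard_mul hp hbar hcomm hK
    (fun a b => if radCard σ bar a b = k then (1 : ℂ) else 0)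
  have hl : ∑ P ∈ Finset.univ.filter (fun P : fixed bar × F => P ≠ 0),
      ((radCard σ bar P.1 P.2 : ℂ) - 1) * (if radCard σ bar P.1 P.2 = k then (1 : ℂ) else 0) =
      (k - 1) * (Finset.univ.filter fun P : fixed bar × F => P ≠ 0 ∧
        radCard σ bar P.1 P.2 = k).card := by
    rw [← Finset.filter_filter, Finset.card_filter, Nat.cast_sum, Finset.mul_sum]
    refine Finset.sum_congr rfl fun P _ => ?_
    split_ifs with h
    · rw [h]; push_cast; ring
    · simp
  have hr : ∀ x ∈ Finset.univ.filter (fun x : F => x ≠ 0), ∑ ω ∈ fixedUnits bar,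
      (if radCard σ bar (-(ω + σ ω) / (2 * (x * bar x))) (σ ω / (x * σ x)) = k
        then (1 : ℂ) else 0) =
      (fixedUnits bar).card - ((fixedUnits bar).filter (IsOrth p σ bar)).card := by
    intro x hx
    rw [Finset.card_filter, Nat.cast_sum, Finset.card_eq_sum_ones, Nat.cast_sum,
      ← Finset.sum_sub_distrib]
    refine Finset.sum_congr rfl fun ω hω => ?_
    rw [radCard_param hp hbar hcomm hK hN hq hω (by simpa using hx)]
    split_ifs with h1 h2
    · exact absurd h2.symm hkk
    · simp
    · simp
  rw [hl, Finset.sum_congr rfl hr, Finset.sum_const, nsmul_eq_mul, Finset.filter_ne',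
    Finset.card_erase_of_mem (Finset.mem_univ _), Finset.card_univ,
    Nat.cast_pred Fintype.card_pos, card_fixedUnits] at h
  have h3 := card_isOrth hp hbar hK
  rw [← hk] at h3
  linear_combination (k : ℂ) * h - ((Fintype.card F : ℂ) - 1) * h3

/-- The middle class consists of the forms from non-orthogonal `ω`, over which `gaussFixed` sums to
zero. -/
theorem sum_expSum_radCard_eq (hK1 : 1 < Fintype.card (fixed (twist σ bar))) :
    ∑ P ∈ Finset.univ.filter (fun P : fixed bar × F => P ≠ 0 ∧
        radCard σ bar P.1 P.2 = Fintype.card (fixed (twist σ bar))),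
      expSum σ bar P.1 P.2 = 0 := by
  classical
  set k := Fintype.card (fixed (twist σ bar)) with hk
  have hkk : k ≠ k ^ 2 := by nlinarith
  have h := sum_radCard_mul hp hbar hcomm hK
    (fun a b => if radCard σ bar a b = k then expSum σ bar a b else 0)
  have hl : ∑ P ∈ Finset.univ.filter (fun P : fixed bar × F => P ≠ 0),
      ((radCard σ bar P.1 P.2 : ℂ) - 1) *
        (if radCard σ bar P.1 P.2 = k then expSum σ bar P.1 P.2 else 0) =
      (k - 1) * ∑ P ∈ Finset.univ.filter (fun P : fixed bar × F => P ≠ 0 ∧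
        radCard σ bar P.1 P.2 = k), expSum σ bar P.1 P.2 := by
    rw [← Finset.filter_filter, Finset.sum_filter (fun P : fixed bar × F => radCard σ bar P.1 P.2 = k),
      Finset.mul_sum]
    refine Finset.sum_congr rfl fun P _ => ?_
    split_ifs with h
    · rw [h]
    · simp
  have hr : ∀ x ∈ Finset.univ.filter (fun x : F => x ≠ 0), ∑ ω ∈ fixedUnits bar,
      (if radCard σ bar (-(ω + σ ω) / (2 * (x * bar x))) (σ ω / (x * σ x)) = k
        then expSum σ bar (-(ω + σ ω) / (2 * (x * bar x))) (σ ω / (x * σ x)) else 0) = 0 := by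
    intro x hx
    have hx0 : x ≠ 0 := by simpa using hx
    have : ∀ ω ∈ fixedUnits bar,
        (if radCard σ bar (-(ω + σ ω) / (2 * (x * bar x))) (σ ω / (x * σ x)) = k
        then expSum σ bar (-(ω + σ ω) / (2 * (x * bar x))) (σ ω / (x * σ x)) else 0) =
        (-(Fintype.card (fixed bar) : ℂ)) *
          if ¬ IsOrth p σ bar ω then gaussFixed σ bar ω else 0 := by
      intro ω hω
      have hω' := mem_fixedUnits.mp hω
      rw [radCard_param hp hbar hcomm hK hN hq hω hx0,
        expSum_of_radical hp hbar hcomm hN hω'.1 hω'.2 hx0]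
      split_ifs with h1 h2
      · exact absurd h2.symm hkk
      · simp
      · rfl
    rw [Finset.sum_congr rfl this, ← Finset.mul_sum, ← Finset.sum_filter,
      sum_gaussFixed_not_isOrth hp hbar hK, mul_zero]
  rw [hl, Finset.sum_eq_zero hr] at h
  have hk1 : ((k : ℂ) - 1) ≠ 0 := by
    rw [sub_ne_zero]; exact_mod_cast hK1.ne'
  exact (mul_eq_zero.mp h).resolve_left hk1

end Kasami

/-! ### Size of the radical by a Wronskian argument, the second moment, and invariance under roots
of unity. -/

namespace Kasami

variable {p : ℕ} [Fact p.Prime] {F : Type*} [Field F] [Algebra (ZMod p) F]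
variable {σ bar : F ≃ₐ[ZMod p] F}

/-- Eliminating `2 a` from the radical equations of `x` and `y` leaves a first-order semilinear
equation for their Wronskian `σ x bar y - σ y bar x`. -/
lemma radical_wronskian (hbar : ∀ x, bar (bar x) = x) (hcomm : ∀ x, σ (bar x) = bar (σ x))
    {a b x y : F} (hx : σ (2 * a * bar x + b * σ x) + b * x = 0)
    (hy : σ (2 * a * bar y + b * σ y) + b * y = 0) :
    σ b * σ (σ x * bar y - σ y * bar x) = b * bar (σ x * bar y - σ y * bar x) := by
  have e1 : b * (σ x * bar y - σ y * bar x) =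
      (2 * a * bar x + b * σ x) * bar y - (2 * a * bar y + b * σ y) * bar x := by ring
  rw [← map_mul, e1, map_sub, map_mul, map_mul σ (2 * a * bar y + b * σ y)]
  simp only [map_sub, map_mul bar, hbar]
  rw [← hcomm, ← hcomm]
  linear_combination σ (bar y) * hx - σ (bar x) * hy

variable [Fintype F] [DecidableEq F]

/-- If `x` and `x₀` have the same Wronskian with `y`, then `σ` and `bar` agree on `(x - x₀) / y`,
which therefore lies in the fixed field of `twist σ bar`. -/
lemma card_wronskian_fiber_le (hbar : ∀ x, bar (bar x) = x)
    (hcomm : ∀ x, σ (bar x) = bar (σ x)) {y : F} (hy : y ≠ 0) (s : Finset F) (w : F) :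
    (s.filter fun x => σ x * bar y - σ y * bar x = w).card ≤
      Fintype.card (fixed (twist σ bar)) := by
  rcases Finset.eq_empty_or_nonempty (s.filter fun x => σ x * bar y - σ y * bar x = w) with
    h | ⟨x₀, hx₀⟩
  · rw [h]; simp
  have hx₀' := (Finset.mem_filter.mp hx₀).2
  have hsy : σ y ≠ 0 := by simpa using hy
  have hby : bar y ≠ 0 := by simpa using hy
  have hmem : ∀ x ∈ s.filter (fun x => σ x * bar y - σ y * bar x = w),
      (x - x₀) / y ∈ fixed (twist σ bar) := by
    intro x hx
    have hx' := (Finset.mem_filter.mp hx).2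
    have h1 : σ ((x - x₀) / y) = bar ((x - x₀) / y) := by
      rw [map_div₀, map_div₀, div_eq_div_iff hsy hby, map_sub, map_sub]
      linear_combination hx' - hx₀'
    rw [mem_fixed, twist_apply, hcomm, h1, hbar]
  rw [← Finset.card_univ]
  refine Finset.card_le_card_of_injOn
    (fun x => if h : (x - x₀) / y ∈ fixed (twist σ bar) then ⟨_, h⟩ else 0)
    (fun _ _ => by simp) ?_
  intro x hx x' hx' h
  simp only [hmem x hx, hmem x' hx', dite_true, Subtype.mk.injEq] at h
  exact sub_left_injective ((div_left_inj' hy).mp h)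

/-- The quotient of two nonzero solutions of this semilinear equation is fixed by `twist σ bar`. -/
lemma card_semilinear_le (hbar : ∀ x, bar (bar x) = x)
    (hcomm : ∀ x, σ (bar x) = bar (σ x)) {b : F} (hb : b ≠ 0) (s : Finset F)
    (hs : ∀ w ∈ s, σ b * σ w = b * bar w) :
    s.card ≤ Fintype.card (fixed (twist σ bar)) := by
  by_cases h0 : ∃ w₀ ∈ s, w₀ ≠ 0
  · obtain ⟨w₀, hw₀, hne⟩ := h0
    have hsw : σ w₀ ≠ 0 := by simpa using hne
    have hbw : bar w₀ ≠ 0 := by simpa using hne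
    have hmem : ∀ w ∈ s, w / w₀ ∈ fixed (twist σ bar) := by
      intro w hw
      have h1 : σ (w / w₀) = bar (w / w₀) := by
        rw [map_div₀, map_div₀, div_eq_div_iff hsw hbw]
        apply mul_left_cancel₀ hb
        linear_combination (-σ w) * hs w₀ hw₀ + σ w₀ * hs w hw
      rw [mem_fixed, twist_apply, hcomm, h1, hbar]
    rw [← Finset.card_univ]
    refine Finset.card_le_card_of_injOn
      (fun x => if h : x / w₀ ∈ fixed (twist σ bar) then ⟨_, h⟩ else 0) (fun _ _ => by simp) ?_
    intro x hx x' hx' h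
    simp only [hmem x hx, hmem x' hx', dite_true, Subtype.mk.injEq] at h
    exact (div_left_inj' hne).mp h
  · push Not at h0
    have : s ⊆ {0} := fun w hw => by simpa using h0 w hw
    exact (Finset.card_le_card this).trans (by rw [Finset.card_singleton]; exact Fintype.card_pos)

/-- The radical is a vector space over `K = fixed (twist σ bar)`. The Wronskian with a fixed nonzero
element has fibres of size at most `|K|` and at most `|K|` values, so the dimension is at most two.
No inclusion between `K` and the fixed field of `bar` enters. -/
theorem radCard_trichotomy (hp : p ≠ 2) (hbar : ∀ x, bar (bar x) = x)
    (hcomm : ∀ x, σ (bar x) = bar (σ x)) {a b : F} (hab : ¬ (a = 0 ∧ b = 0)) :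
    radCard σ bar a b = 1 ∨ radCard σ bar a b = Fintype.card (fixed (twist σ bar)) ∨
      radCard σ bar a b = Fintype.card (fixed (twist σ bar)) ^ 2 := by
  have h2 := two_ne_zero_field (p := p) (F := F) hp
  set k := Fintype.card (fixed (twist σ bar)) with hk
  set R := Finset.univ.filter fun x : F => σ (2 * a * bar x + b * σ x) + b * x = 0 with hR
  have hcard : radCard σ bar a b = R.card := rfl
  have hmemR : ∀ x, x ∈ R ↔ σ (2 * a * bar x + b * σ x) + b * x = 0 := fun x => by simp [hR]
  by_cases h1 : radCard σ bar a b = 1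
  · exact Or.inl h1
  right
  have h1' : 1 < R.card := lt_of_le_of_ne (radCard_pos a b) (Ne.symm h1)
  obtain ⟨y, hy, hy0⟩ := Finset.exists_mem_ne h1' (0 : F)
  have hy' := (hmemR y).mp hy
  have hb : b ≠ 0 := by
    rintro rfl
    have : 2 * a * bar y = 0 := by simpa using hy'
    have hby : bar y ≠ 0 := by simpa using hy0
    have ha : a = 0 := by
      rcases mul_eq_zero.mp this with h | h
      · exact (mul_eq_zero.mp h).resolve_left h2
      · exact absurd h hby
    exact hab ⟨ha, rfl⟩
  have hscal : ∀ c ∈ fixed (twist σ bar), ∀ x ∈ R, c * x ∈ R := by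
    intro c hc x hx
    rw [hmemR] at hx ⊢
    have hc1 : σ (bar c) = c := hc
    have hc2 := sigma_eq_bar hbar hcomm hc
    have : 2 * a * bar (c * x) + b * σ (c * x) = bar c * (2 * a * bar x + b * σ x) := by
      rw [map_mul, map_mul, hc2]; ring
    rw [this, map_mul, hc1]
    linear_combination c * hx
  have hadd : ∀ x ∈ R, ∀ z ∈ R, x + z ∈ R := by
    intro x hx z hz
    rw [hmemR] at hx hz ⊢
    simp only [map_add, map_mul, mul_add] at hx hz ⊢
    linear_combination hx + hz
  have hle : R.card ≤ k * k := by
    refine (Finset.card_le_mul_card_image (f := fun x => σ x * bar y - σ y * bar x) R k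
      (fun w _ => card_wronskian_fiber_le hbar hcomm hy0 R w)).trans
      (Nat.mul_le_mul_left _ (card_semilinear_le hbar hcomm hb _ ?_))
    intro w hw
    obtain ⟨x, hx, rfl⟩ := Finset.mem_image.mp hw
    exact radical_wronskian hbar hcomm ((hmemR x).mp hx) hy'
  have himg : (Finset.univ.image fun c : fixed (twist σ bar) => (c : F) * y) ⊆ R := by
    intro z hz
    obtain ⟨c, -, rfl⟩ := Finset.mem_image.mp hz
    exact hscal c c.2 y hy
  have himgcard : (Finset.univ.image fun c : fixed (twist σ bar) => (c : F) * y).card = k := by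
    rw [Finset.card_image_of_injective, Finset.card_univ]
    intro c c' h
    exact Subtype.ext (mul_right_cancel₀ hy0 h)
  by_cases hsub : R ⊆ Finset.univ.image fun c : fixed (twist σ bar) => (c : F) * y
  · left
    rw [hcard, ← himgcard]
    exact le_antisymm (Finset.card_le_card hsub) (Finset.card_le_card himg)
  · right
    obtain ⟨x, hx, hxn⟩ := Finset.not_subset.mp hsub
    rw [hcard, pow_two]
    refine le_antisymm hle ?_
    have hinj : Function.Injective
        fun c : fixed (twist σ bar) × fixed (twist σ bar) => (c.1 : F) * x + c.2 * y := by
      rintro ⟨c, d⟩ ⟨c', d'⟩ h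
      simp only at h
      by_cases hc : (c : F) = c'
      · rw [hc] at h
        exact Prod.ext (Subtype.ext hc) (Subtype.ext (mul_right_cancel₀ hy0 (add_left_cancel h)))
      · exfalso
        apply hxn
        have hcc : (c : F) - c' ≠ 0 := sub_ne_zero.mpr hc
        refine Finset.mem_image.mpr ⟨⟨((d' : F) - d) / (c - c'), ?_⟩, Finset.mem_univ _, ?_⟩
        · rw [mem_fixed, map_div₀, map_sub, map_sub, fixed_apply, fixed_apply, fixed_apply,
            fixed_apply]
        · simp only; field_simp; linear_combination -h
    have : (Finset.univ.image
        fun c : fixed (twist σ bar) × fixed (twist σ bar) => (c.1 : F) * x + c.2 * y) ⊆ R := by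
      intro z hz
      obtain ⟨c, -, rfl⟩ := Finset.mem_image.mp hz
      exact hadd _ (hscal _ c.1.2 _ hx) _ (hscal _ c.2.2 _ hy)
    have h3 := Finset.card_le_card this
    rwa [Finset.card_image_of_injective _ hinj, Finset.card_univ, Fintype.card_prod] at h3

/-- The second moment of the exponential sums. -/
lemma sum_radCard (hp : p ≠ 2) (hbar : ∀ x, bar (bar x) = x) {D : ℕ}
    (hD : (Finset.univ.filter fun μ : F => μ * bar μ = 1 ∧ μ * σ μ = 1).card = D) :
    ∑ P : fixed bar × F, (radCard σ bar P.1 P.2 : ℂ) =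
      Fintype.card (fixed bar) * (1 + (Fintype.card F - 1) * D) := by
  classical
  have hq : (Fintype.card F : ℂ) ≠ 0 := Nat.cast_ne_zero.mpr Fintype.card_ne_zero
  apply mul_left_cancel₀ hq
  -- The squared modulus is expanded as a double sum over `x` and `y`; orthogonality in both
  -- coefficients keeps the pairs with equal `x bar(x)` and equal `x σ(x)`.
  have h1 : ∀ P : fixed bar × F, (Fintype.card F : ℂ) * radCard σ bar P.1 P.2 =
      ∑ y, ∑ x, traceChar p F (P.1 * (x * bar x - y * bar y) + P.2 * (x * σ x - y * σ y)) := by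
    intro P
    have h := normSq_expSum hp hbar (fixed_apply P.1) (σ := σ) P.2
    have h' : expSum σ bar P.1 P.2 * (starRingEnd ℂ) (expSum σ bar P.1 P.2) =
        (Fintype.card F : ℂ) * radCard σ bar P.1 P.2 := by
      rw [Complex.mul_conj, h]; push_cast; rfl
    rw [← h', expSum, map_sum, Finset.mul_sum]
    refine Finset.sum_congr rfl fun y _ => ?_
    rw [Finset.sum_mul]
    refine Finset.sum_congr rfl fun x _ => ?_
    rw [star_traceChar, ← AddChar.map_add_eq_mul]
    congr 1; ring
  have h2 : ∀ x y : F,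
      ∑ P : fixed bar × F,
        traceChar p F (P.1 * (x * bar x - y * bar y) + P.2 * (x * σ x - y * σ y)) =
      if x * bar x = y * bar y ∧ x * σ x = y * σ y then
        (Fintype.card (fixed bar) : ℂ) * Fintype.card F else 0 := by
    intro x y
    have hmem : bar (x * bar x - y * bar y) = x * bar x - y * bar y := by
      simp only [map_sub, map_mul, hbar]; ring
    rw [Fintype.sum_prod_type]
    simp only [AddChar.map_add_eq_mul, ← Finset.mul_sum, mul_comm _ (x * σ x - y * σ y)]
    simp only [sum_traceChar_mul, ← Finset.sum_mul, mul_comm _ (x * bar x - y * bar y)]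
    by_cases h3 : x * bar x = y * bar y
    · simp only [h3, sub_self, zero_mul, AddChar.map_zero_eq_one, true_and, sub_eq_zero]
      split_ifs <;> simp
    · rw [sum_fixed_mul hp hbar hmem (sub_ne_zero.mpr h3), zero_mul, if_neg (fun h => h3 h.1)]
  -- For `y ≠ 0` the solutions are `x = μ y` with `μ` in the set counted by `D`; for `y = 0` only `x
  -- = 0` remains.
  have h3 : ∀ y : F, (∑ x : F, if x * bar x = y * bar y ∧ x * σ x = y * σ y then
        (Fintype.card (fixed bar) : ℂ) * Fintype.card F else 0) =
      (if y = 0 then 1 else (D : ℂ)) * ((Fintype.card (fixed bar) : ℂ) * Fintype.card F) := by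
    intro y
    rw [← Finset.sum_filter, Finset.sum_const, nsmul_eq_mul]
    congr 1
    split_ifs with hy
    · subst hy
      have : (Finset.univ.filter fun x : F => x * bar x = 0 * bar 0 ∧ x * σ x = 0 * σ 0) = {0} := by
        ext x; simp
      rw [this]; simp
    · rw [← hD]
      congr 1
      symm
      have hb0 : bar y ≠ 0 := by simpa using hy
      have hs0 : σ y ≠ 0 := by simpa using hy
      refine Finset.card_bij' (fun μ _ => μ * y) (fun x _ => x / y) ?_ ?_ ?_ ?_
      · intro μ hμ
        simp only [Finset.mem_filter_univ, map_mul] at hμ ⊢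
        exact ⟨by linear_combination (y * bar y) * hμ.1, by linear_combination (y * σ y) * hμ.2⟩
      · intro x hx
        simp only [Finset.mem_filter_univ, map_div₀] at hx ⊢
        refine ⟨?_, ?_⟩
        · field_simp; exact hx.1
        · field_simp; exact hx.2
      · intro μ _; field_simp
      · intro x _; field_simp
  rw [Finset.mul_sum, Finset.sum_congr rfl fun P _ => h1 P, Finset.sum_comm,
    Finset.sum_congr rfl fun y _ => Finset.sum_comm]
  simp only [h2, h3]
  rw [← Finset.sum_mul, ← Finset.add_sum_erase _ _ (Finset.mem_univ 0), if_pos rfl,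
    Finset.sum_congr rfl (g := fun _ => (D : ℂ)) (fun y hy => if_neg (Finset.ne_of_mem_erase hy)),
    Finset.sum_const, nsmul_eq_mul, Finset.card_erase_of_mem (Finset.mem_univ _),
    Finset.card_univ, Nat.cast_pred Fintype.card_pos]
  ring

/-- The fibre sizes of a function that is invariant under multiplication by `D`-th roots
of unity. -/
lemma dvd_card_fiber {ζ : F} {D : ℕ} (hζ : IsPrimitiveRoot ζ D) (hD : 0 < D)
    {A : Type*} [DecidableEq A] (f : F → A) (hf : ∀ μ x, μ ^ D = 1 → f (μ * x) = f x) {t : A}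
    (ht : f 0 ≠ t) : D ∣ (Finset.univ.filter fun x => f x = t).card := by
  classical
  -- The fibre is grouped by the value of `x ^ D`. It avoids `0`, so each group is a full coset of
  -- the `D`-th roots of unity.
  rw [Finset.card_eq_sum_card_image (fun x => x ^ D)]
  refine Finset.dvd_sum fun y hy => ?_
  obtain ⟨x₀, hx₀, rfl⟩ := Finset.mem_image.mp hy
  have hx₀' := (Finset.mem_filter.mp hx₀).2
  have h0 : x₀ ≠ 0 := by rintro rfl; exact ht hx₀'
  have hset : (Finset.filter (fun x => x ^ D = x₀ ^ D) (Finset.univ.filter fun x => f x = t)) =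
      Polynomial.nthRootsFinset D (x₀ ^ D) := by
    ext x
    rw [Polynomial.mem_nthRootsFinset hD, Finset.mem_filter, Finset.mem_filter]
    constructor
    · exact fun h => h.2
    · intro h
      refine ⟨⟨Finset.mem_univ _, ?_⟩, h⟩
      rw [← hx₀', ← hf (x / x₀) x₀ (by rw [div_pow, h, div_self (pow_ne_zero _ h0)])]
      congr 1; field_simp
  have hcard := hζ.card_nthRoots (x₀ ^ D)
  rw [if_pos ⟨x₀, rfl⟩] at hcard
  rw [hset, Polynomial.nthRootsFinset_def,
    Multiset.toFinset_card_of_nodup (hζ.nthRoots_nodup (pow_ne_zero D h0)), hcard]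

end Kasami

namespace Kasami

/-! ### Arithmetic of the exponents -/

/-- The left side is the degree of the fixed field of the `(l + s)`-th power of Frobenius in degree
`2 s`; the right side is `d'`. -/
lemma gcd_add_two_mul (s l : ℕ) : Nat.gcd (l + s) (2 * s) = Nat.gcd (s + l) (2 * l) := by
  apply Nat.dvd_antisymm
  · refine Nat.dvd_gcd (by rw [add_comm]; exact Nat.gcd_dvd_left _ _) ?_
    have h := Nat.dvd_sub ((Nat.gcd_dvd_left (l + s) (2 * s)).mul_left 2)
      (Nat.gcd_dvd_right (l + s) (2 * s))
    rwa [show 2 * (l + s) - 2 * s = 2 * l by omega] at h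
  · refine Nat.dvd_gcd (by rw [add_comm]; exact Nat.gcd_dvd_left _ _) ?_
    have h := Nat.dvd_sub ((Nat.gcd_dvd_left (s + l) (2 * l)).mul_left 2)
      (Nat.gcd_dvd_right (s + l) (2 * l))
    rwa [show 2 * (s + l) - 2 * l = 2 * s by omega] at h

/-- After division by `d`, the second gcd is coprime to `l / d` and divides `2 l / d`, hence divides
`2`. -/
lemma gcd_cases {s l d d' : ℕ} (hs : 0 < s) (hd : d = Nat.gcd s l)
    (hd' : d' = Nat.gcd (s + l) (2 * l)) : d' = d ∨ d' = 2 * d := by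
  have hd0 : 0 < d := hd ▸ Nat.gcd_pos_of_pos_left _ hs
  obtain ⟨g, s', l', hg, hco, rfl, rfl⟩ := Nat.exists_coprime' (m := s) (n := l)
    (Nat.gcd_pos_of_pos_left _ hs)
  have hdg : d = g := by rw [hd, Nat.gcd_mul_right, hco, one_mul]
  subst hdg
  have h1 : d' = Nat.gcd (s' + l') (2 * l') * d := by
    rw [hd', ← add_mul, ← mul_assoc, Nat.gcd_mul_right]
  have h2 : Nat.gcd (s' + l') (2 * l') ∣ 2 := by
    have hc : Nat.Coprime (Nat.gcd (s' + l') (2 * l')) l' := by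
      refine Nat.Coprime.coprime_dvd_left (Nat.gcd_dvd_left _ _) ?_
      simpa using hco
    exact hc.dvd_of_dvd_mul_right (Nat.gcd_dvd_right _ _)
  rcases (Nat.dvd_prime Nat.prime_two).mp h2 with h | h
  · left; rw [h1, h, one_mul]
  · right; rw [h1, h]

/-- Here `s / d` and `l / d` are coprime with even sum. -/
lemma odd_of_gcd_eq {s l d : ℕ} (hs : 0 < s) (hd : d = Nat.gcd s l)
    (hd' : 2 * d = Nat.gcd (s + l) (2 * l)) :
    ∃ i j, s = d * (2 * i + 1) ∧ l = d * (2 * j + 1) := by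
  obtain ⟨g, s', l', hg, hco, rfl, rfl⟩ := Nat.exists_coprime' (m := s) (n := l)
    (Nat.gcd_pos_of_pos_left _ hs)
  have hdg : d = g := by rw [hd, Nat.gcd_mul_right, hco, one_mul]
  subst hdg
  have h1 : 2 ∣ s' + l' := by
    have h : 2 * d ∣ (s' + l') * d := by
      rw [hd', ← add_mul]; exact Nat.gcd_dvd_left _ _
    exact Nat.dvd_of_mul_dvd_mul_right hg h
  have h2 : ¬ (2 ∣ s' ∧ 2 ∣ l') := fun h => by
    have := Nat.dvd_gcd h.1 h.2
    rw [hco] at this; omega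
  refine ⟨s' / 2, l' / 2, ?_, ?_⟩
  · rw [mul_comm]; congr 1; omega
  · rw [mul_comm]; congr 1; omega

/-! ### Powers of the Frobenius automorphism -/

/-- The hypotheses say that `x` is a periodic point of `y ↦ y ^ p` with periods `i` and `j`. -/
lemma pow_pow_gcd {F : Type*} [Monoid F] {p i j : ℕ} {x : F} (hi : x ^ p ^ i = x) (hj : x ^ p ^ j = x) :
    x ^ p ^ Nat.gcd i j = x := by
  have h : ∀ k, (fun y : F => y ^ p)^[k] x = x ^ p ^ k := by
    intro k; rw [pow_iterate]
  have h1 : Function.IsPeriodicPt (fun y : F => y ^ p) i x := (h i).trans hi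
  have h2 : Function.IsPeriodicPt (fun y : F => y ^ p) j x := (h j).trans hj
  exact (h _).symm.trans (h1.gcd h2)

lemma pow_pow_of_dvd {F : Type*} [Monoid F] {p i j : ℕ} (hij : i ∣ j) {x : F} (hi : x ^ p ^ i = x) : x ^ p ^ j = x := by
  have h : ∀ k, (fun y : F => y ^ p)^[k] x = x ^ p ^ k := by
    intro k; rw [pow_iterate]
  have h1 : Function.IsPeriodicPt (fun y : F => y ^ p) i x := (h i).trans hi
  obtain ⟨c, rfl⟩ := hij
  exact (h _).symm.trans (h1.mul_const c)

variable {p : ℕ} [Fact p.Prime] {F : Type*} [Field F] [Algebra (ZMod p) F]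

variable (p F) in
/-- The automorphism `x ↦ x ^ p ^ k`. -/
noncomputable def frob [Finite F] (k : ℕ) : F ≃ₐ[ZMod p] F :=
  FiniteField.frobeniusAlgEquivOfAlgebraic (ZMod p) F ^ k

lemma frob_apply [Finite F] (k : ℕ) (x : F) : frob p F k x = x ^ p ^ k := by
  induction k generalizing x with
  | zero => simp [frob]
  | succ k ih =>
    have : frob p F (k + 1) x = frob p F k (FiniteField.frobeniusAlgEquivOfAlgebraic (ZMod p) F x) := by
      simp only [frob, pow_succ, AlgEquiv.mul_apply]
    rw [this, ih, FiniteField.coe_frobeniusAlgEquivOfAlgebraic, ZMod.card, ← pow_mul, pow_succ']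

lemma frob_comm [Finite F] (i j : ℕ) (x : F) :
    frob p F i (frob p F j x) = frob p F j (frob p F i x) := by
  simp only [frob_apply, ← pow_mul, mul_comm]

variable (p) in
lemma pow_sub_one_pos {m : ℕ} (hm : 0 < m) : 0 < p ^ m - 1 :=
  Nat.sub_pos_of_lt (Nat.one_lt_pow hm.ne' (Fact.out : p.Prime).one_lt)

section card
variable [Fintype F] [DecidableEq F] {m : ℕ} (hF : Fintype.card F = p ^ m)
include hF

omit [Fact p.Prime] [Algebra (ZMod p) F] [DecidableEq F] in
lemma pow_card_pow (x : F) : x ^ p ^ m = x := by rw [← hF, FiniteField.pow_card]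

variable {α : F} (hα : IsPrimitiveRoot α (p ^ m - 1))
include hα

omit [Algebra (ZMod p) F] [DecidableEq F] in
lemma exists_pow_eq (hm : 0 < m) {x : F} (hx : x ≠ 0) : ∃ i < p ^ m - 1, α ^ i = x := by
  have : NeZero (p ^ m - 1) := ⟨(pow_sub_one_pos p hm).ne'⟩
  refine hα.eq_pow_of_pow_eq_one ?_
  rw [← hF]; exact FiniteField.pow_card_sub_one_eq_one x hx

omit [Algebra (ZMod p) F] [Fintype F] [DecidableEq F] hF in
lemma exists_primitiveRoot (hm : 0 < m) {D : ℕ} (hD : D ∣ p ^ m - 1) :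
    ∃ ζ : F, IsPrimitiveRoot ζ D := by
  obtain ⟨c, hc⟩ := hD
  exact ⟨_, hα.pow (pow_sub_one_pos p hm) (by rw [hc, mul_comm])⟩

lemma card_pow_eq_one (hm : 0 < m) {D : ℕ} (hD : D ∣ p ^ m - 1) :
    (Finset.univ.filter fun x : F => x ^ D = 1).card = D := by
  obtain ⟨ζ, hζ⟩ := exists_primitiveRoot hα hm hD
  have hD0 : 0 < D := Nat.pos_of_dvd_of_pos hD (pow_sub_one_pos p hm)
  conv_rhs => rw [← hζ.card_nthRootsFinset]
  congr 1
  ext x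
  rw [Polynomial.mem_nthRootsFinset hD0]; simp

/-- With `g = gcd k m`, the nonzero fixed points are the `(p ^ g - 1)`-th roots of unity. -/
lemma card_fixed_frob (hm : 0 < m) (k : ℕ) :
    Fintype.card (fixed (frob p F k)) = p ^ Nat.gcd k m := by
  have h1 : Fintype.card (fixed (frob p F k)) =
      (Finset.univ.filter fun x : F => x ^ p ^ Nat.gcd k m = x).card := by
    rw [Fintype.card_subtype]
    congr 1
    ext x
    simp only [Finset.mem_filter_univ, mem_fixed, frob_apply]
    exact ⟨fun h => pow_pow_gcd h (pow_card_pow hF x), pow_pow_of_dvd (Nat.gcd_dvd_left _ _)⟩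
  have hg : 0 < Nat.gcd k m := Nat.gcd_pos_of_pos_right _ hm
  have hpg : 1 < p ^ Nat.gcd k m := Nat.one_lt_pow hg.ne' (Fact.out : p.Prime).one_lt
  have h2 : (Finset.univ.filter fun x : F => x ^ p ^ Nat.gcd k m = x) =
      insert 0 (Finset.univ.filter fun x : F => x ^ (p ^ Nat.gcd k m - 1) = 1) := by
    ext x
    simp only [Finset.mem_filter_univ, Finset.mem_insert]
    by_cases hx : x = 0
    · simp [hx, (Fact.out : p.Prime).ne_zero]
    · simp only [hx, false_or]
      conv_lhs => rw [← Nat.sub_add_cancel hpg.le, pow_succ]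
      exact mul_eq_right₀ hx
  rw [h1, h2, Finset.card_insert_of_notMem, card_pow_eq_one hF hα hm]
  · omega
  · exact Nat.pow_sub_one_dvd_pow_sub_one p (Nat.gcd_dvd_right k m)
  · simp [(Nat.sub_pos_of_lt hpg).ne']

/-- A nonzero element `α ^ j` of the subfield has `p ^ s + 1 ∣ j`, so it is a `(p ^ s + 1)`-th
power, and `F` contains all `(p ^ s + 1)`-th roots of unity. -/
lemma card_norm_fiber {s : ℕ} (hs : 0 < s) (hms : m = 2 * s) {e : F}
    (he : frob p F s e = e) (he0 : e ≠ 0) :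
    (Finset.univ.filter fun w : F => w * frob p F s w = e).card = p ^ s + 1 := by
  have hm : 0 < m := by omega
  have hps : 1 < p ^ s := Nat.one_lt_pow hs.ne' (Fact.out : p.Prime).one_lt
  have hfac : p ^ m - 1 = (p ^ s + 1) * (p ^ s - 1) := by
    rw [hms, mul_comm 2 s, pow_mul, ← Nat.sq_sub_sq, one_pow]
  obtain ⟨ζ, hζ⟩ := exists_primitiveRoot hα hm (Dvd.intro _ hfac.symm)
  obtain ⟨j, -, rfl⟩ := exists_pow_eq hF hα hm he0
  have h1 : α ^ (j * (p ^ s - 1)) = 1 := by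
    rw [pow_mul]
    apply mul_right_cancel₀ he0
    rw [one_mul, ← pow_succ, Nat.sub_add_cancel hps.le, ← frob_apply, he]
  have h2 : p ^ s + 1 ∣ j := by
    have := hα.dvd_of_pow_eq_one _ h1
    rw [hfac] at this
    exact Nat.dvd_of_mul_dvd_mul_right (Nat.sub_pos_of_lt hps) this
  obtain ⟨c, rfl⟩ := h2
  have hcard := hζ.card_nthRoots (α ^ ((p ^ s + 1) * c))
  rw [if_pos ⟨α ^ c, by rw [← pow_mul, mul_comm]⟩] at hcard
  rw [← Multiset.toFinset_card_of_nodup (hζ.nthRoots_nodup he0)] at hcard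
  refine Eq.trans ?_ hcard
  congr 1
  ext x
  simp only [Finset.mem_filter_univ, Multiset.mem_toFinset, Polynomial.mem_nthRoots (Nat.succ_pos _),
    frob_apply, pow_succ' x]

omit hα in
lemma frob_frob_self {s : ℕ} (hms : m = 2 * s) (x : F) : frob p F s (frob p F s x) = x := by
  rw [frob_apply, frob_apply, ← pow_mul, ← pow_add, ← two_mul, ← hms, pow_card_pow hF]

omit [DecidableEq F] hF hα in
lemma twist_frob (s l : ℕ) (x : F) : twist (frob p F l) (frob p F s) x = frob p F (l + s) x := by
  rw [twist_apply, frob_apply, frob_apply, frob_apply, ← pow_mul, ← pow_add, add_comm]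

omit hα in
lemma pow_of_twist {s l d' : ℕ} (hms : m = 2 * s) (hd' : d' = Nat.gcd (s + l) (2 * l)) {y : F}
    (hy : frob p F l (frob p F s y) = y) : y ^ p ^ d' = y := by
  rw [← twist_apply, twist_frob, frob_apply] at hy
  have := pow_pow_gcd hy (pow_card_pow hF y)
  rwa [hms, gcd_add_two_mul, ← hd'] at this

lemma card_fixed_twist {s l d' : ℕ} (hm : 0 < m) (hms : m = 2 * s)
    (hd' : d' = Nat.gcd (s + l) (2 * l)) :
    Fintype.card (fixed (twist (frob p F l) (frob p F s))) = p ^ d' := by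
  rw [hd', ← gcd_add_two_mul, ← hms, ← card_fixed_frob hF hα hm]
  refine Fintype.card_congr (Equiv.subtypeEquivRight fun x => ?_)
  rw [mem_fixed, mem_fixed, twist_frob]

lemma card_fixed_bar {s : ℕ} (hm : 0 < m) (hms : m = 2 * s) :
    Fintype.card (fixed (frob p F s)) = p ^ s := by
  rw [card_fixed_frob hF hα hm, hms, Nat.gcd_mul_left_right]

omit hα in
/-- The scalars preserving all forms, when `s` and `l` are odd multiples of `d`. -/
lemma isometry_iff {s l d : ℕ} (hms : m = 2 * s)
    (hd' : 2 * d = Nat.gcd (s + l) (2 * l)) {i j : ℕ} (hs : s = d * (2 * i + 1))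
    (hl : l = d * (2 * j + 1)) (μ : F) :
    (μ * frob p F s μ = 1 ∧ μ * frob p F l μ = 1) ↔ μ ^ (p ^ d + 1) = 1 := by
  have hdvd : ∀ k, p ^ d + 1 ∣ p ^ (d * (2 * k + 1)) + 1 := by
    intro k
    have := Odd.nat_add_dvd_pow_add_pow (p ^ d) 1 (n := 2 * k + 1) ⟨k, rfl⟩
    rwa [one_pow, ← pow_mul] at this
  constructor
  · rintro ⟨h1, h2⟩
    have hμ : μ ≠ 0 := by rintro rfl; simp at h1
    -- Both automorphisms agree on `μ`, so `μ` lies in the field of `p ^ (2 d)` elements, where the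
    -- exponent `s`, an odd multiple of `d`, may be replaced by `d`.
    have h3 : frob p F l μ = frob p F s μ := mul_left_cancel₀ hμ (h2.trans h1.symm)
    have h4 : frob p F l (frob p F s μ) = μ := by
      rw [frob_comm, h3, frob_frob_self hF hms]
    have h5 := pow_of_twist hF hms hd' h4
    have h6 : μ ^ p ^ (2 * d * i) = μ := pow_pow_of_dvd (Dvd.intro _ rfl) h5
    rw [frob_apply, hs, show d * (2 * i + 1) = 2 * d * i + d by ring, pow_add, pow_mul, h6] at h1
    rw [pow_succ', h1]
  · intro h
    have hk : ∀ k, μ ^ (p ^ (d * (2 * k + 1)) + 1) = 1 := by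
      intro k
      obtain ⟨c, hc⟩ := hdvd k
      rw [hc, pow_mul, h, one_pow]
    rw [frob_apply, frob_apply, ← pow_succ', ← pow_succ', hs, hl]
    exact ⟨hk i, hk j⟩

end card

end Kasami

/-! ### Weights of the words `Q x + Tr (c x) + h` belonging to one quadratic form `Q`. -/

namespace Kasami

variable {p : ℕ} [Fact p.Prime] {F : Type*} [Field F] [Algebra (ZMod p) F]
variable [Fintype F] [DecidableEq F]

/-- The number of zeros of `x ↦ Q x + Tr (c x) + h`. -/
noncomputable def zeroCount (Q : QuadraticForm (ZMod p) F) (c : F) (h : ZMod p) : ℕ :=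
  (Finset.univ.filter fun x => Q x + Algebra.trace (ZMod p) F (c * x) + h = 0).card

section
variable (Q : QuadraticForm (ZMod p) F) (Λ : F →+ F)
  (hΛ : ∀ x v, QuadraticMap.polar Q x v = Algebra.trace (ZMod p) F (Λ v * x))

include hΛ

omit [DecidableEq F] in
lemma radical_iff_ker (x : F) : (∀ y, QuadraticMap.polar Q x y = 0) ↔ Λ x = 0 := by
  constructor
  · intro h
    refine eq_zero_of_trace_mul (p := p) fun y => ?_
    rw [← hΛ, QuadraticMap.polar_comm]; exact h y
  · intro h y
    rw [QuadraticMap.polar_comm, hΛ, h, zero_mul, map_zero]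

omit [Fintype F] [DecidableEq F] in
lemma form_eq_zero_of_ker (hp : p ≠ 2) {x : F} (hx : Λ x = 0) : Q x = 0 := by
  have h := QuadraticMap.polar_self Q x
  rw [hΛ, hx, zero_mul, map_zero, nsmul_eq_mul] at h
  exact (mul_eq_zero.mp h.symm).resolve_left (by exact_mod_cast two_ne_zero_zmod hp)

/-- For `c = Λ v`, the shift by `v` completes the square: `Q (x + v) = Q x + Tr (c x) + Q v`. -/
lemma zeroCount_of_range {c v : F} (hv : Λ v = c) (h : ZMod p) :
    zeroCount Q c h = (Finset.univ.filter fun x => Q x = Q v - h).card := by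
  refine Finset.card_bij' (fun x _ => x + v) (fun x _ => x - v) ?_ ?_ ?_ ?_
  · intro x hx
    simp only [Finset.mem_filter_univ] at hx ⊢
    have h1 := hΛ x v
    rw [QuadraticMap.polar, hv] at h1
    linear_combination h1 + hx
  · intro x hx
    simp only [Finset.mem_filter_univ] at hx ⊢
    have h1 := hΛ (x - v) v
    rw [QuadraticMap.polar, hv, sub_add_cancel] at h1
    linear_combination -h1 + hx
  · intro x _; simp
  · intro x _; simp

/-- By the symmetry of the polar form the range of `Λ` is contained in the annihilator of its
kernel, and the two have equally many elements. -/
lemma exists_ker_of_not_range {c : F} (hc : c ∉ Λ.range) :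
    ∃ x, Λ x = 0 ∧ Algebra.trace (ZMod p) F (c * x) ≠ 0 := by
  classical
  by_contra! hcon
  set R : Finset F := Finset.univ.filter fun c => ∀ x : Λ.ker, Algebra.trace (ZMod p) F (c * x) = 0
    with hR
  have h1 : (R.card : ℂ) * Fintype.card Λ.ker = Fintype.card F := by
    have e1 : ∀ c : F, ∑ x : Λ.ker, traceChar p F (c * x) =
        if ∀ x : Λ.ker, Algebra.trace (ZMod p) F (c * x) = 0 then
          (Fintype.card Λ.ker : ℂ) else 0 := fun c =>
      sum_traceChar_comp (p := p) ((AddMonoidHom.mulLeft c).comp Λ.ker.subtype)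
    have e2 : ∑ c : F, ∑ x : Λ.ker, traceChar p F (c * x) = (R.card : ℂ) * Fintype.card Λ.ker := by
      simp only [e1]
      rw [← Finset.sum_filter, Finset.sum_const, nsmul_eq_mul]
    rw [← e2, Finset.sum_comm, Finset.sum_eq_single 0]
    · simp
    · intro x _ hx
      simp only [mul_comm _ (x : F)]
      rw [sum_traceChar_mul, if_neg]
      simpa using hx
    · simp
  have h2 : Nat.card Λ.ker * Nat.card Λ.range = Nat.card F := by
    rw [← AddSubgroup.index_ker, AddSubgroup.card_mul_index]
  simp only [Nat.card_eq_fintype_card] at h2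
  have h3 : R.card = Fintype.card Λ.range := by
    have h1' : R.card * Fintype.card Λ.ker = Fintype.card F := by exact_mod_cast h1
    rw [← h2, mul_comm] at h1'
    exact Nat.eq_of_mul_eq_mul_left Fintype.card_pos h1'
  have h4 : (Finset.univ.filter fun c => c ∈ Λ.range) ⊆ R := by
    intro d hd
    obtain ⟨v, rfl⟩ := (Finset.mem_filter.mp hd).2
    rw [hR, Finset.mem_filter]
    refine ⟨Finset.mem_univ _, fun x => ?_⟩
    rw [← hΛ]
    exact (radical_iff_ker Q Λ hΛ x).mpr x.2 v
  have h5 : (Finset.univ.filter fun c => c ∈ Λ.range) = R := by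
    refine Finset.eq_of_subset_of_card_le h4 ?_
    rw [h3, Fintype.card_subtype]
  have h6 : c ∈ R := by
    rw [hR, Finset.mem_filter]
    exact ⟨Finset.mem_univ _, fun x => hcon x x.2⟩
  rw [← h5, Finset.mem_filter] at h6
  exact hc h6.2

/-- Translation by multiples of a radical element `x₀` with `Tr (c x₀) ≠ 0` leaves `Q` unchanged and
moves the linear term through all of `ZMod p`, so all values are equally frequent. -/
lemma zeroCount_of_not_range (hp : p ≠ 2) {c : F} (hc : c ∉ Λ.range) (h : ZMod p) :
    p * zeroCount Q c h = Fintype.card F := by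
  obtain ⟨x₀, hx₀, hx₁⟩ := exists_ker_of_not_range Q Λ hΛ hc
  set f : F → ZMod p := fun x => Q x + Algebra.trace (ZMod p) F (c * x) + h with hf
  set τ := Algebra.trace (ZMod p) F (c * x₀) with hτ
  have hshift : ∀ (a : ZMod p) (x : F), f (x + a • x₀) = f x + a * τ := by
    intro a x
    have h1 := hΛ x (a • x₀)
    have hker : Λ (a • x₀) = 0 := by
      rw [← radical_iff_ker Q Λ hΛ] at hx₀ ⊢
      intro y
      rw [QuadraticMap.polar_smul_left, hx₀ y, smul_zero]
    have hQ := form_eq_zero_of_ker Q Λ hΛ hp hker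
    rw [QuadraticMap.polar, hker, zero_mul, map_zero, hQ] at h1
    simp only [hf]
    rw [mul_add, map_add (Algebra.trace (ZMod p) F), mul_smul_comm,
      map_smul (Algebra.trace (ZMod p) F), smul_eq_mul]
    linear_combination h1
  have hfib : ∀ t : ZMod p, (Finset.univ.filter fun x => f x = t).card = zeroCount Q c h := by
    intro t
    have h0 : zeroCount Q c h = (Finset.univ.filter fun x => f x = 0).card := rfl
    rw [h0]
    refine Finset.card_bij' (fun x _ => x + (-(t / τ)) • x₀) (fun x _ => x + (t / τ) • x₀)
      ?_ ?_ ?_ ?_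
    · intro x hx
      simp only [Finset.mem_filter_univ] at hx ⊢
      rw [hshift, hx]; field_simp; ring
    · intro x hx
      simp only [Finset.mem_filter_univ] at hx ⊢
      rw [hshift, hx]; field_simp; ring
    · intro x _; simp
    · intro x _; simp
  have := Finset.card_eq_sum_card_fiberwise (f := f) (s := Finset.univ) (t := Finset.univ)
    (fun _ _ => Finset.mem_coe.mpr (Finset.mem_univ _))
  rw [Finset.sum_congr rfl fun t _ => hfib t, Finset.sum_const, Finset.card_univ,
    Finset.card_univ, ZMod.card, smul_eq_mul] at this
  exact this.symm

end

/-- The indicator of the weight `w`. -/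
def wtInd (w : ℕ) (a : ℤ) : ℚ := if a = w then 1 else 0

/-- The number of words of weight `w` belonging to the form `Q`. -/
noncomputable def formCount (Q : QuadraticForm (ZMod p) F) (w : ℕ) : ℕ :=
  (Finset.univ.filter fun P : F × ZMod p =>
    Fintype.card F - zeroCount Q P.1 P.2 = w).card

lemma zeroCount_le (Q : QuadraticForm (ZMod p) F) (c : F) (h : ZMod p) :
    zeroCount Q c h ≤ Fintype.card F := Finset.card_le_univ _

/-- There are `p ^ (n - k)` linear parts in the range of `Λ`; for each of them, `Q v - h` runs over
all values `t` as `h` varies. Every other linear part gives `p` words of the generic weight. -/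
lemma formCount_eq (hp : p ≠ 2) (Q : QuadraticForm (ZMod p) F) (Λ : F →+ F)
    (hΛ : ∀ x v, QuadraticMap.polar Q x v = Algebra.trace (ZMod p) F (Λ v * x))
    {n k : ℕ} (hn : 0 < n) (hF : Fintype.card F = p ^ n) (hkn : k ≤ n)
    (hk : Nat.card {x : F | ∀ y, QuadraticMap.polar Q x y = 0} = p ^ k) (w : ℕ) :
    (formCount Q w : ℚ) = p * (p ^ n - p ^ (n - k)) * wtInd w (p ^ n - p ^ (n - 1)) +
      p ^ (n - k) * ∑ t : ZMod p,
        wtInd w (p ^ n - (Finset.univ.filter fun x => Q x = t).card) := by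
  classical
  have hp0 : 0 < p := (Fact.out : p.Prime).pos
  have hker : Nat.card Λ.ker = p ^ k := by
    rw [← hk]
    refine Nat.card_congr (Equiv.subtypeEquivRight fun x => ?_)
    exact (radical_iff_ker Q Λ hΛ x).symm
  have hrange : (Finset.univ.filter fun c => c ∈ Λ.range).card = p ^ (n - k) := by
    have h2 : Nat.card Λ.ker * Nat.card Λ.range = Nat.card F := by
      rw [← AddSubgroup.index_ker, AddSubgroup.card_mul_index]
    rw [hker, Nat.card_eq_fintype_card, Nat.card_eq_fintype_card, hF] at h2
    rw [← Fintype.card_subtype]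
    have : p ^ k * p ^ (n - k) = p ^ n := by rw [← pow_add, Nat.add_sub_cancel' hkn]
    exact Nat.eq_of_mul_eq_mul_left (pow_pos hp0 k) (h2.trans this.symm)
  have h0 : (formCount Q w : ℚ) =
      ∑ c : F, ∑ h : ZMod p, wtInd w (p ^ n - zeroCount Q c h) := by
    rw [formCount, Finset.card_filter, Nat.cast_sum, Fintype.sum_prod_type]
    refine Finset.sum_congr rfl fun c _ => Finset.sum_congr rfl fun h _ => ?_
    have hle := zeroCount_le Q c h
    rw [hF] at hle
    rw [wtInd, hF]
    push_cast
    congr 1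
    rw [← Nat.cast_pow, ← Nat.cast_sub hle]
    simp
  rw [h0, ← Finset.sum_filter_add_sum_filter_not Finset.univ (fun c => c ∈ Λ.range), add_comm]
  congr 1
  · have h1 : ∀ c ∈ Finset.univ.filter (fun c => ¬ c ∈ Λ.range),
        ∑ h : ZMod p, wtInd w (p ^ n - zeroCount Q c h) =
          p * wtInd w (p ^ n - p ^ (n - 1)) := by
      intro c hc
      have hc' := (Finset.mem_filter.mp hc).2
      have h2 : ∀ h, zeroCount Q c h = p ^ (n - 1) := by
        intro h
        have := zeroCount_of_not_range Q Λ hΛ hp hc' h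
        rw [hF, ← Nat.sub_add_cancel hn, pow_succ'] at this
        exact Nat.eq_of_mul_eq_mul_left hp0 this
      simp [h2, ZMod.card]
    rw [Finset.sum_congr rfl h1, Finset.sum_const, nsmul_eq_mul]
    have h3 : ((Finset.univ.filter (fun c => ¬ c ∈ Λ.range)).card : ℚ) =
        p ^ n - p ^ (n - k) := by
      have := Finset.card_filter_add_card_filter_not (s := (Finset.univ : Finset F))
        (fun c => c ∈ Λ.range)
      rw [hrange, Finset.card_univ, hF] at this
      rw [eq_sub_iff_add_eq']
      exact_mod_cast this
    rw [h3]; ring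
  · have h1 : ∀ c ∈ Finset.univ.filter (fun c => c ∈ Λ.range),
        ∑ h : ZMod p, wtInd w (p ^ n - zeroCount Q c h) =
          ∑ t : ZMod p, wtInd w (p ^ n - (Finset.univ.filter fun x => Q x = t).card) := by
      intro c hc
      obtain ⟨v, hv⟩ := (Finset.mem_filter.mp hc).2
      refine Fintype.sum_equiv (Equiv.subLeft (Q v)) _ _ fun h => ?_
      rw [zeroCount_of_range Q Λ hΛ hv]; rfl
    rw [Finset.sum_congr rfl h1, Finset.sum_const, nsmul_eq_mul, hrange]
    push_cast; rfl

lemma sum_wtInd_even {N : ZMod p → ℕ} {n h : ℕ} (hn : 0 < n) (hh : 0 < h) {e : ℤ}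
    (hN : ∀ t, (p : ℤ) * N t = p ^ n + e * p ^ h * (if t = 0 then (p : ℤ) - 1 else -1)) (w : ℕ) :
    ∑ t, wtInd w (p ^ n - N t) =
      wtInd w (p ^ n - p ^ (n - 1) - e * (p - 1) * p ^ (h - 1)) +
        (p - 1) * wtInd w (p ^ n - p ^ (n - 1) + e * p ^ (h - 1)) := by
  have hp0 : (p : ℤ) ≠ 0 := by exact_mod_cast (Fact.out : p.Prime).ne_zero
  obtain ⟨n, rfl⟩ := Nat.exists_eq_add_of_lt hn
  obtain ⟨h, rfl⟩ := Nat.exists_eq_add_of_lt hh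
  simp only [zero_add, Nat.add_sub_cancel] at hN ⊢
  have h0 : (N 0 : ℤ) = p ^ n + e * (p - 1) * p ^ h := by
    have := hN 0
    rw [if_pos rfl] at this
    apply mul_left_cancel₀ hp0
    rw [this]; ring
  have h1 : ∀ t ∈ Finset.univ.erase (0 : ZMod p), wtInd w (p ^ (n + 1) - N t) =
      wtInd w (p ^ (n + 1) - p ^ n + e * p ^ h) := by
    intro t ht
    have := hN t
    rw [if_neg (Finset.ne_of_mem_erase ht)] at this
    have h2 : (N t : ℤ) = p ^ n - e * p ^ h := by
      apply mul_left_cancel₀ hp0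
      rw [this]; ring
    rw [h2]; congr 1; ring
  rw [← Finset.add_sum_erase _ _ (Finset.mem_univ (0 : ZMod p)), h0, Finset.sum_congr rfl h1,
    Finset.sum_const, nsmul_eq_mul, Finset.card_erase_of_mem (Finset.mem_univ _),
    Finset.card_univ, ZMod.card, Nat.cast_pred (Fact.out : p.Prime).pos]
  congr 2; ring

/-- On the values `1` and `-1` the function `f` agrees with an affine one, whose linear part sums to
zero because the quadratic character does. -/
lemma sum_quadraticChar_comp (hp : p ≠ 2) (f : ℤ → ℚ) :
    ∑ t : ZMod p, f (quadraticChar (ZMod p) t) = f 0 + (p - 1) / 2 * (f 1 + f (-1)) := by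
  have hzero := quadraticChar_sum_zero (F := ZMod p) (by rwa [ZMod.ringChar_zmod_n])
  have h2 : ∀ t ∈ Finset.univ.erase (0 : ZMod p), f (quadraticChar (ZMod p) t) =
      (f 1 + f (-1)) / 2 + (f 1 - f (-1)) / 2 * (quadraticChar (ZMod p) t : ℚ) := by
    intro t ht
    rcases quadraticChar_dichotomy (Finset.ne_of_mem_erase ht) with h | h <;> rw [h] <;>
      push_cast <;> ring
  have h3 : ∑ t ∈ Finset.univ.erase (0 : ZMod p), (quadraticChar (ZMod p) t : ℚ) = 0 := by
    rw [Finset.sum_erase _ (by simp)]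
    exact_mod_cast hzero
  rw [← Finset.add_sum_erase _ _ (Finset.mem_univ (0 : ZMod p)), Finset.sum_congr rfl h2,
    Finset.sum_add_distrib, ← Finset.mul_sum, h3, Finset.sum_const, nsmul_eq_mul,
    Finset.card_erase_of_mem (Finset.mem_univ _), Finset.card_univ, ZMod.card,
    Nat.cast_pred (Fact.out : p.Prime).pos, MulChar.map_zero]
  ring

/-- The sign `e` drops out because nonzero squares and nonsquares are equally many. -/
lemma sum_wtInd_odd (hp : p ≠ 2) {N : ZMod p → ℕ} {n h : ℕ} (hn : 0 < n) (hh : 0 < h) {e : ℤ}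
    (he : e = 1 ∨ e = -1)
    (hN : ∀ t, (p : ℤ) * N t = p ^ n + e * p ^ h * quadraticChar (ZMod p) t) (w : ℕ) :
    ∑ t, wtInd w (p ^ n - N t) = wtInd w (p ^ n - p ^ (n - 1)) +
      (p - 1) / 2 * (wtInd w (p ^ n - p ^ (n - 1) + p ^ (h - 1)) +
        wtInd w (p ^ n - p ^ (n - 1) - p ^ (h - 1))) := by
  have hp0 : (p : ℤ) ≠ 0 := by exact_mod_cast (Fact.out : p.Prime).ne_zero
  obtain ⟨n, rfl⟩ := Nat.exists_eq_add_of_lt hn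
  obtain ⟨h, rfl⟩ := Nat.exists_eq_add_of_lt hh
  simp only [zero_add, Nat.add_sub_cancel] at hN ⊢
  have h1 : ∀ t : ZMod p, wtInd w (p ^ (n + 1) - N t) =
      (fun z : ℤ => wtInd w (p ^ (n + 1) - p ^ n - e * p ^ h * z)) (quadraticChar (ZMod p) t) := by
    intro t
    have h2 : (N t : ℤ) = p ^ n + e * p ^ h * quadraticChar (ZMod p) t := by
      apply mul_left_cancel₀ hp0
      rw [hN t]; ring
    simp only [h2]; congr 1; ring
  rw [Finset.sum_congr rfl fun t _ => h1 t,
    sum_quadraticChar_comp hp (fun z : ℤ => wtInd w (p ^ (n + 1) - p ^ n - e * p ^ h * z))]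
  rcases he with rfl | rfl
  · rw [show (p : ℤ) ^ (n + 1) - p ^ n - 1 * p ^ h * 0 = p ^ (n + 1) - p ^ n by ring,
      show (p : ℤ) ^ (n + 1) - p ^ n - 1 * p ^ h * 1 = p ^ (n + 1) - p ^ n - p ^ h by ring,
      show (p : ℤ) ^ (n + 1) - p ^ n - 1 * p ^ h * -1 = p ^ (n + 1) - p ^ n + p ^ h by ring]
    ring
  · rw [show (p : ℤ) ^ (n + 1) - p ^ n - -1 * p ^ h * 0 = p ^ (n + 1) - p ^ n by ring,
      show (p : ℤ) ^ (n + 1) - p ^ n - -1 * p ^ h * 1 = p ^ (n + 1) - p ^ n + p ^ h by ring,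
      show (p : ℤ) ^ (n + 1) - p ^ n - -1 * p ^ h * -1 = p ^ (n + 1) - p ^ n - p ^ h by ring]

/-! ### Word counts for the forms `kasamiForm` -/

/-- The self-adjoint map attached to `kasamiForm`. -/
noncomputable def polarMap (σ bar : F ≃ₐ[ZMod p] F) (a b : F) : F →+ F where
  toFun v := σ.symm (σ (2 * a * bar v + b * σ v) + b * v)
  map_zero' := by simp
  map_add' u v := by rw [← map_add]; congr 1; simp only [map_add, map_mul]; ring

section
variable {σ bar : F ≃ₐ[ZMod p] F} (hp : p ≠ 2) (hbar : ∀ x, bar (bar x) = x)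
  {n : ℕ} (hn : 0 < n) (hF : Fintype.card F = p ^ n) {a b : F} (ha : bar a = a)

include hbar ha in
omit [Fintype F] [DecidableEq F] in
lemma polar_eq_polarMap (x v : F) : QuadraticMap.polar (kasamiForm σ bar a b) x v =
    Algebra.trace (ZMod p) F (polarMap σ bar a b v * x) := by
  rw [QuadraticMap.polar_comm, polar_kasamiForm hbar ha, ← Algebra.trace_eq_of_algEquiv σ
    (polarMap σ bar a b v * x), map_mul σ]
  congr 2
  exact (σ.apply_symm_apply _).symm

include hp hbar hn hF ha

/-- Even rank: the word counts in terms of the exponential sum. -/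
theorem formCount_even {k r : ℕ} (hk : radCard σ bar a b = p ^ k) (hnk : n = k + 2 * r)
    (hkr : 0 < k + r) : ∃ e : ℤ, (e = 1 ∨ e = -1) ∧ expSum σ bar a b = e * p ^ (k + r) ∧
      (∀ t, t ≠ 0 → (p : ℤ) * (Finset.univ.filter fun x => kasamiForm σ bar a b x = t).card =
        p ^ n - e * p ^ (k + r)) ∧
      ∀ w, (formCount (kasamiForm σ bar a b) w : ℚ) =
        p * (p ^ n - p ^ (n - k)) * wtInd w (p ^ n - p ^ (n - 1)) +
        p ^ (n - k) * (wtInd w (p ^ n - p ^ (n - 1) - e * (p - 1) * p ^ (k + r - 1)) +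
          (p - 1) * wtInd w (p ^ n - p ^ (n - 1) + e * p ^ (k + r - 1))) := by
  rw [← card_radical_eq hbar ha] at hk
  obtain ⟨e, he, hsum, hN⟩ := quadraticForm_even hp (kasamiForm σ bar a b) n k r hF hk hnk
  refine ⟨e, he, hsum, fun t ht => ?_, fun w => ?_⟩
  · rw [hN t, if_neg ht]; ring
  · rw [formCount_eq hp _ (polarMap σ bar a b) (polar_eq_polarMap hbar ha) hn hF (by omega) hk,
      sum_wtInd_even hn hkr hN]

/-- Odd rank. -/
theorem formCount_odd {k r : ℕ} (hk : radCard σ bar a b = p ^ k) (hnk : n = k + (2 * r + 1)) :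
    ∀ w, (formCount (kasamiForm σ bar a b) w : ℚ) =
        p * (p ^ n - p ^ (n - k)) * wtInd w (p ^ n - p ^ (n - 1)) +
        p ^ (n - k) * (wtInd w (p ^ n - p ^ (n - 1)) +
          (p - 1) / 2 * (wtInd w (p ^ n - p ^ (n - 1) + p ^ (k + r)) +
            wtInd w (p ^ n - p ^ (n - 1) - p ^ (k + r)))) := by
  intro w
  rw [← card_radical_eq hbar ha] at hk
  obtain ⟨e, he, hN⟩ := quadraticForm_odd hp (kasamiForm σ bar a b) n k r hF hk hnk
  rw [formCount_eq hp _ (polarMap σ bar a b) (polar_eq_polarMap hbar ha) hn hF (by omega) hk,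
    sum_wtInd_odd hp hn (Nat.succ_pos _) he hN, Nat.succ_sub_one]

end

end Kasami

namespace Kasami

/-! ### Dual and extended codes -/

section dual
variable {k : Type*} [Field k] {n : ℕ}

lemma dualCode_dualCode (D : Submodule k (Fin n → k)) : dualCode (dualCode D) = D := by
  apply le_antisymm
  · intro v hv
    rw [← Subspace.dualAnnihilator_dualCoannihilator_eq (W := D), Submodule.mem_dualCoannihilator]
    intro f hf
    rw [Submodule.mem_dualAnnihilator] at hf
    have hsum : ∀ x : Fin n → k, f x = ∑ i, x i * f (Pi.single i 1) := by
      intro x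
      rw [LinearMap.pi_apply_eq_sum_univ f x]
      refine Finset.sum_congr rfl fun i _ => ?_
      rw [smul_eq_mul]
      congr 2
      ext j
      simp [Pi.single_apply, eq_comm]
    rw [hsum]
    refine hv (fun i => f (Pi.single i 1)) fun c hc => ?_
    rw [← hf c hc, hsum]
    exact Finset.sum_congr rfl fun i _ => mul_comm _ _
  · intro v hv u hu
    rw [← hu v hv]
    exact Finset.sum_congr rfl fun i _ => mul_comm _ _

/-- The words of length `n + 1` obtained from the words of `D` by appending `0` and adding a
constant. -/
def augmentedCode (D : Submodule k (Fin n → k)) : Submodule k (Fin (n + 1) → k) :=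
  D.comap (LinearMap.pi fun i : Fin n =>
    LinearMap.proj (R := k) (φ := fun _ => k) i.castSucc - LinearMap.proj (Fin.last n))

lemma mem_augmentedCode {D : Submodule k (Fin n → k)} {v : Fin (n + 1) → k} :
    v ∈ augmentedCode D ↔ (fun i : Fin n => v i.castSucc - v (Fin.last n)) ∈ D := Iff.rfl

/-- The augmented code is spanned by the words of `D` padded with `0` and by the all-ones word;
orthogonality to these is membership in the dual of `D` and vanishing of the coordinate sum,
respectively. -/
lemma extendedCode_dualCode (D : Submodule k (Fin n → k)) :
    extendedCode (dualCode D) = dualCode (augmentedCode D) := by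
  ext u
  constructor
  · rintro ⟨h1, h2⟩ v hv
    have h3 := h1 _ (mem_augmentedCode.mp hv)
    simp only [mul_sub, Finset.sum_sub_distrib, ← Finset.sum_mul] at h3
    rw [Fin.sum_univ_castSucc] at h2 ⊢
    linear_combination h3 + v (Fin.last n) * h2
  · intro h
    refine ⟨fun c hc => ?_, ?_⟩
    · have := h (Fin.snoc c 0) (by
        rw [mem_augmentedCode]; simpa using hc)
      rw [Fin.sum_univ_castSucc] at this
      simpa using this
    · have := h (fun _ => 1) (by
        rw [mem_augmentedCode]; simp only [sub_self]; exact D.zero_mem)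
      simpa using this

lemma dual_extended_dual (D : Submodule k (Fin n → k)) :
    dualCode (extendedCode (dualCode D)) = augmentedCode D := by
  rw [extendedCode_dualCode, dualCode_dualCode]

end dual

/-! ### Sums of two powers -/

/-- Compare the exact powers of `p` on both sides: `1 + p ^ e` is never divisible by `p`, where `e =
0` is the case that needs `p > 2`. -/
lemma pow_add_pow_inj {p : ℕ} (hp : 2 < p) {i j i' j' : ℕ} (h : p ^ i + p ^ j = p ^ i' + p ^ j') :
    (i = i' ∧ j = j') ∨ (i = j' ∧ j = i') := by
  have key : ∀ i j i' j' : ℕ, i ≤ j → i' ≤ j' → p ^ i + p ^ j = p ^ i' + p ^ j' → ¬ i < i' := by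
    intro i j i' j' hij hij' h hlt
    obtain ⟨e, rfl⟩ := Nat.exists_eq_add_of_le hij
    have h1 : p ^ (i + 1) ∣ p ^ i + p ^ (i + e) := by
      rw [h]
      exact dvd_add (pow_dvd_pow p (by omega)) (pow_dvd_pow p (by omega))
    have h2 : p ∣ 1 + p ^ e := by
      rw [pow_succ, pow_add, show p ^ i + p ^ i * p ^ e = p ^ i * (1 + p ^ e) by ring] at h1
      exact Nat.dvd_of_mul_dvd_mul_left (pow_pos (by omega) i) h1
    rcases Nat.eq_zero_or_pos e with rfl | he
    · have := Nat.le_of_dvd (by norm_num) h2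
      norm_num at this; omega
    · have h3 : p ∣ 1 := (Nat.dvd_add_left (dvd_pow_self p he.ne')).mp h2
      have := Nat.le_of_dvd one_pos h3
      omega
  have hinj : ∀ {a b : ℕ}, p ^ a = p ^ b → a = b := fun h => Nat.pow_right_injective (by omega) h
  have main : ∀ i j i' j' : ℕ, i ≤ j → i' ≤ j' → p ^ i + p ^ j = p ^ i' + p ^ j' →
      i = i' ∧ j = j' := by
    intro i j i' j' hij hij' h
    have h1 : i = i' := le_antisymm (not_lt.mp (key _ _ _ _ hij' hij h.symm))
      (not_lt.mp (key _ _ _ _ hij hij' h))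
    subst h1
    exact ⟨rfl, hinj (Nat.add_left_cancel h)⟩
  rcases le_total i j with h1 | h1 <;> rcases le_total i' j' with h2 | h2
  · exact Or.inl (main _ _ _ _ h1 h2 h)
  · exact Or.inr (main _ _ _ _ h1 h2 (by rw [h, add_comm]))
  · have := main j i i' j' h1 h2 (by rw [← h, add_comm])
    exact Or.inr ⟨this.2, this.1⟩
  · have := main j i j' i' h1 h2 (by rw [add_comm, h, add_comm])
    exact Or.inl ⟨this.2, this.1⟩

/-! ### Roots of the parity-check polynomial -/

variable {p : ℕ} [Fact p.Prime] {F : Type*} [Field F] [Algebra (ZMod p) F]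

lemma finrank_eq_of_card [Fintype F] {m : ℕ} (hF : Fintype.card F = p ^ m) :
    Module.finrank (ZMod p) F = m := by
  have h := Module.card_eq_pow_finrank (K := ZMod p) (V := F)
  rw [hF, ZMod.card] at h
  exact (Nat.pow_right_injective (Fact.out : p.Prime).two_le h).symm

lemma aeval_pow_pow [Fintype F] (f : (ZMod p)[X]) (x : F) (k : ℕ) :
    aeval (x ^ p ^ k) f = (aeval x f) ^ p ^ k := by
  rw [← frob_apply (p := p), ← frob_apply (p := p), Polynomial.aeval_algHom_apply]

lemma root_minpoly_iff [Fintype F] {m : ℕ} (hF : Fintype.card F = p ^ m) (x β : F) :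
    aeval x (minpoly (ZMod p) β) = 0 ↔ ∃ k < m, x = β ^ p ^ k := by
  constructor
  · intro h
    have hc : IsConjRoot (ZMod p) x β :=
      ((isConjRoot_iff_aeval_eq_zero (Algebra.IsIntegral.isIntegral β)).mpr h).symm
    obtain ⟨τ, rfl⟩ := isConjRoot_iff_exists_algEquiv.mp hc
    obtain ⟨k, hk⟩ := (FiniteField.bijective_frobeniusAlgEquivOfAlgebraic_pow (ZMod p) F).2 τ
    refine ⟨k, ?_, ?_⟩
    · exact k.2.trans_eq (finrank_eq_of_card hF)
    · rw [← frob_apply (p := p), ← hk]; rfl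
  · rintro ⟨k, -, rfl⟩
    rw [aeval_pow_pow, minpoly.aeval, zero_pow (pow_pos (Fact.out : p.Prime).pos k).ne']

lemma X_pow_sub_one_dvd_iff [Fintype F] {n : ℕ} (hn : 0 < n) {α : F} (hα : IsPrimitiveRoot α n)
    (f : (ZMod p)[X]) : X ^ n - 1 ∣ f ↔ ∀ x : F, x ^ n = 1 → aeval x f = 0 := by
  classical
  constructor
  · rintro ⟨g, rfl⟩ x hx
    simp [hx]
  · intro h
    rw [← Polynomial.map_dvd_map' (algebraMap (ZMod p) F), Polynomial.map_sub, Polynomial.map_pow,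
      Polynomial.map_X, Polynomial.map_one, X_pow_sub_one_eq_prod hn hα]
    refine Finset.prod_dvd_of_coprime ?_ fun x hx => ?_
    · intro x _ y _ hxy
      exact Polynomial.isCoprime_X_sub_C_of_isUnit_sub (sub_ne_zero.mpr hxy).isUnit
    · rw [Polynomial.dvd_iff_isRoot, Polynomial.IsRoot.def, Polynomial.eval_map_algebraMap]
      exact h x ((Polynomial.mem_nthRootsFinset hn _).mp hx)

/-- After multiplication by `h`, membership says `X ^ n - 1 ∣ h * wordPoly c`, which can be tested
at the `n` distinct roots of unity. -/
lemma mem_parityCheck_iff [Fintype F] {n : ℕ} (hn : 0 < n) {α : F} (hα : IsPrimitiveRoot α n)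
    {h : (ZMod p)[X]} (hmon : h.Monic) (hdvd : h ∣ X ^ n - 1) (c : Fin n → ZMod p) :
    c ∈ parityCheckCyclicCode n h ↔
      ∀ x : F, x ^ n = 1 → aeval x h ≠ 0 → aeval x (wordPoly c) = 0 := by
  have hg : h * ((X ^ n - 1) /ₘ h) = X ^ n - 1 := by
    have h1 := Polynomial.modByMonic_add_div (X ^ n - 1 : (ZMod p)[X]) h
    rwa [(Polynomial.modByMonic_eq_zero_iff_dvd hmon).mpr hdvd, zero_add] at h1
  have h2 : c ∈ parityCheckCyclicCode n h ↔ X ^ n - 1 ∣ h * wordPoly c := by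
    change (X ^ n - 1) /ₘ h ∣ wordPoly c ↔ _
    conv_rhs => rw [← hg]
    exact (mul_dvd_mul_iff_left hmon.ne_zero).symm
  rw [h2, X_pow_sub_one_dvd_iff hn hα]
  refine forall_congr' fun x => forall_congr' fun _ => ?_
  rw [map_mul, mul_eq_zero, or_iff_not_imp_left]

lemma aeval_wordPoly {n : ℕ} (c : Fin n → ZMod p) (x : F) :
    aeval x (wordPoly c) = ∑ i, algebraMap (ZMod p) F (c i) * x ^ (i : ℕ) := by
  simp [wordPoly, map_sum]

lemma sum_pow_eq_zero {n : ℕ} {z : F} (hz : z ^ n = 1) (h1 : z ≠ 1) :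
    ∑ i : Fin n, z ^ (i : ℕ) = 0 := by
  rw [Fin.sum_univ_eq_sum_range (fun i => z ^ i)]
  have := geom_sum_mul z n
  rw [hz, sub_self] at this
  exact (mul_eq_zero.mp this).resolve_right (sub_ne_zero.mpr h1)

/-- Fourier inversion for words. -/
lemma word_eq_sum [Fintype F] [DecidableEq F] {m : ℕ} (hm : 0 < m) (hF : Fintype.card F = p ^ m)
    {α : F} (hα : IsPrimitiveRoot α (p ^ m - 1)) (c : Fin (p ^ m - 1) → ZMod p)
    (i : Fin (p ^ m - 1)) : algebraMap (ZMod p) F (c i) =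
      -∑ x ∈ Finset.univ.filter (fun x : F => x ≠ 0),
        aeval x (wordPoly c) * x⁻¹ ^ (i : ℕ) := by
  have hn : 0 < p ^ m - 1 := pow_sub_one_pos p hm
  -- The length is `-1` in `F`; this is the normalising factor of the inversion formula.
  have hnz : ((p ^ m - 1 : ℕ) : F) = -1 := by
    have h : ((p ^ m : ℕ) : F) = 0 := by
      have := congrArg (algebraMap (ZMod p) F) (ZMod.natCast_self p)
      rw [map_natCast, map_zero] at this
      rw [Nat.cast_pow, this, zero_pow hm.ne']
    rw [Nat.cast_sub (Nat.one_le_pow _ _ (Fact.out : p.Prime).pos), h]; simp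
  have hinj : Set.InjOn (fun j => α ^ j) (Finset.range (p ^ m - 1) : Set ℕ) := by
    intro a ha b hb h
    exact hα.pow_inj (Finset.mem_range.mp ha) (Finset.mem_range.mp hb) h
  have himg : Finset.univ.filter (fun x : F => x ≠ 0) =
      (Finset.range (p ^ m - 1)).image fun j => α ^ j := by
    ext x
    simp only [Finset.mem_filter_univ, Finset.mem_image, Finset.mem_range]
    constructor
    · intro hx
      exact exists_pow_eq hF hα hm hx
    · rintro ⟨j, -, rfl⟩
      exact pow_ne_zero _ (hα.ne_zero hn.ne')
  have horth : ∀ j : Fin (p ^ m - 1), ∑ x ∈ Finset.univ.filter (fun x : F => x ≠ 0),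
      x ^ (j : ℕ) * x⁻¹ ^ (i : ℕ) = if j = i then -1 else 0 := by
    intro j
    rw [himg, Finset.sum_image hinj]
    have hα0 : α ≠ 0 := hα.ne_zero hn.ne'
    have : ∀ e : ℕ, (α ^ e) ^ (j : ℕ) * (α ^ e)⁻¹ ^ (i : ℕ) = (α ^ (j : ℕ) / α ^ (i : ℕ)) ^ e := by
      intro e
      rw [div_pow, ← pow_mul, ← pow_mul, ← pow_mul, inv_pow, ← pow_mul, mul_comm e, mul_comm e,
        div_eq_mul_inv]
    simp only [this]
    rw [← Fin.sum_univ_eq_sum_range]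
    split_ifs with hji
    · subst hji
      rw [div_self (pow_ne_zero _ hα0)]
      simp [hnz]
    · apply sum_pow_eq_zero
      · rw [div_pow, ← pow_mul, ← pow_mul, mul_comm, pow_mul, hα.pow_eq_one, mul_comm, pow_mul,
          hα.pow_eq_one, one_pow, one_pow, div_one]
      · intro h
        rw [div_eq_one_iff_eq (pow_ne_zero _ hα0)] at h
        exact hji (Fin.ext (hα.pow_inj j.2 i.2 h))
  simp only [aeval_wordPoly, Finset.sum_mul]
  rw [Finset.sum_comm]
  simp only [mul_assoc, ← Finset.mul_sum, horth]
  simp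

end Kasami

/-! ### The codewords as trace functions. -/

namespace Kasami

variable {p : ℕ} [Fact p.Prime] {F : Type*} [Field F] [Algebra (ZMod p) F]

lemma absTrace_eq_sum_frob [Finite F] (r : ℕ) (x : F) :
    absTrace p r x = ∑ k ∈ Finset.range r, frob p F k x := by
  simp only [absTrace, frob_apply]

lemma absTrace_add [Finite F] (r : ℕ) (x y : F) :
    absTrace p r (x + y) = absTrace p r x + absTrace p r y := by
  simp only [absTrace_eq_sum_frob, map_add, Finset.sum_add_distrib]

lemma absTrace_neg [Finite F] (r : ℕ) (x : F) : absTrace p r (-x) = -absTrace p r x := by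
  simp only [absTrace_eq_sum_frob, map_neg, Finset.sum_neg_distrib]

lemma absTrace_zero [Finite F] (r : ℕ) : absTrace p r (0 : F) = 0 := by
  simp only [absTrace_eq_sum_frob, map_zero, Finset.sum_const_zero]

section
variable [Fintype F] [DecidableEq F] {m s l : ℕ} (hp : 2 < p) (hs : 2 ≤ s) (hms : m = 2 * s)
  (hl : l < m) (hls : l ≠ s) (hF : Fintype.card F = p ^ m) {α : F}
  (hα : IsPrimitiveRoot α (p ^ m - 1))

include hp hs hms

/-- For `p ≥ 3` these exponents do not wrap around modulo the order of `α`, so equalities of powers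
of `α` become equalities of integers. -/
lemma pow_add_pow_lt {i j : ℕ} (hi : i < m) (hj : j < m) : p ^ i + p ^ j < p ^ m - 1 := by
  have h1 : p ^ i ≤ p ^ (m - 1) := Nat.pow_le_pow_right (by omega) (by omega)
  have h2 : p ^ j ≤ p ^ (m - 1) := Nat.pow_le_pow_right (by omega) (by omega)
  have h3 : p ^ m = p * p ^ (m - 1) := by rw [← pow_succ']; congr 1; omega
  have h4 : 3 * p ^ (m - 1) ≤ p * p ^ (m - 1) := Nat.mul_le_mul_right _ hp
  have h5 : 1 < p ^ (m - 1) := Nat.one_lt_pow (by omega) (by omega)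
  omega

include hF hα

lemma alpha_pow_inj {i j i' j' : ℕ} (hi : i < m) (hj : j < m) (hi' : i' < m) (hj' : j' < m)
    (h : α ^ (p ^ i + p ^ j) = α ^ (p ^ i' + p ^ j')) :
    (i = i' ∧ j = j') ∨ (i = j' ∧ j = i') :=
  pow_add_pow_inj hp (hα.pow_inj (pow_add_pow_lt hp hs hms hi hj)
    (pow_add_pow_lt hp hs hms hi' hj') h)

/-- The exponents differ in parity, as `p` is odd. -/
lemma alpha_pow_ne {i j k : ℕ} (hi : i < m) (hj : j < m) (hk : k < m) :
    α ^ p ^ k ≠ α ^ (p ^ i + p ^ j) := by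
  intro h
  have h1 := hα.pow_inj ((Nat.le_add_right _ _).trans_lt (pow_add_pow_lt hp hs hms hk hi))
    (pow_add_pow_lt hp hs hms hi hj) h
  have hodd : Odd p := (Fact.out : p.Prime).odd_of_ne_two (by omega)
  have h2 : Odd (p ^ k) := hodd.pow
  have h3 : Even (p ^ i + p ^ j) := hodd.pow.add_odd hodd.pow
  rw [h1] at h2
  exact (Nat.not_odd_iff_even.mpr h3) h2

lemma conj_bar {k : ℕ} : (α ^ (p ^ s + 1)) ^ p ^ k = α ^ (p ^ k + p ^ (k + s)) := by
  rw [← pow_mul]; congr 1; ring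

lemma conj_sigma (k : ℕ) :
    (α ^ (p ^ l + 1)) ^ p ^ k = α ^ (p ^ k + p ^ ((l + k) % m)) := by
  have h1 : α ^ p ^ (l + k) = α ^ p ^ ((l + k) % m) := by
    have hm : ∀ y : F, ∀ c, y ^ p ^ (m * c) = y := fun y c =>
      pow_pow_of_dvd (Dvd.intro _ rfl) (pow_card_pow hF y)
    conv_lhs => rw [← Nat.mod_add_div (l + k) m, pow_add, pow_mul, hm]
  rw [← pow_mul, pow_add, ← h1, ← pow_add]; congr 1; ring

/-- The element `α ^ (p ^ s + 1)` lies in the subfield of `p ^ s` elements, so only exponents below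
`s` matter. -/
lemma conj_bar_mod (k : ℕ) : ∃ k' < s, (α ^ (p ^ s + 1)) ^ p ^ k = (α ^ (p ^ s + 1)) ^ p ^ k' := by
  have hper : (α ^ (p ^ s + 1)) ^ p ^ s = α ^ (p ^ s + 1) := by
    rw [← pow_mul, show (p ^ s + 1) * p ^ s = p ^ m + p ^ s by rw [hms]; ring, pow_add,
      pow_card_pow hF, ← pow_succ']
  refine ⟨k % s, Nat.mod_lt _ (by omega), ?_⟩
  generalize α ^ (p ^ s + 1) = B at hper ⊢
  conv_lhs => rw [← Nat.mod_add_div k s, pow_add, mul_comm, pow_mul]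
  rw [pow_pow_of_dvd (Dvd.intro _ rfl) hper]

include hl hls

/-- Comparing base-`p` digits, in either order, would give `l ≡ s` modulo `m = 2 s`. -/
lemma bar_ne_sigma {k k' : ℕ} (hk : k < s) (hk' : k' < m) :
    (α ^ (p ^ s + 1)) ^ p ^ k ≠ (α ^ (p ^ l + 1)) ^ p ^ k' := by
  intro h
  rw [conj_bar hp hs hms hF hα, conj_sigma hp hs hms hF hα] at h
  have hmod : (l + k') % m < m := Nat.mod_lt _ (by omega)
  have hcases : (l + k') % m = l + k' ∨ (l + k') % m + m = l + k' := by
    rcases lt_or_ge (l + k') m with h' | h'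
    · left; exact Nat.mod_eq_of_lt h'
    · right
      rw [Nat.mod_eq_sub_mod h', Nat.mod_eq_of_lt (by omega)]; omega
  rcases alpha_pow_inj hp hs hms hF hα (by omega) (by omega) hk' hmod h with ⟨h1, h2⟩ | ⟨h1, h2⟩ <;>
    omega

/-- If the two digits are interchanged, then `2 l ≡ 0` modulo `m`. As `l ≠ s`, this leaves `l = 0`,
where `k = k'` again. -/
lemma sigma_inj {k k' : ℕ} (hk : k < m) (hk' : k' < m)
    (h : (α ^ (p ^ l + 1)) ^ p ^ k = (α ^ (p ^ l + 1)) ^ p ^ k') : k = k' := by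
  rw [conj_sigma hp hs hms hF hα, conj_sigma hp hs hms hF hα] at h
  have hmod : ∀ k, (l + k) % m < m := fun k => Nat.mod_lt _ (by omega)
  have hcases : ∀ k < m, (l + k) % m = l + k ∨ (l + k) % m + m = l + k := by
    intro k hk
    rcases lt_or_ge (l + k) m with h' | h'
    · left; exact Nat.mod_eq_of_lt h'
    · right
      rw [Nat.mod_eq_sub_mod h', Nat.mod_eq_of_lt (by omega)]; omega
  have c1 := hcases k hk
  have c2 := hcases k' hk'
  rcases alpha_pow_inj hp hs hms hF hα hk (hmod k) hk' (hmod k') h with ⟨h1, h2⟩ | ⟨h1, h2⟩ <;>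
    omega

omit hl hls in
lemma bar_inj {k k' : ℕ} (hk : k < s) (hk' : k' < s)
    (h : (α ^ (p ^ s + 1)) ^ p ^ k = (α ^ (p ^ s + 1)) ^ p ^ k') : k = k' := by
  rw [conj_bar hp hs hms hF hα, conj_bar hp hs hms hF hα] at h
  rcases alpha_pow_inj hp hs hms hF hα (by omega) (by omega) (by omega) (by omega) h with h1 | h1 <;>
    omega

omit hl hls in
lemma one_inj {k k' : ℕ} (hk : k < m) (hk' : k' < m) (h : α ^ p ^ k = α ^ p ^ k') : k = k' := by
  have hlt : ∀ k < m, p ^ k < p ^ m - 1 := fun k hk =>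
    (Nat.le_add_right _ _).trans_lt (pow_add_pow_lt hp hs hms hk hk)
  exact Nat.pow_right_injective (by omega) (hα.pow_inj (hlt k hk) (hlt k' hk') h)

omit hl hls in
lemma one_ne_bar {k k' : ℕ} (hk : k < m) (hk' : k' < s) :
    α ^ p ^ k ≠ (α ^ (p ^ s + 1)) ^ p ^ k' := by
  rw [conj_bar hp hs hms hF hα]
  exact alpha_pow_ne hp hs hms hF hα (by omega) (by omega) hk

omit hl hls in
lemma one_ne_sigma {k k' : ℕ} (hk : k < m) (hk' : k' < m) :
    α ^ p ^ k ≠ (α ^ (p ^ l + 1)) ^ p ^ k' := by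
  rw [conj_sigma hp hs hms hF hα]
  exact alpha_pow_ne hp hs hms hF hα (by omega) (Nat.mod_lt _ (by omega)) hk

omit hp hs hms hF hα hl hls in
variable (p m s l α) in
/-- The parity-check polynomial. -/
noncomputable def parityPoly : (ZMod p)[X] :=
  minpoly (ZMod p) α * minpoly (ZMod p) (α ^ (p ^ s + 1)) * minpoly (ZMod p) (α ^ (p ^ l + 1))

omit hp hs hms hF hα hl hls in
lemma parityPoly_monic : (parityPoly p s l α).Monic :=
  ((minpoly.monic (Algebra.IsIntegral.isIntegral _)).mul
    (minpoly.monic (Algebra.IsIntegral.isIntegral _))).mul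
    (minpoly.monic (Algebra.IsIntegral.isIntegral _))

omit hl hls in
lemma root_parityPoly_iff (x : F) : aeval x (parityPoly p s l α) = 0 ↔
    (∃ k < m, x = α ^ p ^ k) ∨ (∃ k < s, x = (α ^ (p ^ s + 1)) ^ p ^ k) ∨
      (∃ k < m, x = (α ^ (p ^ l + 1)) ^ p ^ k) := by
  simp only [parityPoly, map_mul, mul_eq_zero, root_minpoly_iff hF, or_assoc]
  refine or_congr Iff.rfl (or_congr ?_ Iff.rfl)
  constructor
  · rintro ⟨k, -, rfl⟩
    obtain ⟨k', hk', h⟩ := conj_bar_mod hp hs hms hF hα k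
    exact ⟨k', hk', h⟩
  · rintro ⟨k, hk, rfl⟩
    exact ⟨k, by omega, rfl⟩

/-- The three minimal polynomials belong to different conjugacy classes, hence are coprime, and each
divides `X ^ (p ^ m - 1) - 1`. -/
lemma parityPoly_dvd : parityPoly p s l α ∣ X ^ (p ^ m - 1) - 1 := by
  have hone : ∀ e, (α ^ e) ^ (p ^ m - 1) = 1 := fun e => by
    rw [← pow_mul, mul_comm, pow_mul, hα.pow_eq_one, one_pow]
  have hdvd : ∀ e, minpoly (ZMod p) (α ^ e) ∣ X ^ (p ^ m - 1) - 1 := fun e => by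
    apply minpoly.dvd; simp [hone e]
  have hirr : ∀ x : F, Irreducible (minpoly (ZMod p) x) := fun x =>
    minpoly.irreducible (Algebra.IsIntegral.isIntegral _)
  have hco : ∀ x y : F, (∀ k < m, y ≠ x ^ p ^ k) →
      IsCoprime (minpoly (ZMod p) x) (minpoly (ZMod p) y) := by
    intro x y h
    rw [(hirr x).coprime_iff_not_dvd]
    intro hd
    have h1 : aeval y (minpoly (ZMod p) x) = 0 := by
      have h2 := eq_of_monic_of_associated (minpoly.monic (Algebra.IsIntegral.isIntegral _))
        (minpoly.monic (Algebra.IsIntegral.isIntegral _)) ((hirr x).associated_of_dvd (hirr y) hd)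
      rw [h2, minpoly.aeval]
    obtain ⟨k, hk, hy⟩ := (root_minpoly_iff hF y x).mp h1
    exact h k hk hy
  have hα1 : minpoly (ZMod p) α = minpoly (ZMod p) (α ^ 1) := by rw [pow_one]
  refine IsCoprime.mul_dvd (IsCoprime.mul_left ?_ ?_) (IsCoprime.mul_dvd ?_ ?_ (hdvd _)) (hdvd _)
  · refine hco _ _ fun k hk h => one_ne_sigma hp hs hms hF hα hk (k' := 0) (l := l) (by omega) ?_
    rw [← h]; simp
  · refine hco _ _ fun k hk h => ?_
    obtain ⟨k', hk', h'⟩ := conj_bar_mod hp hs hms hF hα k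
    refine bar_ne_sigma hp hs hms hl hls hF hα hk' (k' := 0) (by omega) ?_
    rw [← h', ← h]; simp
  · refine hco _ _ fun k hk h => one_ne_bar hp hs hms hF hα hk (k' := 0) (by omega) ?_
    rw [← h]; simp
  · rw [hα1]; exact hdvd 1

/-- The words of the Kasami code are trace words. -/
theorem mem_kasamiCode_iff (c : Fin (p ^ m - 1) → ZMod p) :
    c ∈ kasamiCode p m s l α ↔ ∃ a b d : F, a ^ p ^ s = a ∧ ∀ i,
      algebraMap (ZMod p) F (c i) =
        absTrace p s (a * (α⁻¹ ^ (i : ℕ)) ^ (p ^ s + 1)) +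
        absTrace p m (b * (α⁻¹ ^ (i : ℕ)) ^ (p ^ l + 1) + d * α⁻¹ ^ (i : ℕ)) := by
  have hm : 0 < m := by omega
  have hn : 0 < p ^ m - 1 := pow_sub_one_pos p hm
  have hα0 : α ≠ 0 := hα.ne_zero hn.ne'
  change c ∈ parityCheckCyclicCode (p ^ m - 1) (parityPoly p s l α) ↔ _
  rw [mem_parityCheck_iff hn hα parityPoly_monic (parityPoly_dvd hp hs hms hl hls hF hα)]
  have hterm : ∀ (e : ℕ) (A : F) (i k : ℕ), A ^ p ^ k * ((α ^ e) ^ p ^ k)⁻¹ ^ i =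
      (A * (α⁻¹ ^ i) ^ e) ^ p ^ k := by
    intro e A i k
    rw [mul_pow]; congr 1
    simp only [inv_pow, ← pow_mul]
    congr 2; ring
  constructor
  · intro h
    -- The Fourier coefficients of the word are supported on the roots of the parity-check
    -- polynomial: three disjoint Frobenius orbits, of sizes `m`, `s` and `m`.
    set T1 := (Finset.range m).image fun k => α ^ p ^ k with hT1
    set T2 := (Finset.range s).image fun k => (α ^ (p ^ s + 1)) ^ p ^ k with hT2
    set T3 := (Finset.range m).image fun k => (α ^ (p ^ l + 1)) ^ p ^ k with hT3
    have hT : ∀ x, x ∈ T1 ∪ (T2 ∪ T3) ↔ aeval x (parityPoly p s l α) = 0 := by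
      intro x
      rw [root_parityPoly_iff hp hs hms hF hα]
      simp only [hT1, hT2, hT3, Finset.mem_union, Finset.mem_image, Finset.mem_range,
        @eq_comm _ x]
    have hd23 : Disjoint T2 T3 := by
      rw [Finset.disjoint_left]
      simp only [hT2, hT3, Finset.mem_image, Finset.mem_range]
      rintro _ ⟨k, hk, rfl⟩ ⟨k', hk', h'⟩
      exact bar_ne_sigma hp hs hms hl hls hF hα hk hk' h'.symm
    have hd1 : Disjoint T1 (T2 ∪ T3) := by
      rw [Finset.disjoint_left]
      simp only [hT1, hT2, hT3, Finset.mem_union, Finset.mem_image, Finset.mem_range]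
      rintro _ ⟨k, hk, rfl⟩ (⟨k', hk', h'⟩ | ⟨k', hk', h'⟩)
      · exact one_ne_bar hp hs hms hF hα hk hk' h'.symm
      · exact one_ne_sigma hp hs hms hF hα hk hk' h'.symm
    have hroot0 : ∀ x ∈ T1 ∪ (T2 ∪ T3), x ≠ 0 := by
      intro x hx
      simp only [hT1, hT2, hT3, Finset.mem_union, Finset.mem_image, Finset.mem_range] at hx
      rcases hx with ⟨k, hk, rfl⟩ | ⟨k, hk, rfl⟩ | ⟨k, hk, rfl⟩
      · exact pow_ne_zero _ hα0
      · exact pow_ne_zero _ (pow_ne_zero _ hα0)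
      · exact pow_ne_zero _ (pow_ne_zero _ hα0)
    have hsum : ∀ i : Fin (p ^ m - 1), algebraMap (ZMod p) F (c i) =
        -∑ x ∈ T1 ∪ (T2 ∪ T3), aeval x (wordPoly c) * x⁻¹ ^ (i : ℕ) := by
      intro i
      rw [word_eq_sum hm hF hα]
      congr 1
      symm
      refine Finset.sum_subset (fun x hx => by simpa using hroot0 x hx) fun x hx hxT => ?_
      have hx0 : x ≠ 0 := by simpa using hx
      rw [h x _ ((hT x).not.mp hxT), zero_mul]
      rw [← hF]; exact FiniteField.pow_card_sub_one_eq_one x hx0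
    -- The parameters are the Fourier coefficients at one root of each orbit, negated because of the
    -- sign in `word_eq_sum`. The coefficients at conjugate roots are Frobenius powers of these
    -- (`aeval_pow_pow`), so each orbit sums to a trace.
    refine ⟨-aeval (α ^ (p ^ s + 1)) (wordPoly c), -aeval (α ^ (p ^ l + 1)) (wordPoly c),
      -aeval α (wordPoly c), ?_, fun i => ?_⟩
    · rw [← frob_apply, map_neg, frob_apply, ← aeval_pow_pow, ← pow_mul,
        show (p ^ s + 1) * p ^ s = p ^ m + p ^ s by rw [hms]; ring, pow_add, pow_card_pow hF,
        ← pow_succ']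
    · rw [hsum, Finset.sum_union hd1, Finset.sum_union hd23, hT1, hT2, hT3, Finset.sum_image,
        Finset.sum_image, Finset.sum_image]
      · simp only [aeval_pow_pow, hterm]
        have h1 : ∀ k, aeval α (wordPoly c) ^ p ^ k * (α ^ p ^ k)⁻¹ ^ (i : ℕ) =
            (aeval α (wordPoly c) * α⁻¹ ^ (i : ℕ)) ^ p ^ k := by
          intro k
          have := hterm 1 (aeval α (wordPoly c)) i k
          simpa only [pow_one] using this
        simp only [neg_mul, absTrace_neg, absTrace_add]
        simp only [absTrace, h1]
        abel
      · intro k hk k' hk' h'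
        exact sigma_inj hp hs hms hl hls hF hα (Finset.mem_range.mp hk) (Finset.mem_range.mp hk') h'
      · intro k hk k' hk' h'
        exact bar_inj hp hs hms hF hα (Finset.mem_range.mp hk) (Finset.mem_range.mp hk') h'
      · intro k hk k' hk' h'
        exact one_inj hp hs hms hF hα (Finset.mem_range.mp hk) (Finset.mem_range.mp hk') h'
  · rintro ⟨a, b, d, -, h⟩ x hx hroot
    rw [aeval_wordPoly]
    have hx0 : x ≠ 0 := by rintro rfl; rw [zero_pow hn.ne'] at hx; exact zero_ne_one hx
    -- The `k`-th term of a trace has the single frequency `(α ^ e) ^ p ^ k`; at any other root of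
    -- unity its transform is a vanishing geometric sum.
    have hzero : ∀ (e : ℕ) (A : F) (k : ℕ), x ≠ (α ^ e) ^ p ^ k →
        ∑ i : Fin (p ^ m - 1), (A * (α⁻¹ ^ (i : ℕ)) ^ e) ^ p ^ k * x ^ (i : ℕ) = 0 := by
      intro e A k hxe
      have hβ0 : (α ^ e) ^ p ^ k ≠ 0 := pow_ne_zero _ (pow_ne_zero _ hα0)
      have h1 : ∀ i : Fin (p ^ m - 1), (A * (α⁻¹ ^ (i : ℕ)) ^ e) ^ p ^ k * x ^ (i : ℕ) =
          A ^ p ^ k * (x / (α ^ e) ^ p ^ k) ^ (i : ℕ) := by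
        intro i
        rw [← hterm, mul_assoc, ← mul_pow, div_eq_mul_inv, mul_comm x]
      rw [Finset.sum_congr rfl fun i _ => h1 i, ← Finset.mul_sum, sum_pow_eq_zero, mul_zero]
      · have h2 : ((α ^ e) ^ p ^ k) ^ (p ^ m - 1) = (α ^ (p ^ m - 1)) ^ (e * p ^ k) := by
          rw [← pow_mul, ← pow_mul, ← pow_mul]; congr 1; ring
        rw [div_pow, hx, h2, hα.pow_eq_one, one_pow, div_one]
      · rw [Ne, div_eq_one_iff_eq hβ0]; exact hxe
    have hnot := (root_parityPoly_iff hp hs hms hF hα x (l := l)).not.mp hroot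
    push Not at hnot
    obtain ⟨n1, n2, n3⟩ := hnot
    simp only [h, absTrace_add, add_mul, Finset.sum_add_distrib]
    simp only [absTrace, Finset.sum_mul]
    rw [Finset.sum_comm, Finset.sum_eq_zero (s := Finset.range s), zero_add, Finset.sum_comm,
      Finset.sum_eq_zero (s := Finset.range m), zero_add, Finset.sum_comm,
      Finset.sum_eq_zero (s := Finset.range m)]
    · intro k hk
      have := hzero 1 d k (by rw [pow_one]; exact n1 k (Finset.mem_range.mp hk))
      simpa only [pow_one] using this
    · intro k hk
      exact hzero _ b k (n3 k (Finset.mem_range.mp hk))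
    · intro k hk
      exact hzero _ a k (n2 k (Finset.mem_range.mp hk))

omit hp hs hms hl hls in
lemma coordPoint_castSucc (i : Fin (p ^ m - 1)) :
    coordPoint (p ^ m - 1) α i.castSucc = α⁻¹ ^ (i : ℕ) := by
  simp [coordPoint]

omit hp hs hms hl hls hF hα in
lemma coordPoint_last : coordPoint (p ^ m - 1) α (Fin.last _) = 0 := by
  simp [coordPoint]

/-- The codewords of the dual of the extended dual of the Kasami code. -/
theorem mem_dualExtDual_iff (v : Fin (p ^ m - 1 + 1) → ZMod p) :
    v ∈ dualExtDualKasamiCode p m s l α ↔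
      ∃ a b c : F, ∃ h : ZMod p, a ^ p ^ s = a ∧
        ∀ i, algebraMap (ZMod p) F (v i) =
          absTrace p s (a * coordPoint (p ^ m - 1) α i ^ (p ^ s + 1)) +
          absTrace p m (b * coordPoint (p ^ m - 1) α i ^ (p ^ l + 1) +
            c * coordPoint (p ^ m - 1) α i) +
          algebraMap (ZMod p) F h := by
  rw [dualExtDualKasamiCode, dual_extended_dual, mem_augmentedCode,
    mem_kasamiCode_iff hp hs hms hl hls hF hα]
  constructor
  · rintro ⟨a, b, c, ha, h⟩
    -- The constant is the value at the last coordinate, whose label is `0`, where every trace term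
    -- vanishes.
    refine ⟨a, b, c, v (Fin.last _), ha, fun i => ?_⟩
    refine Fin.lastCases ?_ (fun i => ?_) i
    · rw [coordPoint_last]
      simp [absTrace_zero]
    · rw [coordPoint_castSucc hF hα, ← h i, map_sub]; ring
  · rintro ⟨a, b, c, h, ha, hv⟩
    refine ⟨a, b, c, ha, fun i => ?_⟩
    have h1 := hv (Fin.last _)
    rw [coordPoint_last] at h1
    simp only [zero_pow (Nat.succ_ne_zero _), mul_zero, add_zero, absTrace_zero, zero_add] at h1
    have h2 := hv i.castSucc
    rw [coordPoint_castSucc hF hα] at h2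
    rw [map_sub, h1, h2]; ring

omit hp hs hl hls in
lemma coordPoint_bijective (hm : 0 < m) :
    Function.Bijective (coordPoint (p ^ m - 1) α) := by
  have hn : 0 < p ^ m - 1 := pow_sub_one_pos p hm
  rw [Fintype.bijective_iff_surjective_and_card]
  constructor
  · intro x
    by_cases hx : x = 0
    · exact ⟨Fin.last _, by rw [coordPoint_last, hx]⟩
    · obtain ⟨j, hj, hj'⟩ := exists_pow_eq hF hα hm (inv_ne_zero hx)
      refine ⟨(⟨j, hj⟩ : Fin (p ^ m - 1)).castSucc, ?_⟩
      rw [coordPoint_castSucc hF hα, inv_pow, hj', inv_inv]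
  · rw [Fintype.card_fin, hF]; omega

end

end Kasami

namespace Kasami

variable {p : ℕ} [Fact p.Prime] {F : Type*} [Field F] [Algebra (ZMod p) F]

/-! ### The parametrisation of the code is injective -/

lemma linearIndependent_algEquiv {ι : Type*} (φ : ι → (F ≃ₐ[ZMod p] F))
    (hφ : Function.Injective φ) : LinearIndependent F (fun i => (φ i : F → F)) := by
  refine (linearIndependent_monoidHom F F).comp (fun i => ((φ i : F →* F))) fun i j h => hφ ?_
  ext x
  exact DFunLike.congr_fun h x

/-- The radical equation is a linear relation between the automorphisms `σ ∘ bar`, `σ ∘ σ` and `1`,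
which are independent when distinct (Dedekind). For `σ = 1` the last two coincide and a relation
between `bar` and `1` remains. -/
lemma radical_univ {σ bar : F ≃ₐ[ZMod p] F} (hp : p ≠ 2) (hbar : ∀ x, bar (bar x) = x)
    (hne : ∃ x, σ x ≠ bar x) (hσ : σ = 1 ∨ ∃ x, σ (σ x) ≠ x) {a b : F}
    (h : ∀ x, σ (2 * a * bar x + b * σ x) + b * x = 0) : a = 0 ∧ b = 0 := by
  have h2 := two_ne_zero_field (p := p) (F := F) hp
  obtain ⟨z, hz⟩ := hne
  rcases hσ with rfl | ⟨y, hy⟩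
  · have hli := linearIndependent_algEquiv (p := p) (F := F) ![bar, 1] (by
      intro i j hij
      fin_cases i <;> fin_cases j <;> first | rfl | skip
      · exact absurd (DFunLike.congr_fun hij z).symm hz
      · exact absurd (DFunLike.congr_fun hij z) hz)
    rw [Fintype.linearIndependent_iff] at hli
    have := hli ![2 * a, 2 * b] (by
      ext x
      have := h x
      simp only [AlgEquiv.one_apply] at this
      simp [Fin.sum_univ_two]
      linear_combination this)
    have e0 := this 0
    have e1 := this 1
    simp only [Matrix.cons_val_zero, Matrix.cons_val_one, mul_eq_zero, h2, false_or] at e0 e1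
    exact ⟨e0, e1⟩
  · have hli := linearIndependent_algEquiv (p := p) (F := F) ![bar.trans σ, σ.trans σ, 1] (by
      have n1 : bar.trans σ ≠ σ.trans σ := fun e => by
        have := DFunLike.congr_fun e z
        exact hz (σ.injective this).symm
      have n2 : bar.trans σ ≠ 1 := fun e => by
        have := DFunLike.congr_fun e (bar z)
        simp only [AlgEquiv.trans_apply, hbar, AlgEquiv.one_apply] at this
        exact hz this
      have n3 : σ.trans σ ≠ 1 := fun e => hy (DFunLike.congr_fun e y)
      intro i j hij
      fin_cases i <;> fin_cases j <;> first | rfl | skip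
      · exact absurd hij n1
      · exact absurd hij n2
      · exact absurd hij n1.symm
      · exact absurd hij n3
      · exact absurd hij n2.symm
      · exact absurd hij n3.symm)
    rw [Fintype.linearIndependent_iff] at hli
    have := hli ![σ (2 * a), σ b, b] (by
      ext x
      have := h x
      simp only [map_add, map_mul] at this
      simp [Fin.sum_univ_three]
      linear_combination this)
    have e0 := this 0
    have e2 := this 2
    simp only [Matrix.cons_val_zero, map_eq_zero_iff σ σ.injective, mul_eq_zero, h2, false_or] at e0
    exact ⟨e0, e2⟩

/-- The word of the form `Tr (a x bar(x) + b x σ(x) + c x) + h`. -/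
noncomputable def formWord {ι : Type*} (σ bar : F ≃ₐ[ZMod p] F) (x : ι → F)
    (P : (fixed bar × F) × (F × ZMod p)) (i : ι) : ZMod p :=
  kasamiForm σ bar P.1.1 P.1.2 (x i) + Algebra.trace (ZMod p) F (P.2.1 * x i) + P.2.2

/-- For a difference of two equal words, evaluation at `0` gives the constant, the polar form gives
both coefficients of the quadratic part, and nondegeneracy of the trace form gives the linear part.
-/
lemma formWord_injective [Finite F] {ι : Type*} {σ bar : F ≃ₐ[ZMod p] F} (hp : p ≠ 2)
    (hbar : ∀ x, bar (bar x) = x) (hne : ∃ x, σ x ≠ bar x) (hσ : σ = 1 ∨ ∃ x, σ (σ x) ≠ x)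
    {x : ι → F} (hx : Function.Surjective x) : Function.Injective (formWord σ bar x) := by
  rintro ⟨⟨⟨a, ha⟩, b⟩, c, h⟩ ⟨⟨⟨a', ha'⟩, b'⟩, c', h'⟩ heq
  rw [mem_fixed] at ha ha'
  have hsub : bar (a - a') = a - a' := by rw [map_sub, ha, ha']
  have h1 : ∀ z, kasamiForm σ bar (a - a') (b - b') z +
      Algebra.trace (ZMod p) F ((c - c') * z) + (h - h') = 0 := by
    intro z
    obtain ⟨i, rfl⟩ := hx z
    have := congrFun heq i
    simp only [formWord, kasamiForm_apply] at this
    simp only [kasamiForm_apply, sub_mul, map_add, map_sub] at this ⊢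
    linear_combination this
  have hh : h - h' = 0 := by simpa using h1 0
  have hpol : ∀ z y, QuadraticMap.polar (kasamiForm σ bar (a - a') (b - b')) z y = 0 := by
    intro z y
    have e1 := h1 (z + y)
    have e2 := h1 z
    have e3 := h1 y
    rw [mul_add, map_add (Algebra.trace (ZMod p) F)] at e1
    rw [QuadraticMap.polar]
    linear_combination e1 - e2 - e3 + hh
  obtain ⟨ha0, hb0⟩ := radical_univ hp hbar hne hσ
    (fun z => (polar_eq_zero_iff hbar hsub (b - b') z).mp (hpol z))
  have hc : c - c' = 0 := by
    refine eq_zero_of_trace_mul (p := p) fun z => ?_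
    have := h1 z
    rw [ha0, hb0, hh, kasamiForm_apply] at this
    simpa using this
  rw [sub_eq_zero] at ha0 hb0 hc hh
  subst ha0 hb0 hc hh
  rfl

section
variable [Fintype F] [DecidableEq F]

lemma hammingNorm_formWord {ι : Type*} [Fintype ι] {σ bar : F ≃ₐ[ZMod p] F} {x : ι → F}
    (hx : Function.Bijective x) (P : (fixed bar × F) × (F × ZMod p)) :
    hammingNorm (formWord σ bar x P) =
      Fintype.card F - zeroCount (kasamiForm σ bar P.1.1 P.1.2) P.2.1 P.2.2 := by
  have h1 : zeroCount (kasamiForm σ bar P.1.1 P.1.2) P.2.1 P.2.2 + hammingNorm (formWord σ bar x P)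
      = Fintype.card F := by
    have h2 : hammingNorm (formWord σ bar x P) = (Finset.univ.filter fun z : F =>
        ¬ (kasamiForm σ bar P.1.1 P.1.2 z + Algebra.trace (ZMod p) F (P.2.1 * z) + P.2.2 = 0)).card := by
      rw [hammingNorm]
      refine Finset.card_bij (fun i _ => x i) ?_ ?_ ?_
      · intro i hi
        exact Finset.mem_filter.mpr ⟨Finset.mem_univ _, (Finset.mem_filter.mp hi).2⟩
      · intro i _ j _ h; exact hx.1 h
      · intro z hz
        obtain ⟨i, rfl⟩ := hx.2 z
        exact ⟨i, Finset.mem_filter.mpr ⟨Finset.mem_univ _, (Finset.mem_filter.mp hz).2⟩, rfl⟩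
    rw [h2, zeroCount, Finset.card_filter_add_card_filter_not, Finset.card_univ]
  omega

lemma weightCount_eq_sum {N : ℕ} {D : Submodule (ZMod p) (Fin N → ZMod p)}
    {σ bar : F ≃ₐ[ZMod p] F} {x : Fin N → F} (hx : Function.Bijective x)
    (hinj : Function.Injective (formWord σ bar x))
    (hD : ∀ v, v ∈ D ↔ ∃ P, formWord σ bar x P = v) (w : ℕ) :
    weightCount D w = ∑ P : fixed bar × F, formCount (kasamiForm σ bar P.1 P.2) w := by
  classical
  have h1 : {c : Fin N → ZMod p | c ∈ D ∧ hammingNorm c = w} = formWord σ bar x ''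
      ↑(Finset.univ.filter fun P : (fixed bar × F) × (F × ZMod p) =>
        Fintype.card F - zeroCount (kasamiForm σ bar P.1.1 P.1.2) P.2.1 P.2.2 = w) := by
    ext v
    simp only [Set.mem_ofPred_eq, hD, Set.mem_image, Finset.coe_filter, Finset.mem_univ, true_and]
    constructor
    · rintro ⟨⟨P, rfl⟩, h⟩
      exact ⟨P, by rwa [hammingNorm_formWord hx] at h, rfl⟩
    · rintro ⟨P, h, rfl⟩
      exact ⟨⟨P, rfl⟩, by rwa [hammingNorm_formWord hx]⟩
  rw [weightCount, h1, Set.ncard_image_of_injective _ hinj, Set.ncard_coe_finset]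
  simp only [formCount, Finset.card_filter, Fintype.sum_prod_type]

lemma natCard_eq {N : ℕ} {D : Submodule (ZMod p) (Fin N → ZMod p)}
    {σ bar : F ≃ₐ[ZMod p] F} {x : Fin N → F} (hinj : Function.Injective (formWord σ bar x))
    (hD : ∀ v, v ∈ D ↔ ∃ P, formWord σ bar x P = v) :
    Nat.card D = Fintype.card (fixed bar) * Fintype.card F * (Fintype.card F * p) := by
  have h1 : (D : Set (Fin N → ZMod p)) = Set.range (formWord σ bar x) := by
    ext v; exact hD v
  have h2 : Nat.card D = Nat.card (Set.range (formWord σ bar x)) := by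
    rw [← h1]; rfl
  rw [h2, Nat.card_congr (Equiv.ofInjective _ hinj).symm, Nat.card_eq_fintype_card,
    Fintype.card_prod, Fintype.card_prod, Fintype.card_prod, ZMod.card]

variable {m s l : ℕ} (hF : Fintype.card F = p ^ m)
include hF

lemma algebraMap_trace (x : F) : algebraMap (ZMod p) F (Algebra.trace (ZMod p) F x) =
    absTrace p m x := by
  rw [FiniteField.algebraMap_trace_eq_sum_pow, finrank_eq_of_card hF, Nat.card_zmod, absTrace]

/-- This is the source of the factor `2` between the coefficient `a` of a codeword and the first
coefficient of the corresponding `kasamiForm`. -/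
lemma absTrace_two_mul (hms : m = 2 * s) {e : F} (he : e ^ p ^ s = e) :
    absTrace p m e = absTrace p s (2 * e) := by
  rw [two_mul, absTrace_add, absTrace, absTrace, hms, two_mul, Finset.sum_range_add]
  congr 1
  refine Finset.sum_congr rfl fun i _ => ?_
  rw [pow_add, pow_mul, he]

lemma algebraMap_formWord {ι : Type*} (hms : m = 2 * s) (x : ι → F)
    (P : (fixed (frob p F s) × F) × (F × ZMod p)) (i : ι) :
    algebraMap (ZMod p) F (formWord (frob p F l) (frob p F s) x P i) =
      absTrace p s (2 * P.1.1 * x i ^ (p ^ s + 1)) +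
      absTrace p m (P.1.2 * x i ^ (p ^ l + 1) + P.2.1 * x i) + algebraMap (ZMod p) F P.2.2 := by
  have ha : (P.1.1 : F) ^ p ^ s = P.1.1 := by rw [← frob_apply, fixed_apply]
  have he : (P.1.1 * x i ^ (p ^ s + 1)) ^ p ^ s = P.1.1 * x i ^ (p ^ s + 1) := by
    rw [mul_pow, ha, ← pow_mul, add_mul, one_mul, ← pow_add, ← two_mul, ← hms, pow_add,
      pow_card_pow hF, ← pow_succ']
  simp only [formWord, kasamiForm_apply, map_add, algebraMap_trace hF, frob_apply, ← pow_succ',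
    absTrace_add, mul_assoc]
  rw [absTrace_two_mul hF hms he]
  ring

lemma mem_dualExtDual_iff_formWord (hp : 2 < p) (hs : 2 ≤ s) (hms : m = 2 * s) (hl : l < m)
    (hls : l ≠ s) {α : F} (hα : IsPrimitiveRoot α (p ^ m - 1))
    (v : Fin (p ^ m - 1 + 1) → ZMod p) :
    v ∈ dualExtDualKasamiCode p m s l α ↔
      ∃ P, formWord (frob p F l) (frob p F s) (coordPoint (p ^ m - 1) α) P = v := by
  have h2 := two_ne_zero_field (p := p) (F := F) (by omega)
  rw [mem_dualExtDual_iff hp hs hms hl hls hF hα]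
  constructor
  · rintro ⟨a, b, c, h, ha, hv⟩
    refine ⟨((⟨a / 2, by rw [mem_fixed, map_div₀, map_ofNat, frob_apply, ha]⟩, b), (c, h)), ?_⟩
    funext i
    apply (algebraMap (ZMod p) F).injective
    rw [hv, algebraMap_formWord hF hms, mul_div_cancel₀ _ h2]
  · rintro ⟨P, rfl⟩
    refine ⟨2 * P.1.1, P.1.2, P.2.1, P.2.2, ?_, fun i => algebraMap_formWord hF hms _ P i⟩
    rw [← frob_apply, map_mul, map_ofNat, fixed_apply]

lemma formWord_coordPoint_injective (hp : 2 < p) (hs : 2 ≤ s) (hms : m = 2 * s) (hl : l < m)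
    (hls : l ≠ s) {α : F} (hα : IsPrimitiveRoot α (p ^ m - 1)) :
    Function.Injective (formWord (frob p F l) (frob p F s) (coordPoint (p ^ m - 1) α)) := by
  refine formWord_injective (by omega) (frob_frob_self hF hms) ⟨α, ?_⟩ ?_
    (coordPoint_bijective hms hF hα (by omega)).2
  · rw [frob_apply, frob_apply]
    exact fun h => hls (one_inj hp hs hms hF hα hl (by omega) h)
  -- The square of `σ` is the identity only if `m ∣ 2 l`, that is for `l = 0` or the excluded value
  -- `l = s`.
  · rcases Nat.eq_zero_or_pos l with rfl | hl0
    · left; ext x; simp [frob_apply]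
    · right
      refine ⟨α, ?_⟩
      rw [frob_apply, frob_apply, ← pow_mul, ← pow_add]
      intro h
      rcases lt_or_ge (l + l) m with h' | h'
      · have := one_inj hp hs hms hF hα h' (k' := 0) (by omega) (by simpa using h)
        omega
      · have h3 : α ^ p ^ (l + l) = α ^ p ^ (l + l - m) := by
          rw [show l + l = m + (l + l - m) by omega, pow_add, pow_mul, pow_card_pow hF]
          simp
        have := one_inj hp hs hms hF hα (k := l + l - m) (by omega) (k' := 0) (by omega)
          (by simpa [← h3] using h)
        omega

theorem weightCount_dualExtDual (hp : 2 < p) (hs : 2 ≤ s) (hms : m = 2 * s) (hl : l < m)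
    (hls : l ≠ s) {α : F} (hα : IsPrimitiveRoot α (p ^ m - 1)) (w : ℕ) :
    weightCount (dualExtDualKasamiCode p m s l α) w =
      ∑ P : fixed (frob p F s) × F, formCount (kasamiForm (frob p F l) (frob p F s) P.1 P.2) w :=
  weightCount_eq_sum (coordPoint_bijective hms hF hα (by omega))
    (formWord_coordPoint_injective hF hp hs hms hl hls hα)
    (mem_dualExtDual_iff_formWord hF hp hs hms hl hls hα) w

theorem finrank_dualExtDual (hp : 2 < p) (hs : 2 ≤ s) (hms : m = 2 * s) (hl : l < m)
    (hls : l ≠ s) {α : F} (hα : IsPrimitiveRoot α (p ^ m - 1)) :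
    Module.finrank (ZMod p) (dualExtDualKasamiCode p m s l α) = 5 * m / 2 + 1 := by
  have h := natCard_eq (formWord_coordPoint_injective hF hp hs hms hl hls hα)
    (mem_dualExtDual_iff_formWord hF hp hs hms hl hls hα)
  rw [Module.natCard_eq_pow_finrank (K := ZMod p), Nat.card_zmod, hF,
    card_fixed_bar hF hα (by omega) hms, ← pow_succ, ← pow_add, ← pow_add] at h
  have := Nat.pow_right_injective (Fact.out : p.Prime).two_le h
  omega

end

end Kasami

namespace Kasami

variable {p : ℕ} [Fact p.Prime]

/-! ### Tables of weights -/

/-- In this form a table is a combination of indicators, so rows with coinciding weights merge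
without a separate discussion. -/
lemma sum_filter_eq_sum_wtInd (T : List (ℤ × ℚ)) (w : ℕ) :
    ((T.filter fun r => r.1 = (w : ℤ)).map Prod.snd).sum =
      (T.map fun r => r.2 * wtInd w r.1).sum := by
  induction T with
  | nil => simp
  | cons r T ih =>
    by_cases h : r.1 = (w : ℤ)
    · rw [List.filter_cons_of_pos (by simpa using h)]
      simp only [List.map_cons, List.sum_cons, ih, wtInd, if_pos h, mul_one]
    · rw [List.filter_cons_of_neg (by simpa using h)]
      simp only [List.map_cons, List.sum_cons, ih, wtInd, if_neg h, mul_zero, zero_add]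

lemma numWeights_le {N : ℕ} {D : Submodule (ZMod p) (Fin N → ZMod p)} {r : ℤ × ℚ}
    {T : List (ℤ × ℚ)} (h : HasWeightDistribution D (r :: T)) (hr : r.1 = 0) :
    numWeights D ≤ T.length := by
  classical
  have hsub : {w : ℕ | 1 ≤ w ∧ w ≤ N ∧ weightCount D w ≠ 0} ⊆
      ↑((T.map fun r => r.1.toNat).toFinset) := by
    rintro w ⟨hw1, -, hw⟩
    have h1 := h w
    by_contra hcon
    apply hw
    have h2 : (r :: T).filter (fun r => r.1 = (w : ℤ)) = [] := by
      rw [List.filter_eq_nil_iff]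
      intro x hx
      rcases List.mem_cons.mp hx with rfl | hx
      · rw [hr]; simp; omega
      · simp only [decide_eq_true_eq]
        intro hxw
        apply hcon
        simp only [List.coe_toFinset, List.mem_map, Set.mem_ofPred_eq]
        exact ⟨x, hx, by rw [hxw, Int.toNat_natCast]⟩
    rw [h2] at h1
    simpa using h1
  calc numWeights D ≤ (T.map fun r => r.1.toNat).toFinset.card := by
        rw [numWeights, ← Set.ncard_coe_finset]
        exact Set.ncard_le_ncard hsub (Finset.finite_toSet _)
    _ ≤ (T.map fun r => r.1.toNat).length := List.toFinset_card_le _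
    _ = T.length := List.length_map _

/-! ### Word counts of a class of forms -/

variable {F : Type*} [Field F] [Algebra (ZMod p) F] [Fintype F] [DecidableEq F]

variable {σ bar : F ≃ₐ[ZMod p] F} (hp : p ≠ 2) (hbar : ∀ x, bar (bar x) = x)
  {n : ℕ} (hn : 0 < n) (hF : Fintype.card F = p ^ n) {k : ℕ} (S : Finset (fixed bar × F))
  (hS : ∀ P ∈ S, radCard σ bar P.1 P.2 = p ^ k)

variable (p) in
/-- The word counts of a form of even rank `n - k` and sign `e`, up to words of generic weight;
`h = (n + k) / 2`. -/
def signCount (n h : ℕ) (e : ℤ) (w : ℕ) : ℚ :=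
  wtInd w (p ^ n - p ^ (n - 1) - e * (p - 1) * p ^ (h - 1)) +
    (p - 1) * wtInd w (p ^ n - p ^ (n - 1) + e * p ^ (h - 1))

include hp hbar hn hF hS

/-- The number `t` is the sum of the signs over `S`, so the two signs occur `(S.card + t) / 2` and
`(S.card - t) / 2` times. -/
lemma sum_formCount_even {r : ℕ} (hnk : n = k + 2 * r) (hkr : 0 < k + r) {t : ℚ}
    (ht : ∑ P ∈ S, expSum σ bar P.1 P.2 = t * p ^ (k + r)) (w : ℕ) :
    ∑ P ∈ S, (formCount (kasamiForm σ bar P.1 P.2) w : ℚ) =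
      S.card * (p * (p ^ n - p ^ (n - k))) * wtInd w (p ^ n - p ^ (n - 1)) +
      p ^ (n - k) * ((S.card + t) / 2 * signCount p n (k + r) 1 w +
        (S.card - t) / 2 * signCount p n (k + r) (-1) w) := by
  have h1 : ∀ P : fixed bar × F, ∃ e : ℤ, P ∈ S → expSum σ bar P.1 P.2 = e * p ^ (k + r) ∧
      (formCount (kasamiForm σ bar P.1 P.2) w : ℚ) =
        p * (p ^ n - p ^ (n - k)) * wtInd w (p ^ n - p ^ (n - 1)) +
        p ^ (n - k) * ((1 + e) / 2 * signCount p n (k + r) 1 w +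
          (1 - e) / 2 * signCount p n (k + r) (-1) w) := by
    intro P
    by_cases hP : P ∈ S
    · obtain ⟨e, he, hsum, -, hcount⟩ :=
        formCount_even hp hbar hn hF (fixed_apply P.1) (hS P hP) hnk hkr
      refine ⟨e, fun _ => ⟨hsum, ?_⟩⟩
      rw [hcount]
      rcases he with rfl | rfl <;> simp only [signCount] <;> push_cast <;> ring
    · exact ⟨0, fun h => absurd h hP⟩
  choose e he using h1
  have h2 : ∑ P ∈ S, (e P : ℚ) = t := by
    have h3 : (p : ℂ) ^ (k + r) ≠ 0 := pow_ne_zero _ (Nat.cast_ne_zero.mpr (Fact.out : p.Prime).ne_zero)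
    have h4 : ((∑ P ∈ S, (e P : ℚ) : ℚ) : ℂ) = (t : ℂ) := by
      apply mul_right_cancel₀ h3
      rw [← ht]
      push_cast
      rw [Finset.sum_mul]
      exact Finset.sum_congr rfl fun P hP => ((he P hP).1).symm
    exact_mod_cast h4
  rw [Finset.sum_congr rfl fun P hP => (he P hP).2, Finset.sum_add_distrib, Finset.sum_const,
    nsmul_eq_mul, ← Finset.mul_sum, Finset.sum_add_distrib, ← Finset.sum_mul, ← Finset.sum_mul,
    ← Finset.sum_div, ← Finset.sum_div, Finset.sum_add_distrib, Finset.sum_sub_distrib, h2]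
  simp only [Finset.sum_const, nsmul_eq_mul, mul_one]
  ring

lemma sum_formCount_odd {r : ℕ} (hnk : n = k + (2 * r + 1)) (w : ℕ) :
    ∑ P ∈ S, (formCount (kasamiForm σ bar P.1 P.2) w : ℚ) =
      S.card * (p * (p ^ n - p ^ (n - k)) * wtInd w (p ^ n - p ^ (n - 1)) +
        p ^ (n - k) * (wtInd w (p ^ n - p ^ (n - 1)) +
          (p - 1) / 2 * (wtInd w (p ^ n - p ^ (n - 1) + p ^ (k + r)) +
            wtInd w (p ^ n - p ^ (n - 1) - p ^ (k + r))))) := by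
  rw [Finset.sum_eq_card_nsmul fun P hP => ?_, nsmul_eq_mul]
  exact formCount_odd hp hbar hn hF (fixed_apply P.1) (hS P hP) hnk w

omit hp hbar hn hF hS in
/-- The sum over all forms, split according to the size of the radical. -/
lemma sum_split {M : Type*} [AddCommMonoid M] (f : fixed bar × F → M) {c : ℕ} (hc : 1 < c)
    (h : ∀ P : fixed bar × F, P ≠ 0 → radCard σ bar P.1 P.2 = 1 ∨ radCard σ bar P.1 P.2 = c ∨
      radCard σ bar P.1 P.2 = c ^ 2) :
    ∑ P, f P = f 0 +
      (∑ P ∈ Finset.univ.filter (fun P : fixed bar × F => P ≠ 0 ∧ radCard σ bar P.1 P.2 = 1), f P +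
      (∑ P ∈ Finset.univ.filter (fun P : fixed bar × F => P ≠ 0 ∧ radCard σ bar P.1 P.2 = c), f P +
      ∑ P ∈ Finset.univ.filter
        (fun P : fixed bar × F => P ≠ 0 ∧ radCard σ bar P.1 P.2 = c ^ 2), f P)) := by
  have hcc : c < c ^ 2 := by nlinarith
  rw [← Finset.add_sum_erase _ _ (Finset.mem_univ (0 : fixed bar × F)), ← Finset.sum_union,
    ← Finset.sum_union]
  · congr 2
    ext P
    simp only [Finset.mem_erase, Finset.mem_univ, and_true, Finset.mem_union,
      Finset.mem_filter_univ, ← and_or_left]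
    exact ⟨fun hP => ⟨hP, h P hP⟩, fun hP => hP.1⟩
  · rw [Finset.disjoint_left]
    intro P
    simp only [Finset.mem_union, Finset.mem_filter_univ]
    omega
  · rw [Finset.disjoint_left]
    intro P
    simp only [Finset.mem_filter_univ]
    omega

omit hp hbar hn hF hS in
lemma ne_zero_iff_not (P : fixed bar × F) : P ≠ 0 ↔ ¬ ((P.1 : F) = 0 ∧ P.2 = 0) := by
  rw [Ne, Prod.ext_iff]; simp

omit hS in
-- The words of the zero form are the affine functions: the zero word, the nonzero constants of full
-- weight, and the nonconstant ones of generic weight.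
lemma formCount_zero (w : ℕ) : (formCount (kasamiForm σ bar 0 0) w : ℚ) =
    p * (p ^ n - 1) * wtInd w (p ^ n - p ^ (n - 1)) + wtInd w 0 + (p - 1) * wtInd w (p ^ n) := by
  have h1 : expSum σ bar 0 0 = p ^ n := by
    simp [expSum, hF, Finset.card_univ]
  have h2 : radCard σ bar 0 0 = p ^ n := by
    simp [radCard, hF, Finset.card_univ]
  obtain ⟨e, -, hsum, -, hcount⟩ := formCount_even hp hbar hn hF (a := 0) (b := 0) (by simp) h2
    (r := 0) rfl hn
  have he : e = 1 := by
    have h3 : (p : ℂ) ^ n ≠ 0 := pow_ne_zero _ (Nat.cast_ne_zero.mpr (Fact.out : p.Prime).ne_zero)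
    rw [h1, add_zero] at hsum
    have h4 := mul_right_cancel₀ h3 ((one_mul _).trans hsum)
    exact_mod_cast h4.symm
  obtain ⟨n, rfl⟩ := Nat.exists_eq_add_of_lt hn
  rw [hcount, he]
  simp only [zero_add, add_zero, Nat.add_sub_cancel, Nat.sub_self, pow_zero, one_mul]
  rw [show (p : ℤ) ^ (n + 1) - p ^ n - (p - 1) * p ^ n = 0 by ring,
    show (p : ℤ) ^ (n + 1) - p ^ n + p ^ n = p ^ (n + 1) by ring]
  ring

end Kasami

/-! ### The case `d' = d`: sizes and exponential sums of the classes of forms. -/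

namespace Kasami

variable {p : ℕ} [Fact p.Prime] {F : Type*} [Field F] [Algebra (ZMod p) F]
variable [Fintype F] [DecidableEq F]

variable (p F) in
/-- The nonzero parameters whose form has a radical with `c` elements. -/
noncomputable def radClass (s l c : ℕ) : Finset (fixed (frob p F s) × F) :=
  Finset.univ.filter fun P => P ≠ 0 ∧ radCard (frob p F l) (frob p F s) P.1 P.2 = c

lemma radCard_of_mem {s l c : ℕ} {P : fixed (frob p F s) × F} (h : P ∈ radClass p F s l c) :
    radCard (frob p F l) (frob p F s) P.1 P.2 = c := (Finset.mem_filter.mp h).2.2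

lemma ne_zero_of_mem {s l c : ℕ} {P : fixed (frob p F s) × F} (h : P ∈ radClass p F s l c) :
    P ≠ 0 := (Finset.mem_filter.mp h).2.1

section
variable {m s l d : ℕ} (hp : 2 < p) (hs : 2 ≤ s) (hms : m = 2 * s)
  (hF : Fintype.card F = p ^ m) {α : F} (hα : IsPrimitiveRoot α (p ^ m - 1))
  (hd : d = Nat.gcd s l) (hd' : d = Nat.gcd (s + l) (2 * l))

include hp hs hms hF hα hd hd'

/-- The sums attached to the classes of forms when `gcd (s + l, 2 l) = gcd (s, l)`. -/
lemma classes_single :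
    (∀ P : fixed (frob p F s) × F, P ≠ 0 →
      radCard (frob p F l) (frob p F s) P.1 P.2 = 1 ∨
      radCard (frob p F l) (frob p F s) P.1 P.2 = p ^ d ∨
      radCard (frob p F l) (frob p F s) P.1 P.2 = (p ^ d) ^ 2) ∧
    ((radClass p F s l (p ^ d)).card : ℚ) = (p ^ m - 1) * p ^ s / p ^ d ∧
    ((radClass p F s l ((p ^ d) ^ 2)).card : ℚ) =
      (p ^ m - 1) * (p ^ s - p ^ d) / (p ^ d * (p ^ (2 * d) - 1)) ∧
    ((radClass p F s l 1).card : ℚ) = p ^ (3 * s) - 1 - (radClass p F s l (p ^ d)).card -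
      (radClass p F s l ((p ^ d) ^ 2)).card ∧
    ∑ P ∈ radClass p F s l (p ^ d), expSum (frob p F l) (frob p F s) P.1 P.2 = 0 ∧
    ∑ P ∈ radClass p F s l ((p ^ d) ^ 2), expSum (frob p F l) (frob p F s) P.1 P.2 =
      -(radClass p F s l ((p ^ d) ^ 2)).card * (p ^ s * p ^ d) ∧
    ∑ P ∈ radClass p F s l 1, expSum (frob p F l) (frob p F s) P.1 P.2 =
      p ^ (3 * s) - p ^ m + (radClass p F s l ((p ^ d) ^ 2)).card * (p ^ s * p ^ d) := by
  have hm : 0 < m := by omega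
  have hd0 : 0 < d := hd ▸ Nat.gcd_pos_of_pos_left _ (by omega)
  have hp2 : p ≠ 2 := by omega
  have hbar := frob_frob_self (p := p) hF hms
  have hcomm : ∀ x, frob p F l (frob p F s x) = frob p F s (frob p F l x) := frob_comm l s
  -- The hypothesis `d' = d` gives `d' ∣ s`, which places the fixed field of the twist inside that
  -- of `frob p F s`.
  have hK : ∀ y, frob p F l (frob p F s y) = y → frob p F s y = y := by
    intro y hy
    rw [frob_apply]
    exact pow_pow_of_dvd (hd ▸ Nat.gcd_dvd_left s l) (pow_of_twist hF hms hd' hy)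
  have hE := card_fixed_bar hF hα hm hms
  have hKc := card_fixed_twist hF hα hm hms hd'
  have hN : ∀ e, frob p F s e = e → e ≠ 0 →
      (Finset.univ.filter fun w => w * frob p F s w = e).card =
        Fintype.card (fixed (frob p F s)) + 1 := by
    intro e he he0
    rw [hE]; exact card_norm_fiber hF hα (by omega) hms he he0
  have hq : Fintype.card F = Fintype.card (fixed (frob p F s)) ^ 2 := by
    rw [hE, hF, hms, mul_comm 2, pow_mul]
  have hy1 : 1 < p ^ d := Nat.one_lt_pow hd0.ne' (by omega)
  have hK1 : 1 < Fintype.card (fixed (twist (frob p F l) (frob p F s))) := by rwa [hKc]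
  have hyQ : (1 : ℚ) < p ^ d := by exact_mod_cast hy1
  have hcases : ∀ P : fixed (frob p F s) × F, P ≠ 0 → _ := fun P hP =>
    radCard_cases hp2 hbar hcomm hK hN hq (fixed_apply P.1) ((ne_zero_iff_not P).mp hP)
  have hsq := card_radCard_sq hp2 hbar hcomm hK hN hq hK1
  have heq := card_radCard_eq hp2 hbar hcomm hK hN hq hK1
  have hsum1 := sum_expSum_radCard_eq hp2 hbar hcomm hK hN hq hK1
  have hall := sum_expSum (p := p) (σ := frob p F l) (bar := frob p F s)
  rw [hKc] at hsq heq hsum1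
  simp only [hKc] at hcases
  rw [hE, hF] at hsq heq hall
  have hcl : ∀ c, Finset.univ.filter (fun P : fixed (frob p F s) × F => P ≠ 0 ∧
    radCard (frob p F l) (frob p F s) P.1 P.2 = c) = radClass p F s l c := fun c => rfl
  rw [hcl] at hsq heq hsum1
  have htri : ∀ P : fixed (frob p F s) × F, P ≠ 0 →
      radCard (frob p F l) (frob p F s) P.1 P.2 = 1 ∨
      radCard (frob p F l) (frob p F s) P.1 P.2 = p ^ d ∨
      radCard (frob p F l) (frob p F s) P.1 P.2 = (p ^ d) ^ 2 := by
    intro P hP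
    rcases hcases P hP with h | h | h
    · exact Or.inl h
    · exact Or.inr (Or.inl h)
    · exact Or.inr (Or.inr h.1)
  have hsum2 : ∑ P ∈ radClass p F s l ((p ^ d) ^ 2), expSum (frob p F l) (frob p F s) P.1 P.2 =
      -(radClass p F s l ((p ^ d) ^ 2)).card * (p ^ s * p ^ d) := by
    rw [Finset.sum_eq_card_nsmul (b := -((p : ℂ) ^ s * p ^ d)), nsmul_eq_mul]
    · ring
    · intro P hP
      have h1 := radCard_of_mem hP
      rcases hcases P (ne_zero_of_mem hP) with h | h | h
      · exfalso; rw [h] at h1; nlinarith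
      · exfalso; rw [h] at h1; nlinarith
      · rw [h.2, hE]; push_cast; rfl
  -- The nondegenerate class is found by subtraction, from the number of all forms and from the
  -- total of all exponential sums.
  have hcard := sum_split (σ := frob p F l) (bar := frob p F s) (fun _ => (1 : ℚ)) hy1 htri
  simp only [hcl, Finset.sum_const, nsmul_eq_mul, mul_one, Finset.card_univ, Fintype.card_prod, hE,
    hF] at hcard
  have hsplit := sum_split (σ := frob p F l) (bar := frob p F s)
    (fun P => expSum (frob p F l) (frob p F s) P.1 P.2) hy1 htri
  simp only [hcl] at hsplit
  rw [hall, hsum1, hsum2] at hsplit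
  have hzero : expSum (frob p F l) (frob p F s) ((0 : fixed (frob p F s) × F).1 : F)
      (0 : fixed (frob p F s) × F).2 = p ^ m := by
    simp [expSum, hF, Finset.card_univ]
  rw [hzero] at hsplit
  refine ⟨htri, ?_, ?_, ?_, hsum1, hsum2, ?_⟩
  · have h1 : (p ^ d : ℚ) * (p ^ d - 1) * (radClass p F s l (p ^ d)).card =
        (p ^ m - 1) * (p ^ s * p ^ d - p ^ s) := by
      have : (((p ^ d : ℚ) * (p ^ d - 1) * (radClass p F s l (p ^ d)).card : ℚ) : ℂ) =
        (((p ^ m - 1) * (p ^ s * p ^ d - p ^ s) : ℚ) : ℂ) := by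
        push_cast at heq ⊢; exact heq
      exact_mod_cast this
    have h2 : (p ^ d : ℚ) - 1 ≠ 0 := by linarith
    rw [eq_div_iff (by positivity)]
    apply mul_left_cancel₀ h2
    linear_combination h1
  · have h1 : (p ^ d : ℚ) * ((p ^ d) ^ 2 - 1) * (radClass p F s l ((p ^ d) ^ 2)).card =
        (p ^ m - 1) * (p ^ s - p ^ d) := by
      have : (((p ^ d : ℚ) * ((p ^ d) ^ 2 - 1) * (radClass p F s l ((p ^ d) ^ 2)).card : ℚ) : ℂ) =
        (((p ^ m - 1) * (p ^ s - p ^ d) : ℚ) : ℂ) := by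
        push_cast at hsq ⊢; exact hsq
      exact_mod_cast this
    have h2 : ((p : ℚ) ^ d) ^ 2 - 1 ≠ 0 := by nlinarith
    have h3 : (p : ℚ) ^ (2 * d) = (p ^ d) ^ 2 := by rw [mul_comm, pow_mul]
    rw [h3, eq_div_iff (by positivity)]
    linear_combination h1
  · have h3 : (p : ℚ) ^ (3 * s) = p ^ s * p ^ m := by rw [hms, ← pow_add]; congr 1; ring
    rw [h3]
    push_cast at hcard
    linear_combination -hcard
  · have h3 : (p : ℂ) ^ (3 * s) = p ^ s * p ^ m := by rw [hms, ← pow_add]; congr 1; ring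
    rw [h3]
    push_cast at hsplit
    linear_combination -hsplit

end

end Kasami

namespace Kasami

variable {p : ℕ} [Fact p.Prime]

/-! ### Weights and multiplicities -/

lemma generic_weight {M : ℕ} (hM : 0 < M) : (p : ℤ) ^ M - p ^ (M - 1) = p ^ (M - 1) * (p - 1) := by
  obtain ⟨M, rfl⟩ := Nat.exists_eq_add_of_lt hM
  simp only [zero_add, Nat.add_sub_cancel]; ring

lemma signCount_one {M h g : ℕ} (hM : M = h + g) (hh : 0 < h) (w : ℕ) :
    signCount p M h 1 w = wtInd w (p ^ (h - 1) * (p - 1) * (p ^ g - 1)) +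
      (p - 1) * wtInd w (p ^ (h - 1) * (p ^ (g + 1) - p ^ g + 1)) := by
  obtain ⟨h, rfl⟩ := Nat.exists_eq_add_of_lt hh
  rw [signCount, hM, show 0 + h + 1 + g - 1 = h + g by omega, show 0 + h + 1 - 1 = h by omega]
  congr 2
  · ring_nf
  · congr 1; ring

lemma signCount_neg_one {M h g : ℕ} (hM : M = h + g) (hh : 0 < h) (w : ℕ) :
    signCount p M h (-1) w = wtInd w (p ^ (h - 1) * (p - 1) * (p ^ g + 1)) +
      (p - 1) * wtInd w (p ^ (h - 1) * (p ^ (g + 1) - p ^ g - 1)) := by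
  obtain ⟨h, rfl⟩ := Nat.exists_eq_add_of_lt hh
  rw [signCount, hM, show 0 + h + 1 + g - 1 = h + g by omega, show 0 + h + 1 - 1 = h by omega]
  congr 2
  · ring_nf
  · congr 1; ring

section
variable {x y N0 N1 N2 t : ℚ} (hx : 0 < x) (hy : 1 < y) (h1 : N1 = (x ^ 2 - 1) * x / y)
  (h2 : N2 = (x ^ 2 - 1) * (x - y) / (y * (y ^ 2 - 1))) (h0 : N0 = x ^ 3 - 1 - N1 - N2)
  (ht : t = x ^ 2 - x + N2 * y)
include hx hy h1 h2 h0 ht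

/-- With `x = p ^ s` and `y = p ^ d`, `t` is the sum of the signs over the nondegenerate forms, so
this and `count_sub` count those of sign `1` and `-1`. -/
lemma count_add : (N0 + t) / 2 = 1 / 2 * y * (x + 1) * (x ^ 2 - 1) / (y + 1) := by
  have hy1 : y - 1 ≠ 0 := by linarith
  have hy2 : y + 1 ≠ 0 := by linarith
  have hy0 : y ≠ 0 := by linarith
  have e : y ^ 2 - 1 = (y - 1) * (y + 1) := by ring
  rw [ht, h0, h1, h2, e]
  field_simp
  ring

lemma count_sub : (N0 - t) / 2 = y * (x ^ 2 - 2 * (x ^ 2 / y) + 1) * (x - 1) / (2 * (y - 1)) := by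
  have hy1 : y - 1 ≠ 0 := by linarith
  have hy2 : y + 1 ≠ 0 := by linarith
  have hy0 : y ≠ 0 := by linarith
  have e : y ^ 2 - 1 = (y - 1) * (y + 1) := by ring
  rw [ht, h0, h1, h2, e]
  field_simp
  ring

end

lemma pow_sub_eq_div {a b : ℕ} (h : b ≤ a) : (p : ℚ) ^ (a - b) = p ^ a / p ^ b := by
  rw [pow_sub₀ _ (Nat.cast_ne_zero.mpr (Fact.out : p.Prime).ne_zero) h, div_eq_mul_inv]

variable {F : Type*} [Field F] [Algebra (ZMod p) F] [Fintype F] [DecidableEq F]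

/-- The class with radical of size `p ^ d` is left unevaluated: its rank `m - d` has the parity of
`d`, and this is where the tables for even and odd `d` diverge. -/
lemma weightCount_single {m s l d : ℕ} (hp : 2 < p) (hs : 2 ≤ s) (hms : m = 2 * s)
    (hF : Fintype.card F = p ^ m) {α : F} (hα : IsPrimitiveRoot α (p ^ m - 1)) (hl : l < m)
    (hls : l ≠ s) (hd : d = Nat.gcd s l) (hd' : d = Nat.gcd (s + l) (2 * l)) (w : ℕ) :
    (weightCount (dualExtDualKasamiCode p m s l α) w : ℚ) =
      p * (p ^ m - 1) * wtInd w (p ^ (m - 1) * (p - 1)) + wtInd w 0 + (p - 1) * wtInd w (p ^ m) +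
      p ^ m * (1 / 2 * p ^ d * (p ^ s + 1) * (p ^ m - 1) / (p ^ d + 1) * signCount p m s 1 w +
        p ^ d * (p ^ m - 2 * p ^ (m - d) + 1) * (p ^ s - 1) / (2 * (p ^ d - 1)) *
          signCount p m s (-1) w) +
      ∑ P ∈ radClass p F s l (p ^ d),
        (formCount (kasamiForm (frob p F l) (frob p F s) P.1 P.2) w : ℚ) +
      (p ^ (s - d) - 1) * (p ^ m - 1) / (p ^ (2 * d) - 1) *
        (p * (p ^ m - p ^ (m - 2 * d)) * wtInd w (p ^ (m - 1) * (p - 1)) +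
          p ^ (m - 2 * d) * signCount p m (s + d) (-1) w) := by
  have hm : 0 < m := by omega
  have hd0 : 0 < d := hd ▸ Nat.gcd_pos_of_pos_left _ (by omega)
  have hds : d ≤ s := Nat.le_of_dvd (by omega) (hd ▸ Nat.gcd_dvd_left s l)
  have hp2 : p ≠ 2 := by omega
  have hbar := frob_frob_self (p := p) hF hms
  have hp0 : (p : ℂ) ≠ 0 := Nat.cast_ne_zero.mpr (by omega)
  obtain ⟨htri, hN1, hN2, hN0, hT1, hT2, hT0⟩ := classes_single hp hs hms hF hα hd hd'
  have hxy : (p : ℚ) ^ (2 * d) = (p ^ d) ^ 2 := by rw [mul_comm, pow_mul]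
  have hx2 : (p : ℚ) ^ m = (p ^ s) ^ 2 := by rw [hms, mul_comm, pow_mul]
  have hx3 : (p : ℚ) ^ (3 * s) = (p ^ s) ^ 3 := by rw [mul_comm, pow_mul]
  have hy1 : (1 : ℚ) < p ^ d := by
    exact_mod_cast (Nat.one_lt_pow hd0.ne' (by omega) : 1 < p ^ d)
  have hx0 : (0 : ℚ) < p ^ s := by
    have : (0 : ℚ) < p := by exact_mod_cast (by omega : 0 < p)
    positivity
  have e2 : (radClass p F s l ((p ^ d) ^ 2)).card = (p ^ (s - d) - 1) * (p ^ m - 1) /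
      ((p : ℚ) ^ (2 * d) - 1) := by
    have : (p : ℚ) ^ (2 * d) - 1 ≠ 0 := by rw [hxy]; nlinarith
    rw [hN2, pow_sub_eq_div hds]
    field_simp
  -- All forms of this class have sign `-1`, hence the value of `t`.
  have hS2 := sum_formCount_even hp2 hbar hm hF (radClass p F s l ((p ^ d) ^ 2)) (k := 2 * d)
    (fun P hP => (radCard_of_mem hP).trans (by rw [mul_comm, pow_mul])) (r := s - d)
    (by omega) (by omega) (t := -(radClass p F s l ((p ^ d) ^ 2)).card) (by
      rw [hT2, show 2 * d + (s - d) = s + d by omega]; push_cast; ring) w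
  have hS0 := sum_formCount_even hp2 hbar hm hF (radClass p F s l 1) (k := 0)
    (fun P hP => (radCard_of_mem hP).trans (pow_zero p).symm) (r := s)
    (by omega) (by omega) (t := (p ^ s) ^ 2 - p ^ s + (radClass p F s l ((p ^ d) ^ 2)).card * p ^ d)
    (by
      rw [hT0, mul_comm 3, pow_mul, hms, mul_comm 2 s, pow_mul]; push_cast; ring) w
  rw [hx2, hxy] at hN2
  rw [hx2] at hN1
  rw [hx3] at hN0
  rw [count_add hx0 hy1 hN1 hN2 hN0 rfl, count_sub hx0 hy1 hN1 hN2 hN0 rfl] at hS0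
  rw [show 2 * d + (s - d) = s + d by omega, add_neg_cancel, sub_neg_eq_add, add_self_div_two,
    e2, generic_weight hm] at hS2
  rw [weightCount_dualExtDual hF hp hs hms hl hls hα, Nat.cast_sum,
    sum_split (σ := frob p F l) (bar := frob p F s)
      (fun P => (formCount (kasamiForm (frob p F l) (frob p F s) P.1 P.2) w : ℚ))
      (Nat.one_lt_pow hd0.ne' (by omega)) htri]
  have hcl : ∀ c, Finset.univ.filter (fun P : fixed (frob p F s) × F => P ≠ 0 ∧
    radCard (frob p F l) (frob p F s) P.1 P.2 = c) = radClass p F s l c := fun c => rfl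
  have hz : (formCount (kasamiForm (frob p F l) (frob p F s)
      ((0 : fixed (frob p F s) × F).1 : F) (0 : fixed (frob p F s) × F).2) w : ℚ) = _ :=
    formCount_zero hp2 hbar hm hF w
  rw [hcl, hcl, hcl, hS0, hS2, hz, generic_weight hm]
  simp only [Nat.sub_zero, sub_self, mul_zero, zero_mul, zero_add, zero_div]
  rw [pow_sub_eq_div (a := m) (b := d) (by omega), hx2]
  ring

end Kasami

/-! ### The case `d' = d`: the tables for even and odd `d`. -/

namespace Kasami

variable {p : ℕ} [Fact p.Prime]
variable {F : Type*} [Field F] [Algebra (ZMod p) F] [Fintype F] [DecidableEq F]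

section
variable {m s l d : ℕ} (hp : 2 < p) (hs : 2 ≤ s) (hms : m = 2 * s)
    (hF : Fintype.card F = p ^ m) {α : F} (hα : IsPrimitiveRoot α (p ^ m - 1)) (hl : l < m)
    (hls : l ≠ s) (hd : d = Nat.gcd s l)
include hp hs hms hF hα hl hls hd

theorem weightDistribution_even (hd' : d = Nat.gcd (s + l) (2 * l)) (he : Even d) :
    HasWeightDistribution (dualExtDualKasamiCode p m s l α) (tableEven p m s d) := by
  intro w
  have hm : 0 < m := by omega
  have hd0 : 0 < d := hd ▸ Nat.gcd_pos_of_pos_left _ (by omega)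
  have hds : d ≤ s := Nat.le_of_dvd (by omega) (hd ▸ Nat.gcd_dvd_left s l)
  have hp2 : p ≠ 2 := by omega
  have hbar := frob_frob_self (p := p) hF hms
  obtain ⟨-, hN1, -, -, hT1, -, -⟩ := classes_single hp hs hms hF hα hd hd'
  obtain ⟨c, hc⟩ := he
  have hc2 : d / 2 = c := by omega
  have hpQ : (0 : ℚ) < p := by exact_mod_cast (by omega : 0 < p)
  have hx2 : (p : ℚ) ^ m = (p ^ s) ^ 2 := by rw [hms, mul_comm, pow_mul]
  have hx3 : (p : ℚ) ^ (3 * s) = (p ^ s) ^ 3 := by rw [mul_comm, pow_mul]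
  have hy2 : (p : ℚ) ^ (2 * d) = (p ^ d) ^ 2 := by rw [mul_comm, pow_mul]
  have hy3 : (p : ℚ) ^ (3 * d) = (p ^ d) ^ 3 := by rw [mul_comm, pow_mul]
  have hy1 : (1 : ℚ) < p ^ d := by
    exact_mod_cast (Nat.one_lt_pow hd0.ne' (by omega) : 1 < p ^ d)
  have hx0 : (0 : ℚ) < p ^ s := by positivity
  -- The signs in the middle class cancel, hence `t = 0` and the equal multiplicities of the paired
  -- rows.
  have hS1 := sum_formCount_even hp2 hbar hm hF (radClass p F s l (p ^ d)) (k := d)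
    (fun P hP => radCard_of_mem hP) (r := s - c) (by omega) (by omega) (t := 0)
    (by rw [hT1]; push_cast; ring) w
  rw [show d + (s - c) = s + c by omega, add_zero, sub_zero, hN1, generic_weight hm,
    signCount_one (g := s - c) (by omega) (by omega),
    signCount_neg_one (g := s - c) (by omega) (by omega)] at hS1
  rw [sum_filter_eq_sum_wtInd, weightCount_single hp hs hms hF hα hl hls hd hd', hS1,
    signCount_one (g := s) (by omega) (by omega), signCount_neg_one (g := s) (by omega) (by omega),
    signCount_neg_one (g := s - d) (by omega) (by omega)]
  simp only [tableEven, List.map_cons, List.map_nil, List.sum_cons, List.sum_nil, hc2]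
  rw [pow_sub_eq_div (a := 3 * s) (b := d) (by omega),
    pow_sub_eq_div (a := 3 * s) (b := 2 * d) (by omega),
    pow_sub_eq_div (a := 3 * s) (b := 3 * d) (by omega),
    pow_sub_eq_div (a := m) (b := d) (by omega), pow_sub_eq_div (a := m) (b := 2 * d) (by omega),
    pow_sub_eq_div (a := s) (b := d) (by omega), pow_add _ m d, hx2, hx3, hy2, hy3]
  have hy0 : (p : ℚ) ^ d ≠ 0 := by positivity
  have hya : (p : ℚ) ^ d - 1 ≠ 0 := by linarith
  have hyb : (p : ℚ) ^ d + 1 ≠ 0 := by linarith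
  have hyc : ((p : ℚ) ^ d) ^ 2 - 1 = (p ^ d - 1) * (p ^ d + 1) := by ring
  rw [hyc]
  -- With the indicators as independent symbols, what remains is a rational identity in `x = p ^ s`,
  -- `y = p ^ d` and `p`.
  generalize (p : ℚ) ^ s = x at *
  generalize (p : ℚ) ^ d = y at *
  generalize wtInd w _ = W0
  generalize wtInd w _ = W1
  generalize wtInd w _ = W2
  generalize wtInd w _ = W3
  generalize wtInd w _ = W4
  generalize wtInd w _ = W5
  generalize wtInd w _ = W6
  generalize wtInd w _ = W7
  generalize wtInd w _ = W8
  generalize wtInd w _ = W9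
  generalize wtInd w _ = W10
  generalize wtInd w _ = W11
  generalize wtInd w _ = W12
  field_simp
  ring

theorem weightDistribution_odd (hd' : d = Nat.gcd (s + l) (2 * l)) (ho : Odd d) :
    HasWeightDistribution (dualExtDualKasamiCode p m s l α) (tableOdd p m s d) := by
  intro w
  have hm : 0 < m := by omega
  have hd0 : 0 < d := hd ▸ Nat.gcd_pos_of_pos_left _ (by omega)
  have hds : d ≤ s := Nat.le_of_dvd (by omega) (hd ▸ Nat.gcd_dvd_left s l)
  have hp2 : p ≠ 2 := by omega
  have hbar := frob_frob_self (p := p) hF hms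
  obtain ⟨-, hN1, -, -, -, -, -⟩ := classes_single hp hs hms hF hα hd hd'
  obtain ⟨c, hc⟩ := ho
  have hc2 : (d - 1) / 2 = c := by omega
  have hpQ : (0 : ℚ) < p := by exact_mod_cast (by omega : 0 < p)
  have hx2 : (p : ℚ) ^ m = (p ^ s) ^ 2 := by rw [hms, mul_comm, pow_mul]
  have hx3 : (p : ℚ) ^ (3 * s) = (p ^ s) ^ 3 := by rw [mul_comm, pow_mul]
  have hy2 : (p : ℚ) ^ (2 * d) = (p ^ d) ^ 2 := by rw [mul_comm, pow_mul]
  have hy3 : (p : ℚ) ^ (3 * d) = (p ^ d) ^ 3 := by rw [mul_comm, pow_mul]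
  have hy1 : (1 : ℚ) < p ^ d := by
    exact_mod_cast (Nat.one_lt_pow hd0.ne' (by omega) : 1 < p ^ d)
  have hx0 : (0 : ℚ) < p ^ s := by positivity
  have hS1 := sum_formCount_odd hp2 hbar hm hF (radClass p F s l (p ^ d)) (k := d)
    (fun P hP => radCard_of_mem hP) (r := s - (c + 1)) (by omega) w
  rw [show d + (s - (c + 1)) = s + c by omega, hN1, generic_weight hm] at hS1
  rw [sum_filter_eq_sum_wtInd, weightCount_single hp hs hms hF hα hl hls hd hd', hS1]
  have hW : ∀ h g, m = h + g → 0 < h → (p : ℤ) ^ (m - 1) = p ^ (h - 1) * p ^ g := by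
    intro h g hm hh
    rw [← pow_add]; congr 1; omega
  simp only [tableOdd, signCount, generic_weight hm, List.map_cons, List.map_nil, List.sum_cons,
    List.sum_nil, hc2]
  rw [show (p : ℤ) ^ (m - 1) * (p - 1) - 1 * (p - 1) * p ^ (s - 1) =
      (p - 1) * (p ^ (m - 1) - p ^ (s - 1)) by ring,
    show (p : ℤ) ^ (m - 1) * (p - 1) - -1 * (p - 1) * p ^ (s - 1) =
      (p - 1) * (p ^ (m - 1) + p ^ (s - 1)) by ring,
    show (p : ℤ) ^ (m - 1) * (p - 1) + 1 * p ^ (s - 1) =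
      p ^ (m - 1) * (p - 1) + p ^ (s - 1) by ring,
    show (p : ℤ) ^ (m - 1) * (p - 1) + -1 * p ^ (s - 1) =
      p ^ (m - 1) * (p - 1) - p ^ (s - 1) by ring,
    show (p : ℤ) ^ (m - 1) * (p - 1) + -1 * p ^ (s + d - 1) =
      p ^ (m - 1) * (p - 1) - p ^ (s + d - 1) by ring,
    show (p : ℤ) ^ (m - 1) * (p - 1) - -1 * (p - 1) * p ^ (s + d - 1) =
      p ^ (s + d - 1) * (p - 1) * (p ^ (s - d) + 1) by
        rw [hW (s + d) (s - d) (by omega) (by omega)]; ring]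
  -- The sign `(-1) ^ ((p - 1) / 2)` only interchanges two rows of equal multiplicity.
  have hsign : wtInd w (p ^ (m - 1) * (p - 1) + (-1) ^ ((p - 1) / 2) * p ^ (s + c)) +
      wtInd w (p ^ (m - 1) * (p - 1) - (-1) ^ ((p - 1) / 2) * p ^ (s + c)) =
      wtInd w (p ^ (m - 1) * (p - 1) + p ^ (s + c)) +
      wtInd w (p ^ (m - 1) * (p - 1) - p ^ (s + c)) := by
    rcases neg_one_pow_eq_or ℤ ((p - 1) / 2) with h | h <;> rw [h]
    · simp only [one_mul]
    · simp only [neg_one_mul, sub_neg_eq_add, ← sub_eq_add_neg]; ring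
  rw [pow_sub_eq_div (a := 3 * s - 2 * d) (b := 1) (by omega),
    pow_sub_eq_div (a := 3 * s) (b := d) (by omega),
    pow_sub_eq_div (a := 3 * s) (b := 2 * d) (by omega),
    pow_sub_eq_div (a := 3 * s) (b := 3 * d) (by omega),
    pow_sub_eq_div (a := m) (b := d) (by omega), pow_sub_eq_div (a := m) (b := 2 * d) (by omega),
    pow_sub_eq_div (a := s) (b := d) (by omega), pow_add _ m d, hx2, hx3, hy2, hy3, pow_one]
  have hy0 : (p : ℚ) ^ d ≠ 0 := by positivity
  have hya : (p : ℚ) ^ d - 1 ≠ 0 := by linarith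
  have hyb : (p : ℚ) ^ d + 1 ≠ 0 := by linarith
  have hyc : ((p : ℚ) ^ d) ^ 2 - 1 = (p ^ d - 1) * (p ^ d + 1) := by ring
  rw [hyc]
  generalize (p : ℚ) ^ s = x at *
  generalize (p : ℚ) ^ d = y at *
  generalize wtInd w (p ^ (m - 1) * (p - 1) + (-1) ^ ((p - 1) / 2) * p ^ (s + c)) = V1 at *
  generalize wtInd w (p ^ (m - 1) * (p - 1) - (-1) ^ ((p - 1) / 2) * p ^ (s + c)) = V2 at *
  generalize wtInd w (p ^ (m - 1) * (p - 1) + p ^ (s + c)) = V3 at *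
  obtain rfl : V3 = V1 + V2 - wtInd w (p ^ (m - 1) * (p - 1) - p ^ (s + c)) := by
    rw [hsign]; ring
  generalize wtInd w _ = W0
  generalize wtInd w _ = W1
  generalize wtInd w _ = W2
  generalize wtInd w _ = W3
  generalize wtInd w _ = W4
  generalize wtInd w _ = W5
  generalize wtInd w _ = W6
  generalize wtInd w _ = W7
  generalize wtInd w _ = W8
  generalize wtInd w _ = W9
  field_simp
  ring

end

end Kasami

/-! ### The case `d' = 2 d`: signs of the exponential sums and the linear system for the class
sizes. -/

namespace Kasami

variable {p : ℕ} [Fact p.Prime]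

lemma pow_mul_modEq (d a : ℕ) : (p : ℤ) ^ (d * a) ≡ (-1) ^ a [ZMOD (p ^ d + 1 : ℕ)] := by
  rw [pow_mul]
  refine Int.ModEq.pow a ?_
  rw [Int.modEq_iff_dvd]
  exact ⟨-1, by push_cast; ring⟩

lemma eq_neg_of_dvd_add {e c : ℤ} {D : ℕ} (he : e = 1 ∨ e = -1) (hc : c = 1 ∨ c = -1) (hD : 2 < D)
    (h : (D : ℤ) ∣ 1 - e * c) : e = c := by
  rcases he with rfl | rfl <;> rcases hc with rfl | rfl <;> first | rfl | skip
  all_goals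
    have := Int.le_of_dvd (by norm_num) h
    norm_num at this
    omega

variable {F : Type*} [Field F] [Algebra (ZMod p) F] [Fintype F] [DecidableEq F]

section
variable {m s l d : ℕ} (hp : 2 < p) (hs : 2 ≤ s) (hms : m = 2 * s)
    (hF : Fintype.card F = p ^ m) {α : F} (hα : IsPrimitiveRoot α (p ^ m - 1)) (hl : l < m)
    (hls : l ≠ s) (hd : d = Nat.gcd s l) (hd' : 2 * d = Nat.gcd (s + l) (2 * l))
include hp hs hms hF hα hd hd'

/-- Multiplication by a `(p ^ d + 1)`-th root of unity preserves the form, so `p ^ d + 1` divides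
the size of the fibre over `1`, and hence `p ^ m - e p ^ (s + d a)` for the sign `e`. Since `p ^ d ≡
-1` and `s / d` is odd, this number is congruent to `1 - e (-1) ^ (a + 1)`; the modulus exceeds `2`,
so `e = (-1) ^ (a + 1)`. -/
lemma expSum_double {P : fixed (frob p F s) × F} {a r : ℕ}
    (hP : P ∈ radClass p F s l (p ^ (2 * d * a))) (hr : s = d * a + r) :
    expSum (frob p F l) (frob p F s) P.1 P.2 = (-1) ^ (a + 1) * (p ^ s * p ^ (d * a)) := by
  have hm : 0 < m := by omega
  have hp2 : p ≠ 2 := by omega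
  have hd0 : 0 < d := hd ▸ Nat.gcd_pos_of_pos_left _ (by omega)
  obtain ⟨i, j, hsi, hlj⟩ := odd_of_gcd_eq (by omega) hd hd'
  have hbar := frob_frob_self (p := p) hF hms
  obtain ⟨e, he, hsum, hcard, -⟩ := formCount_even hp2 hbar hm hF (fixed_apply P.1)
    (radCard_of_mem hP) (r := r) (by rw [hms, hr]; ring) (by
      rw [show 2 * d * a + r = s + d * a by rw [hr]; ring]; omega)
  rw [show 2 * d * a + r = s + d * a by rw [hr]; ring] at hsum hcard
  have hDm : p ^ d + 1 ∣ p ^ m - 1 := by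
    have h1 : p ^ d + 1 ∣ p ^ s + 1 := by
      have := Odd.nat_add_dvd_pow_add_pow (p ^ d) 1 (n := 2 * i + 1) ⟨i, rfl⟩
      rwa [one_pow, ← pow_mul, ← hsi] at this
    refine h1.trans ⟨p ^ s - 1, ?_⟩
    rw [hms, mul_comm 2 s, pow_mul, ← Nat.sq_sub_sq, one_pow]
  obtain ⟨ζ, hζ⟩ := exists_primitiveRoot (F := F) hα hm hDm
  have hdvd := dvd_card_fiber hζ (Nat.succ_pos _)
    (fun x => kasamiForm (frob p F l) (frob p F s) P.1 P.2 x) (t := 1) (by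
      intro μ x hμ
      obtain ⟨h1, h2⟩ := (isometry_iff hF hms hd' hsi hlj μ).mpr hμ
      simp only [kasamiForm_apply, map_mul]
      congr 1
      linear_combination (P.1 * (x * frob p F s x)) * h1 + (P.2 * (x * frob p F l x)) * h2)
    (by simp)
  have h1 : ((p ^ d + 1 : ℕ) : ℤ) ∣ p ^ m - e * p ^ (s + d * a) := by
    rw [← hcard 1 one_ne_zero]
    exact Dvd.dvd.mul_left (Int.natCast_dvd_natCast.mpr hdvd) _
  have h2 : (p : ℤ) ^ m - e * p ^ (s + d * a) ≡ 1 - e * (-1) ^ (a + 1)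
      [ZMOD (p ^ d + 1 : ℕ)] := by
    refine Int.ModEq.sub ?_ (Int.ModEq.mul_left _ ?_)
    · have := pow_mul_modEq (p := p) d (2 * (2 * i + 1))
      rw [pow_mul (-1 : ℤ), neg_one_sq, one_pow] at this
      rwa [hms, hsi, show 2 * (d * (2 * i + 1)) = d * (2 * (2 * i + 1)) by ring]
    · have := pow_mul_modEq (p := p) d (2 * i + 1 + a)
      rw [show 2 * i + 1 + a = 2 * i + (a + 1) by ring, pow_add (-1 : ℤ), pow_mul (-1 : ℤ),
        neg_one_sq, one_pow, one_mul] at this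
      rwa [hsi, show d * (2 * i + 1) + d * a = d * (2 * i + (a + 1)) by ring]
  have h3 : ((p ^ d + 1 : ℕ) : ℤ) ∣ 1 - e * (-1) ^ (a + 1) := h2.dvd_iff.mp h1
  have hD : 2 < p ^ d + 1 := by
    have : p ^ 1 ≤ p ^ d := Nat.pow_le_pow_right (by omega) hd0
    rw [pow_one] at this
    omega
  have h4 := eq_neg_of_dvd_add he (neg_one_pow_eq_or ℤ (a + 1)) hD h3
  rw [hsum, h4, pow_add]; push_cast; ring

include hl hls

/-- As `s / d` is odd, only `s = d` has to be excluded; then `l < 2 s` and `l / d` odd would give `l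
= s`. The bound makes truncated differences such as `3 * s - 5 * d` and `m - 4 * d` genuine. -/
lemma three_mul_le : 3 * d ≤ s := by
  obtain ⟨i, j, hsi, hlj⟩ := odd_of_gcd_eq (by omega) hd hd'
  rcases Nat.eq_zero_or_pos i with rfl | hi
  · exfalso
    rcases Nat.eq_zero_or_pos j with rfl | hj
    · omega
    · have : d * 3 ≤ d * (2 * j + 1) := Nat.mul_le_mul_left _ (by omega)
      omega
  · have : d * 3 ≤ d * (2 * i + 1) := Nat.mul_le_mul_left _ (by omega)
    omega

/-- The classes of forms when `gcd (s + l, 2 l) = 2 gcd (s, l)`. -/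
lemma classes_double :
    (∀ P : fixed (frob p F s) × F, P ≠ 0 →
      radCard (frob p F l) (frob p F s) P.1 P.2 = 1 ∨
      radCard (frob p F l) (frob p F s) P.1 P.2 = p ^ (2 * d) ∨
      radCard (frob p F l) (frob p F s) P.1 P.2 = (p ^ (2 * d)) ^ 2) ∧
    ((radClass p F s l 1).card : ℚ) + (radClass p F s l (p ^ (2 * d))).card +
      (radClass p F s l ((p ^ (2 * d)) ^ 2)).card = (p ^ s) ^ 3 - 1 ∧
    -((radClass p F s l 1).card : ℚ) + (radClass p F s l (p ^ (2 * d))).card * p ^ d -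
      (radClass p F s l ((p ^ (2 * d)) ^ 2)).card * (p ^ d) ^ 2 = (p ^ s) ^ 2 - p ^ s ∧
    ((radClass p F s l 1).card : ℚ) + (radClass p F s l (p ^ (2 * d))).card * (p ^ d) ^ 2 +
      (radClass p F s l ((p ^ (2 * d)) ^ 2)).card * (p ^ d) ^ 4 =
      p ^ s * (1 + ((p ^ s) ^ 2 - 1) * (p ^ d + 1)) - (p ^ s) ^ 2 := by
  have hm : 0 < m := by omega
  have hp2 : p ≠ 2 := by omega
  have hd0 : 0 < d := hd ▸ Nat.gcd_pos_of_pos_left _ (by omega)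
  have h3d := three_mul_le hp hs hms hF hα hl hls hd hd'
  obtain ⟨i, j, hsi, hlj⟩ := odd_of_gcd_eq (by omega) hd hd'
  have hbar := frob_frob_self (p := p) hF hms
  have hcomm : ∀ x, frob p F l (frob p F s x) = frob p F s (frob p F l x) := frob_comm l s
  have hE := card_fixed_bar hF hα hm hms
  have hKc := card_fixed_twist hF hα hm hms hd'
  have hy1 : 1 < p ^ (2 * d) := Nat.one_lt_pow (by omega) (by omega)
  have hm2 : p ^ m = (p ^ s) ^ 2 := by rw [hms, mul_comm, pow_mul]
  have hDm : p ^ d + 1 ∣ p ^ m - 1 := by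
    have h1 : p ^ d + 1 ∣ p ^ s + 1 := by
      have := Odd.nat_add_dvd_pow_add_pow (p ^ d) 1 (n := 2 * i + 1) ⟨i, rfl⟩
      rwa [one_pow, ← pow_mul, ← hsi] at this
    refine h1.trans ⟨p ^ s - 1, ?_⟩
    rw [hms, mul_comm 2 s, pow_mul, ← Nat.sq_sub_sq, one_pow]
  have hD : (Finset.univ.filter fun μ : F => μ * frob p F s μ = 1 ∧ μ * frob p F l μ = 1).card =
      p ^ d + 1 := by
    rw [← card_pow_eq_one hF hα hm hDm]
    congr 1
    ext μ
    simp only [Finset.mem_filter_univ, isometry_iff hF hms hd' hsi hlj]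
  have htri : ∀ P : fixed (frob p F s) × F, P ≠ 0 → _ := fun P hP =>
    radCard_trichotomy hp2 hbar hcomm ((ne_zero_iff_not P).mp hP)
  simp only [hKc] at htri
  have hrad := sum_radCard hp2 hbar hD
  have hall := sum_expSum (p := p) (σ := frob p F l) (bar := frob p F s)
  have hcl : ∀ c, Finset.univ.filter (fun P : fixed (frob p F s) × F => P ≠ 0 ∧
    radCard (frob p F l) (frob p F s) P.1 P.2 = c) = radClass p F s l c := fun c => rfl
  have e0 : ∀ P ∈ radClass p F s l 1, expSum (frob p F l) (frob p F s) P.1 P.2 =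
      (-1) ^ (0 + 1) * ((p : ℂ) ^ s * p ^ (d * 0)) := fun P hP =>
    expSum_double hp hs hms hF hα hd hd' (r := s) (by simpa using hP) (by omega)
  have e1 : ∀ P ∈ radClass p F s l (p ^ (2 * d)), expSum (frob p F l) (frob p F s) P.1 P.2 =
      (-1) ^ (1 + 1) * ((p : ℂ) ^ s * p ^ (d * 1)) := fun P hP =>
    expSum_double hp hs hms hF hα hd hd' (r := s - d) (by simpa using hP) (by omega)
  have e2 : ∀ P ∈ radClass p F s l ((p ^ (2 * d)) ^ 2),
      expSum (frob p F l) (frob p F s) P.1 P.2 =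
      (-1) ^ (2 + 1) * ((p : ℂ) ^ s * p ^ (d * 2)) := fun P hP =>
    expSum_double hp hs hms hF hα hd hd' (r := s - 2 * d) (by rwa [pow_mul p (2 * d)]) (by omega)
  -- The three equations are the number of forms, the sum of the exponential sums, and the sum of
  -- the radical sizes (their second moment), each corrected by the zero form.
  have hcard := sum_split (σ := frob p F l) (bar := frob p F s) (fun _ => (1 : ℂ)) hy1 htri
  rw [sum_split (σ := frob p F l) (bar := frob p F s) _ hy1 htri] at hrad hall
  simp only [hcl] at hcard hrad hall
  rw [Finset.sum_congr rfl e0, Finset.sum_congr rfl e1, Finset.sum_congr rfl e2] at hall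
  rw [Finset.sum_congr rfl fun P hP => congrArg Nat.cast (radCard_of_mem (p := p) (F := F) hP),
    Finset.sum_congr (s₁ := radClass p F s l (p ^ (2 * d))) rfl
      fun P hP => congrArg Nat.cast (radCard_of_mem (p := p) (F := F) hP),
    Finset.sum_congr (s₁ := radClass p F s l ((p ^ (2 * d)) ^ 2)) rfl
      fun P hP => congrArg Nat.cast (radCard_of_mem (p := p) (F := F) hP)] at hrad
  have z1 : expSum (frob p F l) (frob p F s) ((0 : fixed (frob p F s) × F).1 : F)
      (0 : fixed (frob p F s) × F).2 = ((p : ℂ) ^ s) ^ 2 := by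
    simp [expSum, hF, Finset.card_univ, hm2]
  have z2 : radCard (frob p F l) (frob p F s) ((0 : fixed (frob p F s) × F).1 : F)
      (0 : fixed (frob p F s) × F).2 = (p ^ s) ^ 2 := by
    simp [radCard, hF, Finset.card_univ, hm2]
  rw [z1] at hall
  rw [z2] at hrad
  have h2d : p ^ (2 * d) = (p ^ d) ^ 2 := by rw [mul_comm, pow_mul]
  have hps : (p : ℂ) ^ s ≠ 0 := pow_ne_zero _ (Nat.cast_ne_zero.mpr (by omega))
  simp only [Finset.sum_const, nsmul_eq_mul, mul_one, Finset.card_univ, Fintype.card_prod, hE,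
    hF, hm2, mul_zero, pow_zero, h2d, pow_mul (p : ℂ) d] at hcard hrad hall
  simp only [h2d] at htri ⊢
  push_cast at hcard hrad hall
  generalize (radClass p F s l 1).card = N0 at *
  generalize (radClass p F s l ((p ^ d) ^ 2)).card = N1 at *
  generalize (radClass p F s l (((p ^ d) ^ 2) ^ 2)).card = N2 at *
  have key : ∀ u v : ℚ, ((u : ℂ) = v) → u = v := fun u v h => by exact_mod_cast h
  refine ⟨htri, key _ _ ?_, key _ _ ?_, key _ _ ?_⟩
  · push_cast
    linear_combination -hcard
  · push_cast
    apply mul_left_cancel₀ hps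
    linear_combination hall
  · push_cast
    linear_combination hrad

end

end Kasami

/-! ### The case `d' = 2 d`: solution of the linear system and the table. -/

namespace Kasami

section
variable {x y N0 N1 N2 : ℚ} (hy : 1 < y) (h1 : N0 + N1 + N2 = x ^ 3 - 1)
  (h2 : -N0 + N1 * y - N2 * y ^ 2 = x ^ 2 - x)
  (h3 : N0 + N1 * y ^ 2 + N2 * y ^ 4 = x * (1 + (x ^ 2 - 1) * (y + 1)) - x ^ 2)
include hy h1 h2 h3

/-- With `x = p ^ s` and `y = p ^ d`: `N0` is absent from `h3 - h1` and `h1 + h2`, and subtracting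
`y - 1` times the latter removes `N1`. -/
lemma double_count_two : N2 = (x / y - 1) * (x ^ 2 - 1) / ((y + 1) ^ 2 * (y - 1)) := by
  have ha : y - 1 ≠ 0 := by linarith
  have hb : y + 1 ≠ 0 := by linarith
  have hc : y ≠ 0 := by linarith
  field_simp
  linear_combination h3 - h1 - (y - 1) * (h1 + h2)

lemma double_count_one :
    N1 = y * (x + x / y + x / y ^ 2 + 1) * (x ^ 2 - 1) / (y + 1) ^ 2 := by
  have ha : y - 1 ≠ 0 := by linarith
  have hb : y + 1 ≠ 0 := by linarith
  have hc : y ≠ 0 := by linarith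
  have h : N1 = ((x ^ 2 - 1) * (x + 1) + N2 * (y ^ 2 - 1)) / (y + 1) := by
    rw [eq_div_iff hb]; linear_combination h1 + h2
  rw [h, double_count_two hy h1 h2 h3]
  field_simp
  ring

lemma double_count_zero :
    N0 = y ^ 3 * (x ^ 2 - x ^ 2 / y ^ 2 - x ^ 2 / y ^ 3 + x - x / y + 1) * (x - 1) /
      ((y + 1) ^ 2 * (y - 1)) := by
  have ha : y - 1 ≠ 0 := by linarith
  have hb : y + 1 ≠ 0 := by linarith
  have hc : y ≠ 0 := by linarith
  have h : N0 = x ^ 3 - 1 - N1 - N2 := by linear_combination h1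
  rw [h, double_count_two hy h1 h2 h3, double_count_one hy h1 h2 h3]
  field_simp
  ring

end

variable {p : ℕ} [Fact p.Prime]
variable {F : Type*} [Field F] [Algebra (ZMod p) F] [Fintype F] [DecidableEq F]

section
variable {m s l d : ℕ} (hp : 2 < p) (hs : 2 ≤ s) (hms : m = 2 * s)
    (hF : Fintype.card F = p ^ m) {α : F} (hα : IsPrimitiveRoot α (p ^ m - 1)) (hl : l < m)
    (hls : l ≠ s) (hd : d = Nat.gcd s l) (hd' : 2 * d = Nat.gcd (s + l) (2 * l))
include hp hs hms hF hα hd hd'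

/-- For the classes that occur, `a` is the dimension of the radical over the field of `p ^ (2 d)`
elements. By `expSum_double` a class has a single sign, so `t` is plus or minus its size. -/
lemma sum_formCount_double {a r : ℕ} (hr : s = d * a + r) (w : ℕ) :
    ∑ P ∈ radClass p F s l (p ^ (2 * d * a)),
      (formCount (kasamiForm (frob p F l) (frob p F s) P.1 P.2) w : ℚ) =
    (radClass p F s l (p ^ (2 * d * a))).card *
      (p * (p ^ m - p ^ (m - 2 * d * a)) * wtInd w (p ^ (m - 1) * (p - 1)) +
      p ^ (m - 2 * d * a) * signCount p m (s + d * a) ((-1) ^ (a + 1)) w) := by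
  have hm : 0 < m := by omega
  have he : 2 * d * a + r = s + d * a := by rw [hr]; ring
  have h := sum_formCount_even (by omega) (frob_frob_self (p := p) hF hms) hm hF
    (radClass p F s l (p ^ (2 * d * a))) (fun P hP => radCard_of_mem hP) (r := r)
    (by rw [hms, hr]; ring) (by omega)
    (t := (radClass p F s l (p ^ (2 * d * a))).card * (-1) ^ (a + 1)) (by
      rw [Finset.sum_congr rfl fun P hP => expSum_double hp hs hms hF hα hd hd' hP hr,
        Finset.sum_const, nsmul_eq_mul, he]
      push_cast; ring) w
  rw [h, he, generic_weight hm]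
  rcases neg_one_pow_eq_or ℤ (a + 1) with h' | h' <;>
    rcases neg_one_pow_eq_or ℚ (a + 1) with h'' | h'' <;> rw [h', h'']
  · ring
  · exfalso
    have := congrArg (Int.cast : ℤ → ℚ) h'
    push_cast at this
    rw [h''] at this; norm_num at this
  · exfalso
    have := congrArg (Int.cast : ℤ → ℚ) h'
    push_cast at this
    rw [h''] at this; norm_num at this
  · ring

include hl hls

theorem weightDistribution_double :
    HasWeightDistribution (dualExtDualKasamiCode p m s l α) (tableDouble p m s d) := by
  intro w
  have hm : 0 < m := by omega
  have hd0 : 0 < d := hd ▸ Nat.gcd_pos_of_pos_left _ (by omega)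
  have h3d := three_mul_le hp hs hms hF hα hl hls hd hd'
  have hp2 : p ≠ 2 := by omega
  have hbar := frob_frob_self (p := p) hF hms
  obtain ⟨htri, hc1, hc2, hc3⟩ := classes_double hp hs hms hF hα hl hls hd hd'
  have hpQ : (0 : ℚ) < p := by exact_mod_cast (by omega : 0 < p)
  have hx2 : (p : ℚ) ^ m = (p ^ s) ^ 2 := by rw [hms, mul_comm, pow_mul]
  have hx3 : (p : ℚ) ^ (3 * s) = (p ^ s) ^ 3 := by rw [mul_comm, pow_mul]
  have hy2 : (p : ℚ) ^ (2 * d) = (p ^ d) ^ 2 := by rw [mul_comm, pow_mul]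
  have hy3 : (p : ℚ) ^ (3 * d) = (p ^ d) ^ 3 := by rw [mul_comm, pow_mul]
  have hy4 : (p : ℚ) ^ (4 * d) = (p ^ d) ^ 4 := by rw [mul_comm, pow_mul]
  have hy5 : (p : ℚ) ^ (5 * d) = (p ^ d) ^ 5 := by rw [mul_comm, pow_mul]
  have hy1 : (1 : ℚ) < p ^ d := by
    exact_mod_cast (Nat.one_lt_pow hd0.ne' (by omega) : 1 < p ^ d)
  have hN0 := double_count_zero hy1 hc1 hc2 hc3
  have hN1 := double_count_one hy1 hc1 hc2 hc3
  have hN2 := double_count_two hy1 hc1 hc2 hc3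
  have hS0 := sum_formCount_double hp hs hms hF hα hd hd' (a := 0) (r := s) (by omega) w
  have hS1 := sum_formCount_double hp hs hms hF hα hd hd' (a := 1) (r := s - d) (by omega) w
  have hS2 := sum_formCount_double hp hs hms hF hα hd hd' (a := 2) (r := s - 2 * d) (by omega) w
  rw [mul_zero, mul_zero, pow_zero, zero_add, pow_one, hN0,
    signCount_neg_one (g := s) (by omega) (by omega)] at hS0
  rw [mul_one, mul_one, one_add_one_eq_two, neg_one_sq, hN1,
    signCount_one (g := s - d) (by omega) (by omega)] at hS1
  rw [pow_mul p (2 * d), hN2, show 2 * d * 2 = 4 * d by ring, mul_comm d 2,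
    show (-1 : ℤ) ^ (2 + 1) = -1 by norm_num,
    signCount_neg_one (g := s - 2 * d) (by omega) (by omega)] at hS2
  rw [weightCount_dualExtDual hF hp hs hms hl hls hα, Nat.cast_sum,
    sum_split (σ := frob p F l) (bar := frob p F s)
      (fun P => (formCount (kasamiForm (frob p F l) (frob p F s) P.1 P.2) w : ℚ))
      (Nat.one_lt_pow (by omega) (by omega)) htri]
  have hcl : ∀ c, Finset.univ.filter (fun P : fixed (frob p F s) × F => P ≠ 0 ∧
    radCard (frob p F l) (frob p F s) P.1 P.2 = c) = radClass p F s l c := fun c => rfl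
  have hz : (formCount (kasamiForm (frob p F l) (frob p F s)
      ((0 : fixed (frob p F s) × F).1 : F) (0 : fixed (frob p F s) × F).2) w : ℚ) = _ :=
    formCount_zero hp2 hbar hm hF w
  rw [hcl, hcl, hcl, hS0, hS1, hS2, hz, generic_weight hm, sum_filter_eq_sum_wtInd]
  simp only [tableDouble, List.map_cons, List.map_nil, List.sum_cons, List.sum_nil, Nat.sub_zero]
  rw [pow_sub_eq_div (a := 3 * s) (b := d) (by omega),
    pow_sub_eq_div (a := 3 * s) (b := 2 * d) (by omega),
    pow_sub_eq_div (a := 3 * s) (b := 3 * d) (by omega),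
    pow_sub_eq_div (a := 3 * s) (b := 4 * d) (by omega),
    pow_sub_eq_div (a := 3 * s) (b := 5 * d) (by omega),
    pow_sub_eq_div (a := m) (b := d) (by omega), pow_sub_eq_div (a := m) (b := 2 * d) (by omega),
    pow_sub_eq_div (a := m) (b := 3 * d) (by omega), pow_sub_eq_div (a := m) (b := 4 * d) (by omega),
    pow_sub_eq_div (a := s) (b := d) (by omega), pow_sub_eq_div (a := s) (b := 2 * d) (by omega),
    pow_add _ m (3 * d), hx2, hx3, hy2, hy3, hy4, hy5]
  have hy0 : (p : ℚ) ^ d ≠ 0 := by positivity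
  have hya : (p : ℚ) ^ d - 1 ≠ 0 := by linarith
  have hyb : (p : ℚ) ^ d + 1 ≠ 0 := by linarith
  have hyc : ((p : ℚ) ^ d) ^ 2 - 1 = (p ^ d - 1) * (p ^ d + 1) := by ring
  rw [hyc]
  generalize (p : ℚ) ^ s = x at *
  generalize (p : ℚ) ^ d = y at *
  generalize wtInd w _ = W0
  generalize wtInd w _ = W1
  generalize wtInd w _ = W2
  generalize wtInd w _ = W3
  generalize wtInd w _ = W4
  generalize wtInd w _ = W5
  generalize wtInd w _ = W6
  generalize wtInd w _ = W7
  generalize wtInd w _ = W8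
  field_simp
  ring

end

end Kasami

/-! ### Assembly of the three cases. -/

theorem mainTheorem1 (p m s l d d' : ℕ) [Fact p.Prime] (hp : Odd p)
    (hms : m = 2 * s) (hm : 4 ≤ m) (hl : l ≤ m - 1) (hls : l ≠ s)
    (hd : d = Nat.gcd s l) (hd' : d' = Nat.gcd (s + l) (2 * l))
    {F : Type*} [Field F] [Algebra (ZMod p) F] (hF : Nat.card F = p ^ m)
    (α : F) (hα : IsPrimitiveRoot α (p ^ m - 1)) :
    -- the length is `p ^ m`, and the coordinates are labelled by the elements of the field
    p ^ m - 1 + 1 = p ^ m ∧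
    Function.Bijective (coordPoint (p ^ m - 1) α) ∧
    -- the codewords, with `a` in the subfield of `p ^ s` elements
    (∀ v : Fin (p ^ m - 1 + 1) → ZMod p,
      v ∈ dualExtDualKasamiCode p m s l α ↔
        ∃ a b c : F, ∃ h : ZMod p, a ^ p ^ s = a ∧
          ∀ i, algebraMap (ZMod p) F (v i) =
            absTrace p s (a * coordPoint (p ^ m - 1) α i ^ (p ^ s + 1)) +
            absTrace p m (b * coordPoint (p ^ m - 1) α i ^ (p ^ l + 1) +
              c * coordPoint (p ^ m - 1) α i) +
            algebraMap (ZMod p) F h) ∧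
    -- the dimension
    Module.finrank (ZMod p) (dualExtDualKasamiCode p m s l α) = 5 * m / 2 + 1 ∧
    -- the weight distribution
    (d' = d ∨ d' = 2 * d) ∧
    (d' = d → Odd d →
      HasWeightDistribution (dualExtDualKasamiCode p m s l α) (tableOdd p m s d) ∧
      numWeights (dualExtDualKasamiCode p m s l α) ≤ 10) ∧
    (d' = d → Even d →
      HasWeightDistribution (dualExtDualKasamiCode p m s l α) (tableEven p m s d) ∧
      numWeights (dualExtDualKasamiCode p m s l α) ≤ 12) ∧
    (d' = 2 * d →
      HasWeightDistribution (dualExtDualKasamiCode p m s l α) (tableDouble p m s d) ∧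
      numWeights (dualExtDualKasamiCode p m s l α) ≤ 8) := by
  classical
  have hpp : p.Prime := Fact.out
  have hp2 : 2 < p := by
    have := hpp.two_le
    rcases hp with ⟨k, hk⟩
    omega
  have hs : 2 ≤ s := by omega
  have hl' : l < m := by omega
  have hpm : 0 < p ^ m := pow_pos hpp.pos m
  have : Finite F := Nat.finite_of_card_ne_zero (by omega)
  have := Fintype.ofFinite F
  rw [Nat.card_eq_fintype_card] at hF
  refine ⟨by omega, Kasami.coordPoint_bijective hms hF hα (by omega),
    Kasami.mem_dualExtDual_iff hp2 hs hms hl' hls hF hα,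
    Kasami.finrank_dualExtDual hF hp2 hs hms hl' hls hα, Kasami.gcd_cases (by omega) hd hd', ?_, ?_,
    ?_⟩
  · rintro rfl ho
    have h := Kasami.weightDistribution_odd hp2 hs hms hF hα hl' hls hd hd' ho
    exact ⟨h, Kasami.numWeights_le h rfl⟩
  · rintro rfl he
    have h := Kasami.weightDistribution_even hp2 hs hms hF hα hl' hls hd hd' he
    exact ⟨h, Kasami.numWeights_le h rfl⟩
  · rintro rfl
    have h := Kasami.weightDistribution_double hp2 hs hms hF hα hl' hls hd hd'
    exact ⟨h, Kasami.numWeights_le h rfl⟩
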